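/- Fix an integer bucket size $b\ge 1$ and $0<\alpha<1$. Let $T(z)=\sum_{n\ge1}\frac{n^{n-1}}{n!}z^n$ be the tree function, $\omega=e^{2\pi i/b}$ and $\zeta_\ell=T(\omega^\ell\alpha e^{-\alpha})/\alpha$ for $0\le\ell\le b-1$. **Infinite Poisson model.** Let $X_i$, $i\in\mathbb Z$, be independent Poisson variables with mean $b\alpha$ ($X_i$ is the number of keys with hash address $i$), and let $Q_\alpha=Q_{\alpha;-1}=\max_{j\le -1}\sum_{k=j+1}^{-1}(X_k-b)$, which is almost surely finite, be the number of keys that overflow from bucket $-1$ into bucket $0$. A new key that hashes to bucket $0$ is added. Given $(X_i)_{i\in\mathbb Z}$, the number $V_\alpha$ of keys that hash to $0$ and win over the new key is uniform on $\{0,\dots,X_0\}$. Let $C_\alpha=Q_\alpha+V_\alpha$ be the number of keys that win over the new key and $D^{RH}_\alpha=\lfloor C_\alpha/b\rfloor$ its Robin Hood displacement. Write $\psi_V,\psi_Q,\psi_C,\psi_{RH}$ for the probability generating functions $q\mapsto \mathbb E\,q^{Y}$ of $V_\alpha,Q_\alpha,C_\alpha,D^{RH}_\alpha$. **Exact model.**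 $n$ keys, with distinct linearly ordered values, have independent uniformly random hash addresses in $\mathbb Z_m$, and are inserted, in an arbitrary fixed order, by linear probing with the Robin Hood heuristic into $m$ buckets of capacity $b$: when a key probes a full bucket, then among that key and the keys in the bucket the one that has probed the fewest buckets moves on to the next bucket (cyclically); in case of a tie, the one with the largest value moves on. One of the $n$ keys is selected uniformly at random, independently of the hash addresses. Let $V_{m,n}$ be the number of keys with the same hash address as the selected key and smaller value (i.e. that win over it), let $C_{m,n}$ be the sum of $V_{m,n}$ and the number of keys that overflow into the home bucket of the selected key from the preceding bucket, and let $D^{RH}_{m,n}$ be the displacement of the selected key in the final table (the number of steps from its home bucket to the bucket containing it). **Theorem.** (i) For every $q\in\mathbb C$, $\psi_V(q)$ converges absolutely and, for $q\ne1$, $$\psi_V(q)=\frac{1-e^{b\alpha(q-1)}}{b\alpha(1-q)}.$$ (ii) For every $q\in\mathbb C$ with $\mathbb E|q|^{C_\alpha}<\infty$, $$\psi_C(q)=\psi_Q(q)\psi_V(q)=\frac{1-\alpha}{\alpha}\,\frac{1-e^{b\alpha(q-1)}}{e^{b\alpha(q-1)}-q^b}\,\frac{\prod_{\ell=1}^{b-1}(q-\zeta_\ell)}{\prod_{\ell=1}^{b-1}(1-\zeta_\ell)},$$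 where the last equality is asserted for $e^{b\alpha(q-1)}\ne q^b$. (iii) For every $q\in\mathbb C\setminus\{0,1\}$ with $\mathbb E|q|^{D^{RH}_\alpha}<\infty$ and every choice of the root $q^{1/b}$, $$\psi_{RH}(q)=\frac1b\sum_{j=0}^{b-1}\psi_C(\omega^jq^{1/b})\,\frac{1-q^{-1}}{1-\omega^{-j}q^{-1/b}}.$$ (iv) There is $\delta>0$ such that $\psi_C$ and $\psi_{RH}$ converge absolutely for $|q|\le1+\delta$, and such that whenever $m,n\to\infty$ with $n/(bm)\to\alpha$, we have $V_{m,n}\to V_\alpha$, $C_{m,n}\to C_\alpha$ and $D^{RH}_{m,n}\to D^{RH}_\alpha$ in distribution, with convergence of all moments (the limiting moments being finite), and the corresponding probability generating functions converge to $\psi_V$, $\psi_C$ and $\psi_{RH}$, uniformly for $|q|\le1+\delta$. -/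

import Mathlib

open MeasureTheory ProbabilityTheory Filter Topology

namespace RobinHood

/-! ## Analytic quantities -/

/-- The tree function `T(z) = ∑_{n ≥ 1} n^(n-1) z^n / n!` (the summation index is `n - 1`). -/
noncomputable def treeT (z : ℂ) : ℂ :=
  ∑' n : ℕ, ((n + 1 : ℂ) ^ n / ((n + 1).factorial : ℂ)) * z ^ (n + 1)

/-- The primitive `b`-th root of unity `ω = e^(2πi/b)`. -/
noncomputable def rootU (b : ℕ) : ℂ :=
  Complex.exp (2 * Real.pi * Complex.I / b)

/-- The numbers `ζ_ℓ = T(ω^ℓ α e^(-α)) / α`. -/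
noncomputable def zeta (b : ℕ) (α : ℝ) (l : ℕ) : ℂ :=
  treeT (rootU b ^ l * (α : ℂ) * Complex.exp (-(α : ℂ))) / (α : ℂ)

/-- The probability generating function `q ↦ E q^Y` of a random variable `Y` with values
in the nonnegative integers. -/
noncomputable def pgf {Ω : Type*} [MeasurableSpace Ω] (P : Measure Ω) (Y : Ω → ℕ) (q : ℂ) : ℂ :=
  ∫ ω, q ^ Y ω ∂P

/-- The moment `E Y^r`. -/
noncomputable def moment {Ω : Type*} [MeasurableSpace Ω] (P : Measure Ω) (Y : Ω → ℕ)
    (r : ℕ) : ℝ :=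
  ∫ ω, (Y ω : ℝ) ^ r ∂P

/-! ## The infinite Poisson model

`X i` is the number of keys with hash address `i ∈ ℤ`. -/

/-- The overflow `Q_i = max_{j ≤ i} ∑_{k=j+1}^i (X_k - b)` of the hash table on `ℤ` (here
`j = i - L`).  This is the minimal solution of `H_i = X_i + Q_{i-1}`, `Q_i = (H_i - b)_+`. -/
noncomputable def overflow (b : ℕ) (X : ℤ → ℕ) (i : ℤ) : ℕ :=
  (⨆ L : ℕ, ∑ k ∈ Finset.range L, ((X (i - k) : ℤ) - (b : ℤ))).toNat

/-- The law of the table on `ℤ`: independent `X i`, each Poisson with mean `b α`. -/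
noncomputable def tableLaw (b : ℕ) (α : ℝ) : Measure (ℤ → ℕ) :=
  Measure.infinitePi fun _ : ℤ => poissonMeasure (b * α).toNNReal

/-- Given the table, the conditional law of the number of keys that hash to bucket `0` and win
over the new key: uniform on `{0, …, X 0}`. -/
noncomputable def tieKernel : Kernel (ℤ → ℕ) ℕ :=
  (Kernel.ofFunOfCountable fun k : ℕ =>
    (PMF.uniformOfFinset (Finset.range (k + 1)) Finset.nonempty_range_add_one).toMeasure).comap
    (fun X : ℤ → ℕ => X 0) (measurable_pi_apply 0)

/-- The infinite Poisson model with a new key hashing to bucket `0`: the joint law of the table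
and of the number `V` of keys that hash to `0` and win over the new key. -/
noncomputable def poissonModel (b : ℕ) (α : ℝ) : Measure ((ℤ → ℕ) × ℕ) :=
  (tableLaw b α).compProd tieKernel

instance (b : ℕ) (α : ℝ) : IsProbabilityMeasure (tableLaw b α) := by
  unfold tableLaw; infer_instance

instance : IsMarkovKernel tieKernel := by
  unfold tieKernel
  have : IsMarkovKernel (Kernel.ofFunOfCountable fun k : ℕ =>
      (PMF.uniformOfFinset (Finset.range (k + 1)) Finset.nonempty_range_add_one).toMeasure) :=
    ⟨fun k => PMF.toMeasure.isProbabilityMeasure _⟩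
  infer_instance

instance (b : ℕ) (α : ℝ) : IsProbabilityMeasure (poissonModel b α) := by
  unfold poissonModel; infer_instance

/-- `V_α`. -/
def Vinf (ω : (ℤ → ℕ) × ℕ) : ℕ := ω.2

/-- `Q_{α;-1}`, the number of keys that overflow into bucket `0`. -/
noncomputable def Qinf (b : ℕ) (ω : (ℤ → ℕ) × ℕ) : ℕ := overflow b ω.1 (-1)

/-- `C_α = Q_{α;-1} + V_α`, the number of keys that win over the new key. -/
noncomputable def Cinf (b : ℕ) (ω : (ℤ → ℕ) × ℕ) : ℕ := Qinf b ω + Vinf ω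

/-- The Robin Hood displacement `⌊C_α / b⌋` of the new key. -/
noncomputable def Dinf (b : ℕ) (ω : (ℤ → ℕ) × ℕ) : ℕ := Cinf b ω / b

/-! ## The exact model: Robin Hood hashing with `n` keys in `m` buckets of capacity `b`

Buckets are the elements of `Fin m`, with cyclic addition; keys are the elements of `Fin n`, and
the order of `Fin n` is the order of the key values that is used to break ties.  A hash function
is a map `h : Fin n → Fin m`, and a table assigns to each bucket the set of keys stored in it. -/

/-- The number of steps from the home bucket `h y` to bucket `i`, cyclically. -/
def steps {m n : ℕ} (h : Fin n → Fin m) (i : Fin m) (y : Fin n) : ℕ := (i - h y : Fin m).val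

/-- The keys of `B` that have probed least when competing for bucket `i`. -/
def leastProbed {m n : ℕ} (h : Fin n → Fin m) (i : Fin m) (B : Finset (Fin n)) :
    Finset (Fin n) :=
  B.filter fun y => ∀ z ∈ B, steps h i y ≤ steps h i z

lemma leastProbed_nonempty {m n : ℕ} (h : Fin n → Fin m) (i : Fin m) {B : Finset (Fin n)}
    (hB : B.Nonempty) : (leastProbed h i B).Nonempty := by
  obtain ⟨y, hy, hmin⟩ := B.exists_min_image (steps h i) hB
  exact ⟨y, Finset.mem_filter.mpr ⟨hy, hmin⟩⟩

/-- The key of `B` that loses the competition for bucket `i`: one that has probed least, and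
among these the one with the largest value. -/
def loser {m n : ℕ} (h : Fin n → Fin m) (i : Fin m) (B : Finset (Fin n)) (hB : B.Nonempty) :
    Fin n :=
  (leastProbed h i B).max' (leastProbed_nonempty h i hB)

/-- The key `x` probes bucket `i` of the table `t`.  If there is room it is stored there;
otherwise the loser among `x` and the keys of bucket `i` has to leave and probes bucket `i + 1`.
The first argument bounds the number of probes (`m` probes always suffice in a non-full table). -/
def probe {m n : ℕ} [NeZero m] (b : ℕ) (h : Fin n → Fin m) :
    ℕ → Fin m → Fin n → (Fin m → Finset (Fin n)) → (Fin m → Finset (Fin n))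
  | 0, _, _, t => t
  | s + 1, i, x, t =>
    if (t i).card < b then Function.update t i (insert x (t i))
    else
      probe b h s (i + 1) (loser h i (insert x (t i)) (Finset.insert_nonempty x (t i)))
        (Function.update t i ((insert x (t i)).erase
          (loser h i (insert x (t i)) (Finset.insert_nonempty x (t i)))))

/-- The Robin Hood table obtained from the empty table by inserting the keys of a list, in the
order of the list. -/
def rhTable {m n : ℕ} [NeZero m] (b : ℕ) (h : Fin n → Fin m) (order : List (Fin n)) :
    Fin m → Finset (Fin n) :=
  order.foldl (fun t x => probe b h m (h x) x t) fun _ => ∅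

/-- The displacement of the key `y` in the table `t`: the number of steps from its home bucket to
the bucket that contains it. -/
def disp {m n : ℕ} (h : Fin n → Fin m) (t : Fin m → Finset (Fin n)) (y : Fin n) : ℕ :=
  ∑ i with y ∈ t i, steps h i y

/-- The overflow from bucket `i` in the table `t`: the number of keys that tried bucket `i` but
were transferred to the next bucket. -/
def overflowAt {m n : ℕ} (h : Fin n → Fin m) (t : Fin m → Finset (Fin n)) (i : Fin m) : ℕ :=
  (Finset.univ.filter fun y : Fin n => steps h i y < disp h t y).card

/-- The sample space of the exact model: a hash function together with a marked key. -/
abbrev ExactSpace (m n : ℕ) : Type := (Fin n → Fin m) × Fin n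

/-- The exact model: independent uniformly random hash addresses of the `n` keys, and an
independent uniformly random marked key. -/
noncomputable def exactModel (m n : ℕ) [NeZero m] [NeZero n] : Measure (ExactSpace m n) :=
  (PMF.uniformOfFintype (ExactSpace m n)).toMeasure

instance (m n : ℕ) [NeZero m] [NeZero n] : IsProbabilityMeasure (exactModel m n) := by
  unfold exactModel; infer_instance

/-- The table of the exact model when the keys are inserted in the order
`σ 0, σ 1, …, σ (n - 1)`. -/
def exactTable {m n : ℕ} [NeZero m] (b : ℕ) (σ : Equiv.Perm (Fin n)) (h : Fin n → Fin m) :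
    Fin m → Finset (Fin n) :=
  rhTable b h (List.ofFn σ)

/-- `V_{m,n}`: the number of keys that have the same hash address as the marked key and win over
it, i.e. have a smaller value. -/
def Vex {m n : ℕ} (ω : ExactSpace m n) : ℕ :=
  (Finset.univ.filter fun y : Fin n => ω.1 y = ω.1 ω.2 ∧ y < ω.2).card

/-- `C_{m,n}`: the number of keys that win over the marked key, which is the sum of the number of
keys that overflow into its home bucket and of `V_{m,n}`. -/
def Cex {m n : ℕ} [NeZero m] (b : ℕ) (σ : Equiv.Perm (Fin n)) (ω : ExactSpace m n) : ℕ :=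
  overflowAt ω.1 (exactTable b σ ω.1) (ω.1 ω.2 - 1) + Vex ω

/-- `D_{m,n}`: the Robin Hood displacement of the marked key. -/
def Dex {m n : ℕ} [NeZero m] (b : ℕ) (σ : Equiv.Perm (Fin n)) (ω : ExactSpace m n) : ℕ :=
  disp ω.1 (exactTable b σ ω.1) ω.2

end RobinHood

/-!
Both models reduce to one random walk. A Robin Hood table is *legal* when every bucket that a key
passes on its way is full of keys that win over it; insertion preserves this (`Legal.probe`), in any
order. In a legal table the winners over a key fill the buckets from its home on, so its
displacement is `⌊C / b⌋` (`Legal.disp_eq_div`), and conservation of keys gives the queueing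
recursion `Q_i = (Q_{i-1} + X_i - b)_+` on the circle, hence the overflow is the maximum of the walk
with steps `X_{i-k} - b` once around the circle (`overflowAt_eq_walkMax`).

The marked key of the exact model sees a size-biased home bucket: the law of `(Q, V)` is the average
over a fixed bucket, summed over its keys and divided by the mean number of keys
(`integral_exactModel`). In the Poisson model size-biasing the Poisson number of keys in the bucket
amounts to adding one key, so the same formula holds (`lintegral_poissonModel`); `SizeBiased` is the
common form.

*Generating functions.* In the Poisson model `Q` and `V` are independent. The function `ψ_V` comes
from summation by parts in `P(V = v) = P(X > v) / (bα)`. Taking expectations in the recursion gives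
`(q^b - e^{bα(q-1)}) ψ_Q(q) = p(q)` with a polynomial `p` of degree at most `b`
(`integral_pow_walkMax`). From `T = z e^T` (`treeT_eq_mul_exp`, a consequence of Abel's binomial
identity) it follows that `1 = ζ_0, …, ζ_{b-1}` are `b` distinct solutions of `q^b = e^{bα(q-1)}` in
the closed unit disc, where `ψ_Q` converges; they are therefore all the roots of `p`. The remaining
constant is found by letting `q → 1` (`integral_pow_walkMax_mul`). The formula for `ψ_RH` is a
roots-of-unity filter (`rootsOfUnity_filter`).

*Convergence.* The occupancy counts of finitely many buckets converge to independent Poisson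
variables (`tendsto_countsLaw_window`), and their exponential moments are at most those of
independent Poisson variables with mean `n / m` (`lintegral_countsLaw_le`). For a base `r > 1` close
to `1`, the walk drifts to `-∞` at an exponential rate uniformly in all loads below a bound less than
`1`. This bounds `E r^C` uniformly and makes late excursions of the walk unlikely, so the joint law
of the inflow and the home count converges (`tendsto_inflow_and_lt`). Pointwise convergence of the
probabilities with a common exponential moment of base `r` gives convergence of the moments, and of
the generating functions uniformly on discs of radius less than `r` (`TiltedConv`).
-/

namespace RobinHood

/-! ### The tree function -/

/-- The finite-difference evaluation of Abel's sum at the point where it vanishes. -/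
lemma abel_sum_neg_one (n : ℕ) :
    ∑ j ∈ Finset.range (n + 2), ((n + 1).choose j : ℂ) * (j + 1 : ℂ) ^ (j - 1) *
      (-1 - j : ℂ) ^ (n + 1 - j) = 0 := by
  have h := congrFun (fwdDiff_iter_pow_eq_zero_of_lt (R := ℂ) (Nat.lt_succ_self n)) 1
  rw [fwdDiff_iter_eq_sum_shift] at h
  simp only [Pi.zero_apply] at h
  rw [← h]
  refine Finset.sum_congr rfl fun j hj => ?_
  have hj' : j ≤ n + 1 := by simpa [Nat.lt_succ_iff] using hj
  have e : (-1 - j : ℂ) = (-1) * (j + 1) := by ring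
  rw [e, mul_pow]
  rcases Nat.eq_zero_or_pos j with rfl | hpos
  · simp
  · have e2 : (j + 1 : ℂ) ^ n = (j + 1 : ℂ) ^ (j - 1) * (j + 1) ^ (n + 1 - j) := by
      rw [← pow_add]; congr 1; omega
    simp only [nsmul_eq_mul, mul_one, zsmul_eq_mul]
    push_cast
    rw [add_comm (1 : ℂ) j, e2]
    ring

/-- Abel's binomial identity, in the special case behind the tree function. -/
lemma abel_sum (n : ℕ) (y : ℂ) :
    ∑ j ∈ Finset.range (n + 1), (n.choose j : ℂ) * (j + 1 : ℂ) ^ (j - 1) * (y - j) ^ (n - j) =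
      (y + 1) ^ n := by
  induction n generalizing y with
  | zero => simp
  | succ n ih =>
    -- Both sides have the same derivative in `y`, and they agree at `y = -1`.
    let f : ℂ → ℂ := fun y => (∑ j ∈ Finset.range (n + 1 + 1), ((n + 1).choose j : ℂ) *
      (j + 1 : ℂ) ^ (j - 1) * (y - j) ^ (n + 1 - j)) - (y + 1) ^ (n + 1)
    have hf : ∀ y, HasDerivAt f 0 y := by
      intro y
      have h1 : HasDerivAt f ((∑ j ∈ Finset.range (n + 1 + 1), ((n + 1).choose j : ℂ) *
          (j + 1 : ℂ) ^ (j - 1) * (((n + 1 - j : ℕ) : ℂ) * (y - j) ^ (n + 1 - j - 1) * 1)) -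
          ((n + 1 : ℕ) : ℂ) * (y + 1) ^ (n + 1 - 1) * 1) y := by
        refine HasDerivAt.sub (HasDerivAt.fun_sum fun j _ => ?_) ?_
        · exact (((hasDerivAt_id y).sub_const (j : ℂ)).pow _).const_mul _
        · exact ((hasDerivAt_id y).add_const (1 : ℂ)).pow _
      convert h1 using 1
      rw [Finset.sum_range_succ]
      simp only [Nat.sub_self, Nat.cast_zero, zero_mul, mul_zero, add_zero, Nat.add_sub_cancel,
        mul_one]
      rw [← ih y, Finset.mul_sum, eq_comm, sub_eq_zero]
      refine Finset.sum_congr rfl fun j hj => ?_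
      have hj' : j ≤ n := by simpa [Nat.lt_succ_iff] using hj
      have e : ((n + 1).choose j : ℂ) * ((n + 1 - j : ℕ) : ℂ) = (n + 1 : ℕ) * (n.choose j : ℂ) := by
        have := Nat.choose_mul_succ_eq n j
        rw [mul_comm] at this
        exact_mod_cast this.symm
      have e2 : n + 1 - j - 1 = n - j := by omega
      rw [e2]
      linear_combination ((j + 1 : ℂ) ^ (j - 1) * (y - j) ^ (n - j)) * e
    have hc := is_const_of_deriv_eq_zero (fun y => (hf y).differentiableAt)
      (fun y => (hf y).deriv) y (-1)
    have h0 : f (-1) = 0 := by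
      simp only [f]
      rw [abel_sum_neg_one]
      simp
    rw [h0] at hc
    exact sub_eq_zero.mp hc

/-- The coefficients of `T(z) / z`. -/
noncomputable def treeCoeff (n : ℕ) : ℝ := (n + 1 : ℝ) ^ n / ((n + 1).factorial : ℝ)

lemma treeCoeff_nonneg (n : ℕ) : 0 ≤ treeCoeff n := by unfold treeCoeff; positivity

/-- Hence the radius of convergence is at least `e⁻¹`. -/
lemma succ_mul_treeCoeff_le (n : ℕ) : (n + 1) * treeCoeff n ≤ Real.exp 1 ^ (n + 1) := by
  have h := Real.pow_div_factorial_le_exp (n + 1 : ℝ) (by positivity) (n + 1)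
  rw [← Real.exp_nat_mul, mul_one]
  push_cast
  refine le_trans (le_of_eq ?_) h
  unfold treeCoeff
  rw [pow_succ]; ring

/-- The identity `(T/z)' = T' (T/z)`, for the coefficients; by Abel's binomial identity. -/
lemma treeCoeff_convolution (n : ℕ) :
    ((n : ℂ) + 1) * treeCoeff (n + 1) = ∑ kl ∈ Finset.HasAntidiagonal.antidiagonal n,
      (((kl.1 : ℂ) + 1) * treeCoeff kl.1) * treeCoeff kl.2 := by
  have h := abel_sum n (n + 1)
  rw [← Finset.Nat.sum_antidiagonal_eq_sum_range_succ
    (fun j k => (n.choose j : ℂ) * (j + 1 : ℂ) ^ (j - 1) * ((n + 1 : ℂ) - j) ^ k),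
    ← Finset.Nat.sum_antidiagonal_swap] at h
  have hn : (n.factorial : ℂ) ≠ 0 := by exact_mod_cast n.factorial_ne_zero
  have lhs : ((n : ℂ) + 1) * treeCoeff (n + 1) = (n + 1 + 1 : ℂ) ^ n / n.factorial := by
    unfold treeCoeff
    have h1 : (n + 1 : ℂ) ≠ 0 := by exact_mod_cast n.succ_ne_zero
    have h2 : (n + 1 + 1 : ℂ) ≠ 0 := by exact_mod_cast (n + 1).succ_ne_zero
    rw [Nat.factorial_succ, Nat.factorial_succ]
    push_cast
    field_simp
    ring
  rw [lhs, ← h, Finset.sum_div]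
  refine Finset.sum_congr rfl fun kl hkl => ?_
  obtain ⟨k, l⟩ := kl
  have hkl' : k + l = n := by simpa using hkl
  subst hkl'
  simp only [Prod.swap]
  have hc : ((k + l).choose l : ℂ) * (k.factorial * l.factorial) = (k + l).factorial := by
    have := Nat.add_choose_mul_factorial_mul_factorial k l
    have h3 : (((k + l).choose l * k.factorial * l.factorial : ℕ) : ℂ) = (k + l).factorial := by
      rw [this]
    push_cast at h3
    rw [← h3]; ring
  have hk : (k.factorial : ℂ) ≠ 0 := by exact_mod_cast k.factorial_ne_zero
  have hl : (l.factorial : ℂ) ≠ 0 := by exact_mod_cast l.factorial_ne_zero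
  have hl1 : (l + 1 : ℂ) ≠ 0 := by exact_mod_cast l.succ_ne_zero
  have hk1 : (k + 1 : ℂ) ≠ 0 := by exact_mod_cast k.succ_ne_zero
  have e1 : ((k : ℂ) + 1) * treeCoeff k = (k + 1 : ℂ) ^ k / k.factorial := by
    unfold treeCoeff
    rw [Nat.factorial_succ]; push_cast; field_simp
  have e2 : (treeCoeff l : ℂ) = (l + 1 : ℂ) ^ (l - 1) / l.factorial := by
    unfold treeCoeff
    rw [Nat.factorial_succ]; push_cast
    rcases Nat.eq_zero_or_pos l with rfl | hp
    · simp
    · obtain ⟨i, rfl⟩ : ∃ i, l = i + 1 := ⟨l - 1, by omega⟩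
      rw [Nat.add_sub_cancel, pow_succ]
      field_simp
  rw [e1, e2, ← hc]
  push_cast
  rw [show (k + l + 1 - l : ℂ) = k + 1 by ring]
  have hch : ((k + l).choose l : ℂ) ≠ 0 := by
    exact_mod_cast (Nat.choose_pos (Nat.le_add_left l k)).ne'
  field_simp

lemma summable_treeCoeff_deriv {ρ : ℝ} (h0 : 0 ≤ ρ) (h1 : ρ < Real.exp (-1)) :
    Summable fun n : ℕ => (n + 1) * treeCoeff n * ρ ^ n := by
  have hlt : Real.exp 1 * ρ < 1 := by
    calc Real.exp 1 * ρ < Real.exp 1 * Real.exp (-1) := by gcongr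
      _ = 1 := by rw [← Real.exp_add]; simp
  have hs : Summable fun n : ℕ => Real.exp 1 * (Real.exp 1 * ρ) ^ n :=
    (summable_geometric_of_lt_one (by positivity) hlt).mul_left _
  refine Summable.of_nonneg_of_le (fun n => ?_) (fun n => ?_) hs
  · have := treeCoeff_nonneg n; positivity
  · calc (n + 1) * treeCoeff n * ρ ^ n ≤ Real.exp 1 ^ (n + 1) * ρ ^ n := by
          gcongr; exact succ_mul_treeCoeff_le n
      _ = _ := by rw [mul_pow]; ring

lemma summable_treeCoeff {ρ : ℝ} (h0 : 0 ≤ ρ) (h1 : ρ < Real.exp (-1)) :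
    Summable fun n : ℕ => treeCoeff n * ρ ^ n := by
  refine Summable.of_nonneg_of_le (fun n => ?_) (fun n => ?_) (summable_treeCoeff_deriv h0 h1)
  · have := treeCoeff_nonneg n; positivity
  · have := treeCoeff_nonneg n
    gcongr
    nlinarith [(Nat.cast_nonneg n : (0 : ℝ) ≤ n)]

lemma treeT_eq_tsum (z : ℂ) : treeT z = ∑' n : ℕ, (treeCoeff n : ℂ) * z ^ (n + 1) := by
  unfold treeT treeCoeff
  push_cast
  rfl

/-- The series `T(z) / z`. -/
noncomputable def treeQuot (z : ℂ) : ℂ := ∑' n : ℕ, (treeCoeff n : ℂ) * z ^ n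

lemma treeT_eq_mul (z : ℂ) : treeT z = z * treeQuot z := by
  rw [treeT_eq_tsum, treeQuot, ← tsum_mul_left]
  congr 1; ext n; ring

/-- The series `T'(z)`. -/
noncomputable def treeDeriv (z : ℂ) : ℂ := ∑' n : ℕ, (((n : ℂ) + 1) * treeCoeff n) * z ^ n

lemma norm_succ_mul_treeCoeff (n : ℕ) (z : ℂ) :
    ‖(((n : ℂ) + 1) * treeCoeff n) * z ^ n‖ = (n + 1) * treeCoeff n * ‖z‖ ^ n := by
  rw [norm_mul, norm_mul, norm_pow, Complex.norm_real, Real.norm_of_nonneg (treeCoeff_nonneg n)]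
  congr 2
  exact_mod_cast Complex.norm_natCast (n + 1)

lemma hasDerivAt_treeT {z : ℂ} (hz : ‖z‖ < Real.exp (-1)) :
    HasDerivAt treeT (treeDeriv z) z := by
  obtain ⟨ρ, h1, h2⟩ := exists_between hz
  have hρ : 0 ≤ ρ := (norm_nonneg z).trans h1.le
  have e : treeT = fun z => ∑' n : ℕ, (treeCoeff n : ℂ) * z ^ (n + 1) := funext treeT_eq_tsum
  rw [e]
  refine hasDerivAt_tsum_of_isPreconnected (t := Metric.ball 0 ρ) (y₀ := 0)
    (g' := fun (n : ℕ) z => (((n : ℂ) + 1) * treeCoeff n) * z ^ n)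
    (summable_treeCoeff_deriv hρ h2) Metric.isOpen_ball
    (convex_ball _ _).isPreconnected (fun n y _ => ?_) (fun n y hy => ?_) ?_ ?_ ?_
  · exact ((hasDerivAt_pow (n + 1) y).const_mul (treeCoeff n : ℂ)).congr_deriv
      (by rw [Nat.add_sub_cancel]; push_cast; ring)
  · rw [norm_succ_mul_treeCoeff]
    have := treeCoeff_nonneg n
    have hy' : ‖y‖ ≤ ρ := (mem_ball_zero_iff.mp hy).le
    gcongr
  · simpa using (norm_nonneg z).trans_lt h1
  · simp [summable_zero]
  · simpa using h1

lemma hasDerivAt_treeQuot_tsum {z : ℂ} (hz : ‖z‖ < Real.exp (-1)) :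
    HasDerivAt treeQuot (∑' n : ℕ, (treeCoeff n : ℂ) * ((n : ℂ) * z ^ (n - 1))) z := by
  obtain ⟨ρ, h1, h2⟩ := exists_between hz
  have hρ : 0 ≤ ρ := (norm_nonneg z).trans h1.le
  have hρ' : 0 < ρ := (norm_nonneg z).trans_lt h1
  refine hasDerivAt_tsum_of_isPreconnected (t := Metric.ball 0 ρ) (y₀ := 0)
    (g' := fun (n : ℕ) z => (treeCoeff n : ℂ) * ((n : ℂ) * z ^ (n - 1)))
    (u := fun n : ℕ => (n + 1) * treeCoeff n * ρ ^ n * ρ⁻¹)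
    ((summable_treeCoeff_deriv hρ h2).mul_right _) Metric.isOpen_ball
    (convex_ball _ _).isPreconnected (fun n y _ => ?_) (fun n y hy => ?_) ?_ ?_ ?_
  · exact (hasDerivAt_pow n y).const_mul (treeCoeff n : ℂ)
  · have hc := treeCoeff_nonneg n
    have hy' : ‖y‖ ≤ ρ := (mem_ball_zero_iff.mp hy).le
    rcases Nat.eq_zero_or_pos n with rfl | hp
    · simp; positivity
    · obtain ⟨i, rfl⟩ : ∃ i, n = i + 1 := ⟨n - 1, by omega⟩
      rw [norm_mul, norm_mul, norm_pow, Complex.norm_real, Real.norm_of_nonneg hc,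
        Complex.norm_natCast, Nat.add_sub_cancel, pow_succ ρ i]
      calc treeCoeff (i + 1) * (((i + 1 : ℕ) : ℝ) * ‖y‖ ^ i)
          ≤ treeCoeff (i + 1) * ((((i + 1 : ℕ) : ℝ) + 1) * ρ ^ i) := by gcongr; linarith
        _ = _ := by field_simp
  · simpa using hρ'
  · exact summable_of_ne_finset_zero (s := {0}) fun n hn => by
      have : n ≠ 0 := by simpa using hn
      simp [this]
  · simpa using h1

lemma hasDerivAt_treeQuot {z : ℂ} (hz : ‖z‖ < Real.exp (-1)) :
    HasDerivAt treeQuot (treeDeriv z * treeQuot z) z := by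
  refine (hasDerivAt_treeQuot_tsum hz).congr_deriv ?_
  have hz0 := norm_nonneg z
  have s1 : Summable fun n : ℕ => ‖(((n : ℂ) + 1) * treeCoeff n) * z ^ n‖ := by
    simp_rw [norm_succ_mul_treeCoeff]; exact summable_treeCoeff_deriv hz0 hz
  have s2 : Summable fun n : ℕ => ‖(treeCoeff n : ℂ) * z ^ n‖ := by
    refine (summable_treeCoeff hz0 hz).congr fun n => ?_
    rw [norm_mul, norm_pow, Complex.norm_real, Real.norm_of_nonneg (treeCoeff_nonneg n)]
  rw [treeDeriv, treeQuot, tsum_mul_tsum_eq_tsum_sum_antidiagonal_of_summable_norm s1 s2]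
  have s3 := (summable_norm_sum_mul_antidiagonal_of_summable_norm s1 s2).of_norm
  have e : ∀ n : ℕ, (∑ kl ∈ Finset.HasAntidiagonal.antidiagonal n,
      ((((kl.1 : ℂ) + 1) * treeCoeff kl.1) * z ^ kl.1) * ((treeCoeff kl.2 : ℂ) * z ^ kl.2)) =
      (treeCoeff (n + 1) : ℂ) * (((n + 1 : ℕ) : ℂ) * z ^ (n + 1 - 1)) := by
    intro n
    have := treeCoeff_convolution n
    rw [Nat.add_sub_cancel]
    push_cast
    rw [show (treeCoeff (n + 1) : ℂ) * (((n : ℂ) + 1) * z ^ n) =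
      (((n : ℂ) + 1) * treeCoeff (n + 1)) * z ^ n by ring, this, Finset.sum_mul]
    refine Finset.sum_congr rfl fun kl hkl => ?_
    have : kl.1 + kl.2 = n := by simpa using hkl
    rw [← this, pow_add]; ring
  simp_rw [e] at s3 ⊢
  rw [((summable_nat_add_iff (f := fun n : ℕ => (treeCoeff n : ℂ) * ((n : ℂ) * z ^ (n - 1)))
    1).mp s3).tsum_eq_zero_add]
  simp

/-- The functional equation `T = z e^T` of the tree function, inside the disc of convergence.
It holds because `T(z) / z` and `e^(T(z))` solve the same linear differential equation, which is
Abel's identity for the coefficients. -/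
lemma treeT_eq_mul_exp {z : ℂ} (hz : ‖z‖ < Real.exp (-1)) :
    treeT z = z * Complex.exp (treeT z) := by
  have hd : ∀ w ∈ Metric.ball (0 : ℂ) (Real.exp (-1)),
      HasDerivAt (fun w => treeQuot w * Complex.exp (-treeT w)) 0 w := by
    intro w hw
    have hw' : ‖w‖ < Real.exp (-1) := by simpa using hw
    have h := (hasDerivAt_treeQuot hw').mul ((hasDerivAt_treeT hw').neg.cexp)
    exact h.congr_deriv (by simp; ring)
  have hconst := (convex_ball (0 : ℂ) (Real.exp (-1))).is_const_of_fderivWithin_eq_zero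
    (𝕜 := ℂ) (f := fun w => treeQuot w * Complex.exp (-treeT w))
    (fun w hw => (hd w hw).differentiableAt.differentiableWithinAt)
    (fun w hw => by
      rw [fderivWithin_of_isOpen Metric.isOpen_ball hw, (hd w hw).hasFDerivAt.fderiv]
      ext; simp)
    (x := z) (y := 0) (by simpa using hz) (by simp [Real.exp_pos])
  have h0 : treeQuot 0 = 1 := by
    unfold treeQuot
    rw [tsum_eq_single 0 (fun n hn => by simp [hn])]
    simp [treeCoeff]
  have hT0 : treeT 0 = 0 := by rw [treeT_eq_mul]; simp
  simp only [h0, hT0, neg_zero, Complex.exp_zero, mul_one] at hconst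
  have hq : treeQuot z = Complex.exp (treeT z) := by
    calc treeQuot z = treeQuot z * Complex.exp (-treeT z) * Complex.exp (treeT z) := by
          rw [mul_assoc, ← Complex.exp_add]; simp
      _ = _ := by rw [hconst, one_mul]
  conv_lhs => rw [treeT_eq_mul, hq]

/-- The coefficients of the tree function are nonnegative. -/
lemma norm_treeT_le (z : ℂ) (hz : ‖z‖ < Real.exp (-1)) : ‖treeT z‖ ≤ ‖treeT (‖z‖ : ℂ)‖ := by
  have hz0 := norm_nonneg z
  have s : Summable fun n : ℕ => treeCoeff n * ‖z‖ ^ (n + 1) := by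
    refine ((summable_treeCoeff hz0 hz).mul_right ‖z‖).congr fun n => by ring
  have e : treeT (‖z‖ : ℂ) = ((∑' n : ℕ, treeCoeff n * ‖z‖ ^ (n + 1) : ℝ) : ℂ) := by
    rw [treeT_eq_tsum, Complex.ofReal_tsum]; push_cast; rfl
  have en : ∀ n, ‖(treeCoeff n : ℂ) * z ^ (n + 1)‖ = treeCoeff n * ‖z‖ ^ (n + 1) := fun n => by
    rw [norm_mul, norm_pow, Complex.norm_real, Real.norm_of_nonneg (treeCoeff_nonneg n)]
  rw [e, Complex.norm_real, Real.norm_of_nonneg (tsum_nonneg fun n => by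
    have := treeCoeff_nonneg n; positivity), treeT_eq_tsum]
  refine (norm_tsum_le_tsum_norm (by simpa only [en] using s)).trans (le_of_eq ?_)
  simp_rw [en]

lemma treeT_ofReal_re (x : ℝ) : ((treeT x).re : ℂ) = treeT x := by
  have e : treeT (x : ℂ) = ((∑' n : ℕ, treeCoeff n * x ^ (n + 1) : ℝ) : ℂ) := by
    rw [treeT_eq_tsum, Complex.ofReal_tsum]; push_cast; rfl
  rw [e, Complex.ofReal_re]

/-- The arguments `ω^ℓ α e^(-α)` lie inside the disc of convergence. -/
lemma mul_exp_neg_lt {α : ℝ} (hα1 : α < 1) : α * Real.exp (-α) < Real.exp (-1) := by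
  have h := Real.add_one_lt_exp (x := α - 1) (by linarith)
  have : Real.exp (-1) = Real.exp (α - 1) * Real.exp (-α) := by
    rw [← Real.exp_add]; ring_nf
  rw [this]
  gcongr
  linarith

/-- On `[0, 1)` the tree function inverts `x ↦ x e^(-x)`. -/
lemma treeT_mul_exp_neg {α : ℝ} (hα0 : 0 < α) (hα1 : α < 1) :
    treeT ((α * Real.exp (-α) : ℝ) : ℂ) = α := by
  set x₀ : ℝ := α * Real.exp (-α) with hx₀
  have hx0 : 0 < x₀ := by positivity
  have hxlt : x₀ < Real.exp (-1) := mul_exp_neg_lt hα1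
  let t : ℝ → ℝ := fun x => (treeT x).re
  have hnorm : ∀ x ∈ Set.Icc 0 x₀, ‖(x : ℂ)‖ < Real.exp (-1) := fun x hx => by
    rw [Complex.norm_real, Real.norm_of_nonneg hx.1]; exact hx.2.trans_lt hxlt
  have ht : ∀ x ∈ Set.Icc 0 x₀, t x = x * Real.exp (t x) := fun x hx => by
    have h := treeT_eq_mul_exp (hnorm x hx)
    rw [← treeT_ofReal_re] at h
    exact_mod_cast h
  have hcont : ContinuousOn t (Set.Icc 0 x₀) := by
    intro x hx
    have h1 : ContinuousAt (fun y : ℝ => treeT (y : ℂ)) x :=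
      ContinuousAt.comp (f := fun y : ℝ => (y : ℂ)) (hasDerivAt_treeT (hnorm x hx)).continuousAt
        Complex.continuous_ofReal.continuousAt
    exact (Complex.continuous_re.continuousAt.comp h1).continuousWithinAt
  have ht0 : t 0 = 0 := by simpa using ht 0 ⟨le_rfl, hx0.le⟩
  -- The value `1` is not attained, as it would need the argument `e⁻¹`.
  have hlt : t x₀ < 1 := by
    by_contra hge
    push Not at hge
    obtain ⟨y, hy, hy1⟩ := intermediate_value_Icc hx0.le hcont
      (show (1 : ℝ) ∈ Set.Icc (t 0) (t x₀) by rw [ht0]; exact ⟨zero_le_one, hge⟩)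
    have h := ht y hy
    rw [hy1] at h
    have : y = Real.exp (-1) := by
      rw [Real.exp_neg]; exact eq_inv_of_mul_eq_one_left h.symm
    linarith [hy.2]
  have hx := ht x₀ ⟨hx0.le, le_rfl⟩
  have hts : t x₀ = α * Real.exp (t x₀ - α) := by
    rw [sub_eq_neg_add, Real.exp_add, ← mul_assoc]; exact hx
  have heq : t x₀ = α := by
    rcases lt_trichotomy (t x₀) α with h | h | h
    · have := Real.add_one_lt_exp (x := t x₀ - α) (by linarith)
      nlinarith
    · exact h
    · have h1 := Real.add_one_lt_exp (x := -(t x₀ - α)) (by linarith)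
      have h2 : t x₀ * Real.exp (-(t x₀ - α)) = α := by
        calc t x₀ * Real.exp (-(t x₀ - α))
            = α * Real.exp (t x₀ - α) * Real.exp (-(t x₀ - α)) := by rw [← hts]
          _ = α := by rw [mul_assoc, ← Real.exp_add]; simp
      nlinarith
  rw [← treeT_ofReal_re]
  exact_mod_cast heq

/-! ### The numbers `ζ_ℓ` -/

lemma rootU_isPrimitiveRoot {b : ℕ} (hb : 1 ≤ b) : IsPrimitiveRoot (rootU b) b :=
  Complex.isPrimitiveRoot_exp b (by omega)

lemma norm_rootU_pow {b : ℕ} (hb : 1 ≤ b) (l : ℕ) : ‖rootU b ^ l‖ = 1 := by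
  rw [norm_pow, (rootU_isPrimitiveRoot hb).norm'_eq_one (by omega), one_pow]

section zeta

variable {b : ℕ} {α : ℝ}

lemma norm_zeta_arg (hb : 1 ≤ b) (hα0 : 0 < α) (l : ℕ) :
    ‖rootU b ^ l * (α : ℂ) * Complex.exp (-(α : ℂ))‖ = α * Real.exp (-α) := by
  rw [norm_mul, norm_mul, norm_rootU_pow hb, one_mul, Complex.norm_real,
    Real.norm_of_nonneg hα0.le, ← Complex.ofReal_neg, Complex.norm_exp_ofReal]

lemma zeta_zero (hα0 : 0 < α) (hα1 : α < 1) : zeta b α 0 = 1 := by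
  have h := treeT_mul_exp_neg hα0 hα1
  unfold zeta
  push_cast at h
  rw [pow_zero, one_mul, h, div_self (by exact_mod_cast hα0.ne')]

lemma norm_zeta_le (hb : 1 ≤ b) (hα0 : 0 < α) (hα1 : α < 1) (l : ℕ) : ‖zeta b α l‖ ≤ 1 := by
  have h1 := norm_zeta_arg hb hα0 l
  have h := norm_treeT_le _ (h1.trans_lt (mul_exp_neg_lt hα1))
  rw [h1, treeT_mul_exp_neg hα0 hα1] at h
  unfold zeta
  rw [norm_div]
  exact div_le_one_of_le₀ h (norm_nonneg _)

/-- The equation `T = z e^T`, in terms of `ζ_ℓ`. -/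
lemma zeta_eq (hb : 1 ≤ b) (hα0 : 0 < α) (hα1 : α < 1) (l : ℕ) :
    zeta b α l = rootU b ^ l * Complex.exp (α * (zeta b α l - 1)) := by
  have h := treeT_eq_mul_exp ((norm_zeta_arg hb hα0 l).trans_lt (mul_exp_neg_lt hα1))
  have hα : (α : ℂ) ≠ 0 := by exact_mod_cast hα0.ne'
  have hT : treeT (rootU b ^ l * (α : ℂ) * Complex.exp (-(α : ℂ))) = α * zeta b α l := by
    unfold zeta; field_simp
  rw [hT] at h
  rw [mul_sub, mul_one, sub_eq_add_neg, add_comm, Complex.exp_add]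
  refine mul_left_cancel₀ hα (h.trans ?_)
  ring

/-- The `ζ_ℓ` are roots of `q^b = e^(bα(q-1))`. -/
lemma zeta_pow (hb : 1 ≤ b) (hα0 : 0 < α) (hα1 : α < 1) (l : ℕ) :
    zeta b α l ^ b = Complex.exp (b * α * (zeta b α l - 1)) := by
  conv_lhs => rw [zeta_eq hb hα0 hα1 l]
  rw [mul_pow, ← pow_mul, mul_comm l b, pow_mul, (rootU_isPrimitiveRoot hb).pow_eq_one, one_pow,
    one_mul, ← Complex.exp_nat_mul]
  ring_nf

/-- If `ζ_k = ζ_ℓ`, then `ω^k = ω^ℓ`, by the equation for `ζ_ℓ`. -/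
lemma zeta_injOn (hb : 1 ≤ b) (hα0 : 0 < α) (hα1 : α < 1) :
    Set.InjOn (zeta b α) (Finset.range b : Set ℕ) := by
  intro k hk l hl h
  simp only [Finset.coe_range, Set.mem_Iio] at hk hl
  have h1 := zeta_eq hb hα0 hα1 k
  have h2 := zeta_eq hb hα0 hα1 l
  rw [h] at h1
  have := mul_right_cancel₀ (Complex.exp_ne_zero _) (h1.symm.trans h2)
  exact (rootU_isPrimitiveRoot hb).pow_inj hk hl this

end zeta

/-! ### The Robin Hood table is independent of the order of insertion -/

section cyclic

variable {m : ℕ}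

lemma val_sub_lt (i a : Fin m) : (i - a).val < m := (i - a).isLt

variable [NeZero m]

lemma ofNat_succ (m k : ℕ) [NeZero m] : Fin.ofNat m (k + 1) = Fin.ofNat m k + 1 := by
  ext
  simp [Fin.val_add, Fin.ofNat]

/-- Distances on the circle add up, possibly after a full turn. -/
lemma val_sub_eq_or (j i a : Fin m) :
    (j - a).val = (j - i).val + (i - a).val ∨ (j - a).val + m = (j - i).val + (i - a).val := by
  have h : j - a = (j - i) + (i - a) := by abel
  rw [h, Fin.val_add_eq_ite]
  split_ifs with hm
  · right; omega
  · left; rfl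

lemma val_sub_eq_zero {i a : Fin m} : (i - a).val = 0 ↔ i = a := by
  rw [Fin.val_eq_zero_iff, sub_eq_zero]

lemma val_sub_inj {i j a : Fin m} : (i - a).val = (j - a).val ↔ i = j := by
  rw [Fin.val_inj, sub_left_inj]

lemma val_sub_inj' {i j a : Fin m} : (a - i).val = (a - j).val ↔ i = j := by
  rw [Fin.val_inj, sub_right_inj]

/-- Stepping back from the home bucket leads once around the circle. -/
lemma val_sub_one_sub (i a : Fin m) :
    (i = a ∧ (i - 1 - a).val + 1 = m) ∨ (i ≠ a ∧ (i - a).val = (i - 1 - a).val + 1) := by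
  have hm : 0 < m := Nat.pos_of_ne_zero (NeZero.ne m)
  have h1 := val_sub_eq_or (m := m) i (i - 1) a
  have e : i - (i - 1) = 1 := by abel
  rw [e, Fin.val_one'] at h1
  have hlt := val_sub_lt (i - 1) a
  have hlt' := val_sub_lt i a
  by_cases hia : i = a
  · left
    refine ⟨hia, ?_⟩
    have h0 : (i - a).val = 0 := val_sub_eq_zero.mpr hia
    rcases Nat.lt_or_ge 1 m with h | h
    · rw [Nat.mod_eq_of_lt h] at h1; omega
    · omega
  · right
    refine ⟨hia, ?_⟩
    have h0 : (i - a).val ≠ 0 := fun h => hia (val_sub_eq_zero.mp h)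
    rcases Nat.lt_or_ge 1 m with h | h
    · rw [Nat.mod_eq_of_lt h] at h1; omega
    · omega

lemma val_sub_eq_or_pred (j i a : Fin m) :
    (j - a).val = (j - i).val + 1 + (i - 1 - a).val ∨
      (j - a).val + m = (j - i).val + 1 + (i - 1 - a).val := by
  have h1 := val_sub_eq_or j i a
  have h2 := val_sub_one_sub i a
  have h3 : i = a → (i - a).val = 0 := val_sub_eq_zero.mpr
  have := val_sub_lt j i
  have := val_sub_lt j a
  have := val_sub_lt i a
  rcases h2 with ⟨h2, h4⟩ | ⟨h2, h4⟩
  · have := h3 h2; omega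
  · omega

lemma card_filter_val_sub_lt (i : Fin m) {d : ℕ} (hd : d ≤ m) :
    (Finset.univ.filter fun j : Fin m => (j - i).val < d).card = d := by
  have : (Finset.univ.filter fun j : Fin m => (j - i).val < d).card =
      (Finset.univ.filter fun j : Fin m => j.val < d).card := by
    refine Finset.card_bij' (fun j _ => j - i) (fun j _ => j + i) ?_ ?_ ?_ ?_ <;> simp
  rw [this, Fin.card_filter_val_lt]
  omega

end cyclic

section table

variable {m n : ℕ} {b : ℕ} {h : Fin n → Fin m}

/-- The key `z` wins over the key `y` when they compete for bucket `i`. -/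
def Beats (h : Fin n → Fin m) (i : Fin m) (z y : Fin n) : Prop :=
  steps h i y < steps h i z ∨ (steps h i y = steps h i z ∧ z < y)

lemma Beats.trans {i : Fin m} {x y z : Fin n} (h1 : Beats h i x y) (h2 : Beats h i y z) :
    Beats h i x z := by
  unfold Beats at *
  rcases h1 with h1 | ⟨h1, h1'⟩ <;> rcases h2 with h2 | ⟨h2, h2'⟩
  · left; omega
  · left; omega
  · left; omega
  · right; exact ⟨by omega, h1'.trans h2'⟩

lemma loser_mem {i : Fin m} {B : Finset (Fin n)} (hB : B.Nonempty) : loser h i B hB ∈ B :=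
  (Finset.mem_filter.mp ((leastProbed h i B).max'_mem (leastProbed_nonempty h i hB))).1

lemma beats_loser {i : Fin m} {B : Finset (Fin n)} (hB : B.Nonempty) {z : Fin n} (hz : z ∈ B)
    (hne : z ≠ loser h i B hB) : Beats h i z (loser h i B hB) := by
  have hl := Finset.mem_filter.mp
    ((leastProbed h i B).max'_mem (leastProbed_nonempty h i hB))
  rcases (hl.2 z hz).lt_or_eq with hlt | heq
  · exact Or.inl hlt
  · refine Or.inr ⟨heq, lt_of_le_of_ne ?_ hne⟩
    refine (leastProbed h i B).le_max' z (Finset.mem_filter.mpr ⟨hz, fun w hw => ?_⟩)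
    rw [← heq]
    exact hl.2 w hw

/-- Every bucket that the key `y` passes on its way from home to bucket `i` is full, with keys
that win over `y`. -/
def Passed (b : ℕ) (h : Fin n → Fin m) (t : Fin m → Finset (Fin n)) (y : Fin n) (i : Fin m) :
    Prop :=
  ∀ j, steps h j y < steps h i y → (t j).card = b ∧ ∀ z ∈ t j, Beats h j z y

/-- The tables that Robin Hood hashing can produce from the set `S` of keys: each key of `S` is in
exactly one bucket, no bucket holds more than `b` keys, and every key has lost all competitions on
its way.  The order of insertion plays no role in this description. -/
structure Legal (b : ℕ) (h : Fin n → Fin m) (t : Fin m → Finset (Fin n)) (S : Finset (Fin n)) :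
    Prop where
  mem_iff : ∀ y, y ∈ S ↔ ∃ i, y ∈ t i
  unique : ∀ y i j, y ∈ t i → y ∈ t j → i = j
  card_le : ∀ i, (t i).card ≤ b
  passed : ∀ i, ∀ y ∈ t i, Passed b h t y i

variable {t : Fin m → Finset (Fin n)} {S : Finset (Fin n)}

lemma Legal.sum_card (ht : Legal b h t S) : ∑ i, (t i).card = S.card := by
  rw [← Finset.card_biUnion]
  · congr 1
    ext y
    simp [ht.mem_iff]
  · intro i _ j _ hij
    exact Finset.disjoint_left.mpr fun y hi hj => hij (ht.unique y i j hi hj)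

lemma legal_empty : Legal b h (fun _ => ∅) ∅ where
  mem_iff := by simp
  unique := by simp
  card_le := by simp
  passed := by simp

/-- A key that reaches a bucket with room may be stored there. -/
lemma Legal.update_insert (ht : Legal b h t S) {x : Fin n} (hx : x ∉ S) {i : Fin m}
    (hp : Passed b h t x i) (hc : (t i).card < b) :
    Legal b h (Function.update t i (insert x (t i))) (insert x S) := by
  have hxt : ∀ j, x ∉ t j := fun j hj => hx ((ht.mem_iff x).mpr ⟨j, hj⟩)
  have hmem : ∀ j y, y ∈ Function.update t i (insert x (t i)) j ↔ (y ∈ t j ∨ (y = x ∧ j = i)) := by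
    intro j y
    by_cases hj : j = i
    · subst hj; simp [or_comm]
    · simp [hj]
  refine ⟨fun y => ?_, fun y j k hj hk => ?_, fun j => ?_, fun j y hy k hk => ?_⟩
  · simp only [hmem, Finset.mem_insert, ht.mem_iff]
    constructor
    · rintro (rfl | ⟨j, hj⟩)
      · exact ⟨i, Or.inr ⟨rfl, rfl⟩⟩
      · exact ⟨j, Or.inl hj⟩
    · rintro ⟨j, hj | ⟨rfl, -⟩⟩
      · exact Or.inr ⟨j, hj⟩
      · exact Or.inl rfl
  · rw [hmem] at hj hk
    rcases hj with hj | ⟨rfl, rfl⟩ <;> rcases hk with hk | ⟨h1, rfl⟩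
    · exact ht.unique y j k hj hk
    · exact absurd (h1 ▸ hj) (hxt _)
    · exact absurd hk (hxt _)
    · rfl
  · by_cases hj : j = i
    · subst hj
      simp only [Function.update_self]
      exact (Finset.card_insert_le _ _).trans hc
    · simp only [ne_eq, hj, not_false_eq_true, Function.update_of_ne]
      exact ht.card_le j
  · have key : (t k).card = b ∧ ∀ z ∈ t k, Beats h k z y := by
      rcases (hmem j y).mp hy with hy | ⟨rfl, rfl⟩
      · exact ht.passed j y hy k hk
      · exact hp k hk
    have hki : k ≠ i := by rintro rfl; omega
    simpa [hki] using key

/-- One transfer: the loser of a full bucket leaves it, and the rest of the table remains legal. -/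
lemma Legal.update_erase [NeZero m] (ht : Legal b h t S) {x : Fin n} (hx : x ∉ S) {i : Fin m}
    (hp : Passed b h t x i) (hc : (t i).card = b) {l : Fin n}
    (hl : l = loser h i (insert x (t i)) (Finset.insert_nonempty x (t i))) :
    Legal b h (Function.update t i ((insert x (t i)).erase l)) ((insert x S).erase l) ∧
      Passed b h (Function.update t i ((insert x (t i)).erase l)) l (i + 1) ∧
      (Function.update t i ((insert x (t i)).erase l) i).card = b := by
  have hxt : ∀ j, x ∉ t j := fun j hj => hx ((ht.mem_iff x).mpr ⟨j, hj⟩)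
  have hlB : l ∈ insert x (t i) := hl ▸ loser_mem _
  have hbeat : ∀ z ∈ insert x (t i), z ≠ l → Beats h i z l := fun z hz hne => by
    subst hl; exact beats_loser _ hz hne
  have hlj : ∀ j, j ≠ i → l ∉ t j := fun j hj hl' => by
    rcases Finset.mem_insert.mp hlB with h1 | h1
    · exact hxt j (h1 ▸ hl')
    · exact hj (ht.unique l j i hl' h1)
  set t' := Function.update t i ((insert x (t i)).erase l) with ht'
  have ht'i : t' i = (insert x (t i)).erase l := Function.update_self _ _ _
  have ht'j : ∀ j, j ≠ i → t' j = t j := fun j hj => Function.update_of_ne hj _ _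
  have hmem : ∀ j y, y ∈ t' j ↔ (y ≠ l ∧ (y ∈ t j ∨ (y = x ∧ j = i))) := by
    intro j y
    by_cases hj : j = i
    · subst hj; rw [ht'i]; simp [or_comm]
    · rw [ht'j j hj]
      simp only [hj, and_false, or_false]
      exact ⟨fun hy => ⟨fun h1 => hlj j hj (h1 ▸ hy), hy⟩, fun hy => hy.2⟩
  have hcard : (t' i).card = b := by
    rw [ht'i, Finset.card_erase_of_mem hlB, Finset.card_insert_of_notMem (hxt i), hc]
    rfl
  refine ⟨⟨fun y => ?_, fun y j k hj hk => ?_, fun j => ?_, fun j y hy k hk => ?_⟩, ?_, hcard⟩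
  · simp only [hmem, Finset.mem_erase, Finset.mem_insert, ht.mem_iff]
    constructor
    · rintro ⟨h0, rfl | ⟨j, hj⟩⟩
      · exact ⟨i, h0, Or.inr ⟨rfl, rfl⟩⟩
      · exact ⟨j, h0, Or.inl hj⟩
    · rintro ⟨j, h0, hj | ⟨rfl, -⟩⟩
      · exact ⟨h0, Or.inr ⟨j, hj⟩⟩
      · exact ⟨h0, Or.inl rfl⟩
  · rw [hmem] at hj hk
    rcases hj with ⟨-, hj | ⟨rfl, rfl⟩⟩ <;> rcases hk with ⟨-, hk | ⟨h1, rfl⟩⟩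
    · exact ht.unique y j k hj hk
    · exact absurd (h1 ▸ hj) (hxt _)
    · exact absurd hk (hxt _)
    · rfl
  · by_cases hj : j = i
    · subst hj; exact hcard.le
    · rw [ht'j j hj]; exact ht.card_le j
  · have key : (t k).card = b ∧ ∀ z ∈ t k, Beats h k z y := by
      rcases ((hmem j y).mp hy).2 with hy | ⟨rfl, rfl⟩
      · exact ht.passed j y hy k hk
      · exact hp k hk
    by_cases hki : k = i
    · subst hki
      refine ⟨hcard, fun z hz => ?_⟩
      rcases (hmem k z).mp hz with ⟨hzl, hz | ⟨rfl, -⟩⟩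
      · exact key.2 z hz
      · -- The newcomer wins over the key that it drives out, hence over all who passed before.
        have hlt : l ∈ t k := (Finset.mem_insert.mp hlB).resolve_left fun h1 => hzl h1.symm
        exact (hbeat z (Finset.mem_insert_self _ _) hzl).trans (key.2 l hlt)
    · rw [ht'j k hki]; exact key
  · intro j hj
    have hle : steps h j l ≤ steps h i l := by
      unfold steps at hj ⊢
      have := val_sub_one_sub (i + 1) (h l)
      rw [add_sub_cancel_right] at this
      rcases this with ⟨h1, -⟩ | ⟨-, h2⟩
      · rw [val_sub_eq_zero.mpr h1] at hj; omega
      · omega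
    rcases hle.lt_or_eq with hlt | heq
    · have key : (t j).card = b ∧ ∀ z ∈ t j, Beats h j z l := by
        rcases Finset.mem_insert.mp hlB with h1 | h1
        · rw [h1] at hlt ⊢; exact hp j hlt
        · exact ht.passed i l h1 j hlt
      have hji : j ≠ i := by rintro rfl; omega
      rw [ht'j j hji]; exact key
    · have hji : j = i := val_sub_inj.mp heq
      subst hji
      refine ⟨hcard, fun z hz => ?_⟩
      rw [ht'i] at hz
      exact hbeat z (Finset.mem_of_mem_erase hz) (Finset.ne_of_mem_erase hz)

/-- Probing from bucket `i`, with the buckets from `i₀` to `i - 1` known to be full, produces a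
legal table.  As the table is not full, the bound on the number of probes is not reached. -/
lemma Legal.probe [NeZero m] (s : ℕ) : ∀ {t : Fin m → Finset (Fin n)} {S : Finset (Fin n)}
    {x : Fin n} {i i₀ : Fin m} {k : ℕ}, Legal b h t S → x ∉ S → Passed b h t x i →
    S.card < b * m → s + k = m → (0 < s → (i - i₀).val = k) →
    (∀ j, (j - i₀).val < k → (t j).card = b) → Legal b h (probe b h s i x t) (insert x S) := by
  induction s with
  | zero =>
    intro t S x i i₀ k ht hx hp hS hk hi hfull
    have hall : ∀ j, (t j).card = b := fun j => hfull j (by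
      have := val_sub_lt j i₀; omega)
    have := ht.sum_card
    simp only [hall, Finset.sum_const, Finset.card_univ, Fintype.card_fin, smul_eq_mul] at this
    rw [mul_comm] at this
    omega
  | succ s ih =>
    intro t S x i i₀ k ht hx hp hS hk hi hfull
    have hik := hi (Nat.succ_pos s)
    rw [RobinHood.probe]
    split_ifs with hc
    · exact ht.update_insert hx hp hc
    · have hc' : (t i).card = b := le_antisymm (ht.card_le i) (not_lt.mp hc)
      set l := loser h i (insert x (t i)) (Finset.insert_nonempty x (t i)) with hl
      obtain ⟨h1, h2, h3⟩ := ht.update_erase hx hp hc' hl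
      have hlS : l ∈ insert x S := by
        have : l ∈ insert x (t i) := loser_mem _
        rcases Finset.mem_insert.mp this with h | h
        · exact h ▸ Finset.mem_insert_self _ _
        · exact Finset.mem_insert_of_mem ((ht.mem_iff l).mpr ⟨i, h⟩)
      have hcard : ((insert x S).erase l).card = S.card := by
        rw [Finset.card_erase_of_mem hlS, Finset.card_insert_of_notMem hx]; rfl
      have := ih (i₀ := i₀) (k := k + 1) h1 (Finset.notMem_erase _ _) h2 (by rw [hcard]; exact hS)
        (by omega) (fun hs => by
          have := val_sub_one_sub (i + 1) i₀
          rw [add_sub_cancel_right] at this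
          rcases this with ⟨-, h4⟩ | ⟨-, h4⟩ <;> omega)
        (fun j hj => by
          by_cases hji : j = i
          · rw [hji]; exact h3
          · rw [Function.update_of_ne hji]
            refine hfull j (lt_of_le_of_ne (by omega) fun h5 => hji ?_)
            exact val_sub_inj.mp (h5.trans hik.symm))
      rwa [Finset.insert_erase hlS] at this

lemma legal_foldl [NeZero m] (l : List (Fin n)) : ∀ {t : Fin m → Finset (Fin n)}
    {S : Finset (Fin n)}, Legal b h t S → l.Nodup → (∀ x ∈ l, x ∉ S) → S.card + l.length ≤ b * m →
    Legal b h (l.foldl (fun t x => probe b h m (h x) x t) t) (S ∪ l.toFinset) := by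
  induction l with
  | nil => intro t S ht _ _ _; simpa using ht
  | cons x l ih =>
    intro t S ht hl hS hc
    rw [List.nodup_cons] at hl
    rw [List.length_cons] at hc
    have hx := hS x (by simp)
    have h1 : Legal b h (probe b h m (h x) x t) (insert x S) :=
      ht.probe m (i₀ := h x) (k := 0) hx (fun j hj => by simp [steps] at hj) (by omega) (by omega)
        (by simp) (by simp)
    have := ih h1 hl.2 (fun y hy => by
      rw [Finset.mem_insert, not_or]
      exact ⟨fun h2 => hl.1 (h2 ▸ hy), hS y (by simp [hy])⟩)
      (by rw [Finset.card_insert_of_notMem hx]; omega)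
    rw [List.foldl_cons, List.toFinset_cons]
    convert this using 1
    ext y; simp

lemma legal_exactTable [NeZero m] (σ : Equiv.Perm (Fin n)) (hn : n ≤ b * m) :
    Legal b h (exactTable b σ h) Finset.univ := by
  have := legal_foldl (b := b) (h := h) (List.ofFn σ) legal_empty
    (List.nodup_ofFn.mpr σ.injective) (by simp) (by simpa using hn)
  have hS : ∅ ∪ (List.ofFn σ).toFinset = Finset.univ := by
    ext y
    simp [List.mem_ofFn, σ.surjective y]
  rwa [hS] at this

/-! ### Overflows and displacements in the table -/

lemma Legal.disp_eq (ht : Legal b h t S) {y : Fin n} {i : Fin m} (hy : y ∈ t i) :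
    disp h t y = steps h i y := by
  unfold disp
  have : (Finset.univ.filter fun j => y ∈ t j) = {i} := by
    ext j
    simp only [Finset.mem_filter, Finset.mem_univ, true_and, Finset.mem_singleton]
    exact ⟨fun hj => ht.unique y j i hj hy, fun hj => hj ▸ hy⟩
  rw [this, Finset.sum_singleton]

/-- The number of keys with hash address `i`. -/
def homeCount (h : Fin n → Fin m) (i : Fin m) : ℕ := (Finset.univ.filter fun y => h y = i).card

/-- A key that overflows from a bucket has found it full. -/
lemma Legal.full_of_overflow (ht : Legal b h t Finset.univ) {i : Fin m}
    (hi : overflowAt h t i ≠ 0) : (t i).card = b := by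
  obtain ⟨y, hy⟩ := Finset.card_ne_zero.mp hi
  obtain ⟨j, hj⟩ := (ht.mem_iff y).mp (Finset.mem_univ y)
  have hlt := (Finset.mem_filter.mp hy).2
  rw [ht.disp_eq hj] at hlt
  exact (ht.passed j y hj i hlt).1

variable [NeZero m]

/-- Conservation of keys at bucket `i`. -/
lemma Legal.card_add_overflow (ht : Legal b h t Finset.univ) (i : Fin m) :
    (t i).card + overflowAt h t i = homeCount h i + overflowAt h t (i - 1) := by
  unfold overflowAt homeCount
  rw [← Finset.card_union_of_disjoint, ← Finset.card_union_of_disjoint]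
  · congr 1
    ext y
    obtain ⟨j, hj⟩ := (ht.mem_iff y).mp (Finset.mem_univ y)
    have h1 : y ∈ t i ↔ steps h i y = steps h j y := by
      unfold steps
      rw [val_sub_inj]
      exact ⟨fun hy => ht.unique y i j hy hj, fun hy => hy ▸ hj⟩
    simp only [Finset.mem_union, h1, Finset.mem_filter, Finset.mem_univ, true_and, ht.disp_eq hj]
    unfold steps
    have h2 := val_sub_one_sub i (h y)
    have h3 : i = h y → (i - h y).val = 0 := val_sub_eq_zero.mpr
    have h4 := val_sub_lt j (h y)
    have h5 : h y = i ↔ i = h y := eq_comm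
    rw [h5]
    rcases h2 with ⟨h2, h6⟩ | ⟨h2, h6⟩
    · have := h3 h2
      simp only [h2, true_or, iff_true]
      rw [h2] at this
      omega
    · simp only [h2, false_or]; omega
  · refine Finset.disjoint_left.mpr fun y hy hy' => ?_
    obtain ⟨j, hj⟩ := (ht.mem_iff y).mp (Finset.mem_univ y)
    have h1 := (Finset.mem_filter.mp hy).2
    have h2 := (Finset.mem_filter.mp hy').2
    rw [ht.disp_eq hj] at h2
    unfold steps at h2
    have := val_sub_lt j (h y)
    rcases val_sub_one_sub i (h y) with ⟨-, h6⟩ | ⟨h6, -⟩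
    · omega
    · exact h6 h1.symm
  · refine Finset.disjoint_left.mpr fun y hy hy' => ?_
    have h2 := (Finset.mem_filter.mp hy').2
    rw [ht.disp_eq hy] at h2
    exact lt_irrefl _ h2

/-- A key is displaced by one bucket for every `b` keys that win over it: the buckets that it passes
are full of such keys, and all such keys, together with the key itself, are stored no further than
in its bucket. -/
lemma Legal.disp_eq_div (hb : 1 ≤ b) (ht : Legal b h t Finset.univ) (y : Fin n) :
    disp h t y = (overflowAt h t (h y - 1) +
      (Finset.univ.filter fun z : Fin n => h z = h y ∧ z < y).card) / b := by
  obtain ⟨jy, hjy⟩ := (ht.mem_iff y).mp (Finset.mem_univ y)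
  set i := h y with hi
  set d := disp h t y with hd
  have hds : d = (jy - i).val := ht.disp_eq hjy
  have hdm : d < m := by rw [hds]; exact val_sub_lt _ _
  -- `W` is the set of keys that win over `y`, and `A e` the set of those stored in the `e` buckets
  -- from `i` on.
  set W : Finset (Fin n) := (Finset.univ.filter fun z : Fin n => steps h (i - 1) z < disp h t z) ∪
    (Finset.univ.filter fun z : Fin n => h z = i ∧ z < y) with hW
  have hWcard : W.card = overflowAt h t (i - 1) +
      (Finset.univ.filter fun z : Fin n => h z = i ∧ z < y).card := by
    rw [hW, Finset.card_union_of_disjoint]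
    · rfl
    · refine Finset.disjoint_left.mpr fun z hz hz' => ?_
      have h1 := (Finset.mem_filter.mp hz).2
      have h2 := (Finset.mem_filter.mp hz').2.1
      obtain ⟨j, hj⟩ := (ht.mem_iff z).mp (Finset.mem_univ z)
      rw [ht.disp_eq hj] at h1
      unfold steps at h1
      have := val_sub_lt j (h z)
      rcases val_sub_one_sub i (h z) with ⟨-, h6⟩ | ⟨h6, -⟩
      · omega
      · exact h6 h2.symm
  let A : ℕ → Finset (Fin n) := fun e =>
    (Finset.univ.filter fun j : Fin m => (j - i).val < e).biUnion t
  have hAcard : ∀ e, (A e).card = ∑ j with (j - i).val < e, (t j).card := fun e =>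
    Finset.card_biUnion fun j _ k _ hjk =>
      Finset.disjoint_left.mpr fun z hz hz' => hjk (ht.unique z j k hz hz')
  have hsub : A d ⊆ W := by
    intro z hz
    obtain ⟨j, hj, hzj⟩ := Finset.mem_biUnion.mp hz
    have hjd := (Finset.mem_filter.mp hj).2
    have hbeat := (ht.passed jy y hjy j (by unfold steps; rw [← hi]; omega)).2 z hzj
    unfold Beats steps at hbeat
    rw [← hi] at hbeat
    rw [hW, Finset.mem_union, Finset.mem_filter, Finset.mem_filter]
    rcases hbeat with h1 | ⟨h1, h2⟩
    · left
      refine ⟨Finset.mem_univ _, ?_⟩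
      rw [ht.disp_eq hzj]
      unfold steps
      have := val_sub_eq_or_pred j i (h z)
      have := val_sub_lt (i - 1) (h z)
      omega
    · right
      exact ⟨Finset.mem_univ _, (val_sub_inj'.mp h1).symm, h2⟩
  have hsup : insert y W ⊆ A (d + 1) := by
    intro z hz
    obtain ⟨j, hj⟩ := (ht.mem_iff z).mp (Finset.mem_univ z)
    refine Finset.mem_biUnion.mpr ⟨j, Finset.mem_filter.mpr ⟨Finset.mem_univ _, ?_⟩, hj⟩
    rcases Finset.mem_insert.mp hz with rfl | hz
    · have : j = jy := ht.unique z j jy hj hjy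
      rw [this]; omega
    by_contra hlt
    have hno : ¬ steps h jy z < steps h j z ∨ Beats h jy y z :=
      (em (steps h jy z < steps h j z)).symm.imp id fun h1 => (ht.passed j z hj jy h1).2 y hjy
    unfold Beats at hno
    have hsy : steps h jy y = d := hds.symm
    rw [hsy] at hno
    rw [hW, Finset.mem_union, Finset.mem_filter, Finset.mem_filter] at hz
    rcases hz with ⟨-, h1⟩ | ⟨-, h1, h2⟩
    · rw [ht.disp_eq hj] at h1
      unfold steps at h1 hno
      have := val_sub_eq_or_pred j i (h z)
      have := val_sub_eq_or_pred jy i (h z)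
      have := val_sub_lt j i
      have := val_sub_lt j (h z)
      have := val_sub_lt jy (h z)
      omega
    · have hs : steps h jy z = d := by unfold steps; rw [h1]; exact hds.symm
      have hs' : steps h j z = (j - i).val := by unfold steps; rw [h1]
      rw [hs, hs'] at hno
      rcases hno with h3 | h3 | ⟨-, h3⟩
      · omega
      · omega
      · exact absurd h2 h3.asymm
  have hyW : y ∉ W := by
    rw [hW, Finset.mem_union, Finset.mem_filter, Finset.mem_filter]
    rintro (⟨-, h1⟩ | ⟨-, -, h1⟩)
    · unfold steps at h1
      rw [← hd] at h1
      rcases val_sub_one_sub i (h y) with ⟨-, h6⟩ | ⟨h6, -⟩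
      · omega
      · exact h6 rfl
    · exact lt_irrefl _ h1
  have hlow : d * b ≤ W.card := by
    refine le_trans (le_of_eq ?_) (Finset.card_le_card hsub)
    rw [hAcard, Finset.sum_congr rfl (g := fun _ => b), Finset.sum_const, smul_eq_mul,
      card_filter_val_sub_lt i hdm.le]
    intro j hj
    have hjd := (Finset.mem_filter.mp hj).2
    exact (ht.passed jy y hjy j (by unfold steps; rw [← hi]; omega)).1
  have hup : W.card < (d + 1) * b := by
    have h1 := Finset.card_le_card hsup
    rw [Finset.card_insert_of_notMem hyW] at h1
    refine lt_of_lt_of_le (Nat.lt_of_succ_le h1) ?_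
    rw [hAcard]
    refine (Finset.sum_le_card_nsmul _ _ b fun j _ => ht.card_le j).trans ?_
    rw [card_filter_val_sub_lt i hdm, smul_eq_mul]
  rw [← hWcard]
  exact ((Nat.div_eq_iff (by omega)).mpr ⟨hlow, by rw [add_mul] at hup; omega⟩).symm

end table

/-! ### Overflow as the maximum of a random walk -/

/-- The partial sums of the sequence `x k - b`. -/
def walk (b : ℕ) (x : ℕ → ℕ) (L : ℕ) : ℤ := ∑ k ∈ Finset.range L, ((x k : ℤ) - (b : ℤ))

/-- The maximum of the partial sums of `x k - b` (with value `0` if they are unbounded). -/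
noncomputable def walkMax (b : ℕ) (x : ℕ → ℕ) : ℕ := (⨆ L : ℕ, walk b x L).toNat

@[simp] lemma walk_zero (b : ℕ) (x : ℕ → ℕ) : walk b x 0 = 0 := by simp [walk]

lemma walk_succ (b : ℕ) (x : ℕ → ℕ) (L : ℕ) : walk b x (L + 1) = walk b x L + (x L - b) := by
  rw [walk, walk, Finset.sum_range_succ]

lemma walk_succ' (b : ℕ) (x : ℕ → ℕ) (L : ℕ) :
    walk b x (L + 1) = walk b (fun k => x (k + 1)) L + (x 0 - b) := by
  rw [walk, walk, Finset.sum_range_succ']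

lemma overflow_eq_walkMax (b : ℕ) (X : ℤ → ℕ) (i : ℤ) :
    overflow b X i = walkMax b fun k => X (i - k) := rfl

lemma isGreatest_walkMax {b : ℕ} {x : ℕ → ℕ} (hx : BddAbove (Set.range (walk b x))) :
    IsGreatest (Set.range (walk b x)) (walkMax b x) := by
  have h1 : sSup (Set.range (walk b x)) ∈ Set.range (walk b x) :=
    Int.csSup_mem (Set.range_nonempty _) hx
  have h0 : 0 ≤ sSup (Set.range (walk b x)) := le_csSup hx ⟨0, walk_zero b x⟩
  have e : (walkMax b x : ℤ) = sSup (Set.range (walk b x)) := Int.toNat_of_nonneg h0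
  rw [e]
  exact ⟨h1, fun _ h => le_csSup hx h⟩

lemma walkMax_eq_of_isGreatest {b : ℕ} {x : ℕ → ℕ} {c : ℕ}
    (h : IsGreatest (Set.range (walk b x)) (c : ℤ)) : walkMax b x = c := by
  unfold walkMax iSup
  rw [h.csSup_eq]
  simp

/-- The queueing recursion on the circle determines the overflows: unrolling it backwards from `i`
gives upper bounds, with equality at the first bucket without overflow. -/
lemma eq_walkMax_of_recursion {m b : ℕ} [NeZero m] (O X : Fin m → ℕ)
    (h1 : ∀ i, X i + O (i - 1) ≤ O i + b) (h2 : ∀ i, O i ≠ 0 → O i + b = X i + O (i - 1))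
    (h3 : ∃ i, O i = 0) (i : Fin m) :
    O i = walkMax b fun k => if k + 1 < m then X (i - (Fin.ofNat m k)) else 0 := by
  set x : ℕ → ℕ := fun k => if k + 1 < m then X (i - (Fin.ofNat m k)) else 0 with hx
  have hsub : ∀ k : ℕ, i - Fin.ofNat m (k + 1) = i - Fin.ofNat m k - 1 := fun k => by
    rw [ofNat_succ, sub_sub]
  have hle : ∀ L, walk b x L + (if L < m then (O (i - Fin.ofNat m L) : ℤ) else 0) ≤ O i := by
    intro L
    induction L with
    | zero =>
      have : 0 < m := Nat.pos_of_ne_zero (NeZero.ne m)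
      simp [this]
    | succ L ih =>
      rw [walk_succ]
      by_cases hL : L + 1 < m
      · have h4 := h1 (i - Fin.ofNat m L)
        rw [← hsub L] at h4
        have hx' : x L = X (i - Fin.ofNat m L) := by simp [hx, hL]
        rw [if_pos (by omega)] at ih
        rw [if_pos hL, hx']
        omega
      · have hx' : x L = 0 := by simp [hx, hL]
        rw [if_neg hL, hx']
        split_ifs at ih <;> omega
  have hex : ∃ L, L < m ∧ O (i - Fin.ofNat m L) = 0 := by
    obtain ⟨j, hj⟩ := h3
    refine ⟨(i - j).val, (i - j).isLt, ?_⟩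
    rw [Fin.ofNat_val_eq_self]
    simpa using hj
  classical
  have hfind := Nat.find_spec hex
  have heq : ∀ L, L ≤ Nat.find hex → walk b x L + (O (i - Fin.ofNat m L) : ℤ) = O i := by
    intro L
    induction L with
    | zero => intro _; simp
    | succ L ih =>
      intro hL
      have hlt : L < Nat.find hex := hL
      have hm : L + 1 < m := lt_of_le_of_lt hL hfind.1
      have h4 : O (i - Fin.ofNat m L) ≠ 0 := fun h => Nat.find_min hex hlt ⟨by omega, h⟩
      have h5 := h2 _ h4
      rw [← hsub L] at h5
      have hx' : x L = X (i - Fin.ofNat m L) := by simp [hx, hm]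
      have := ih hlt.le
      rw [walk_succ, hx']
      omega
  refine (walkMax_eq_of_isGreatest ⟨⟨Nat.find hex, ?_⟩, ?_⟩).symm
  · have := heq _ le_rfl
    rw [hfind.2] at this
    simpa using this
  · rintro _ ⟨L, rfl⟩
    have := hle L
    split_ifs at this <;> omega

/-- The numbers of keys with the hash addresses `i`, `i - 1`, `i - 2`, … once around the circle,
followed by zeros. -/
def homeCounts {m n : ℕ} [NeZero m] (h : Fin n → Fin m) (i : Fin m) (k : ℕ) : ℕ :=
  if k < m then homeCount h (i - Fin.ofNat m k) else 0

/-- As the table is not full, some bucket does not overflow, so the recursion applies. -/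
lemma overflowAt_eq_walkMax {m n b : ℕ} [NeZero m] (σ : Equiv.Perm (Fin n)) (h : Fin n → Fin m)
    (hn : n < b * m) (i : Fin m) :
    overflowAt h (exactTable b σ h) (i - 1) = walkMax b fun k => homeCounts h i (k + 1) := by
  have ht := legal_exactTable (h := h) σ hn.le
  rw [eq_walkMax_of_recursion (overflowAt h (exactTable b σ h)) (homeCount h) _ _ _ (i - 1)]
  · congr 1
    ext k
    unfold homeCounts
    rw [ofNat_succ, sub_sub, add_comm 1]
  · intro j
    have := ht.card_add_overflow j
    have := ht.card_le j
    omega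
  · intro j hj
    have := ht.card_add_overflow j
    have := ht.full_of_overflow hj
    omega
  · by_contra hne
    push Not at hne
    have := ht.sum_card
    simp only [fun j => ht.full_of_overflow (hne j), Finset.sum_const, Finset.card_univ,
      Fintype.card_fin, smul_eq_mul] at this
    rw [mul_comm] at this
    omega

/-! ### Occupancy counts of a uniformly random hash function -/

section counts

variable {J : Type*} [Fintype J] [DecidableEq J]

/-- The number of keys that a hash function sends to `j`. -/
def fiberCount {n : ℕ} (h : Fin n → J) (j : J) : ℕ := (Finset.univ.filter fun y => h y = j).card

lemma prod_comp_eq_prod_pow {n : ℕ} (h : Fin n → J) (u : J → ℝ) :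
    ∏ y, u (h y) = ∏ j, u j ^ fiberCount h j := by
  rw [Finset.prod_comp]
  refine Finset.prod_subset (Finset.subset_univ _) fun j _ hj => ?_
  have : (Finset.univ.filter fun y => h y = j) = ∅ := by
    ext y
    simp only [Finset.mem_filter, Finset.mem_univ, true_and, Finset.notMem_empty, iff_false]
    exact fun hy => hj (Finset.mem_image.mpr ⟨y, Finset.mem_univ _, hy⟩)
  rw [this]; simp

/-- The generating function of the occupancy counts, restricted to hash functions with prescribed
counts in the buckets of `W`.  The buckets of `W` are treated one at a time, by comparing
coefficients of polynomials in the weight of the bucket. -/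
lemma sum_prescribed_counts (n : ℕ) (W : Finset J) : ∀ (u : J → ℝ) (a : J → ℕ),
    (∑ h : Fin n → J, if ∀ i ∈ W, fiberCount h i = a i then ∏ j ∈ Wᶜ, u j ^ fiberCount h j else 0) *
      ∏ i ∈ W, ((a i).factorial : ℝ) =
    n.descFactorial (∑ i ∈ W, a i) * (∑ j ∈ Wᶜ, u j) ^ (n - ∑ i ∈ W, a i) := by
  induction W using Finset.induction_on with
  | empty =>
    intro u a
    simp only [Finset.notMem_empty, false_imp_iff, implies_true, if_true, Finset.compl_empty,
      Finset.prod_empty, mul_one, Finset.sum_empty, Nat.descFactorial_zero, Nat.cast_one, one_mul,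
      Nat.sub_zero]
    rw [Fintype.sum_pow]
    exact Finset.sum_congr rfl fun h _ => (prod_comp_eq_prod_pow h u).symm
  | insert i W hi ih =>
    intro u a
    have hcompl : Wᶜ = insert i (insert i W)ᶜ := by
      ext j; by_cases hj : j = i <;> simp [hj, hi]
    have hni : i ∉ (insert i W)ᶜ := by simp
    set N := n - ∑ i ∈ W, a i with hN
    set c := ∑ j ∈ (insert i W)ᶜ, u j with hc
    let p : Polynomial ℝ := ∑ h : Fin n → J, Polynomial.monomial (fiberCount h i)
      ((if ∀ i ∈ W, fiberCount h i = a i then ∏ j ∈ (insert i W)ᶜ, u j ^ fiberCount h j else 0) *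
        ∏ i ∈ W, ((a i).factorial : ℝ))
    let q : Polynomial ℝ := Polynomial.C (n.descFactorial (∑ i ∈ W, a i) : ℝ) *
      (Polynomial.X + Polynomial.C c) ^ N
    have hpq : p = q := by
      refine Polynomial.funext fun w => ?_
      have h1 := ih (Function.update u i w) a
      have hupd : ∀ f : J → ℕ, ∏ j ∈ (insert i W)ᶜ, Function.update u i w j ^ f j =
          ∏ j ∈ (insert i W)ᶜ, u j ^ f j := fun f =>
        Finset.prod_congr rfl fun j hj => by
          rw [Function.update_of_ne (ne_of_mem_of_not_mem hj hni)]
      have hupd' : ∑ j ∈ (insert i W)ᶜ, Function.update u i w j = c :=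
        Finset.sum_congr rfl fun j hj => by
          rw [Function.update_of_ne (ne_of_mem_of_not_mem hj hni)]
      simp only [hcompl, Finset.prod_insert hni, Finset.sum_insert hni, Function.update_self, hupd,
        hupd'] at h1
      simp only [p, q, Polynomial.eval_finsetSum, Polynomial.eval_monomial, Polynomial.eval_mul,
        Polynomial.eval_C, Polynomial.eval_pow, Polynomial.eval_add, Polynomial.eval_X]
      rw [← h1, Finset.sum_mul]
      refine Finset.sum_congr rfl fun h _ => ?_
      split_ifs <;> ring
    have hco := congrArg (fun r => Polynomial.coeff r (a i)) hpq
    simp only [p, q, Polynomial.finsetSum_coeff, Polynomial.coeff_monomial,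
      Polynomial.coeff_C_mul, Polynomial.coeff_X_add_C_pow] at hco
    have hsum : ∑ j ∈ insert i W, a j = (∑ j ∈ W, a j) + a i := by
      rw [Finset.sum_insert hi, add_comm]
    have hdesc : (n.descFactorial (∑ j ∈ W, a j) : ℝ) * (N.choose (a i) * (a i).factorial) =
        n.descFactorial (∑ j ∈ insert i W, a j) := by
      rw [hsum, mul_comm (N.choose (a i) : ℝ)]
      norm_cast
      rw [← Nat.descFactorial_eq_factorial_mul_choose, hN, mul_comm,
        ← Nat.descFactorial_mul_descFactorial (Nat.le_add_right (∑ j ∈ W, a j) (a i)),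
        Nat.add_sub_cancel_left]
    rw [← hdesc, hsum, ← Nat.sub_sub, ← hN, Finset.prod_insert hi]
    calc _ = (∑ h : Fin n → J, if fiberCount h i = a i then
          (if ∀ i ∈ W, fiberCount h i = a i then ∏ j ∈ (insert i W)ᶜ, u j ^ fiberCount h j else 0) *
            ∏ i ∈ W, ((a i).factorial : ℝ) else 0) * (a i).factorial := by
          rw [mul_comm ((a i).factorial : ℝ), ← mul_assoc, Finset.sum_mul]
          congr 1
          refine Finset.sum_congr rfl fun h _ => ?_
          simp only [Finset.forall_mem_insert]
          by_cases h1 : fiberCount h i = a i <;> simp [h1]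
      _ = _ := by rw [hco]; ring

/-- The number of hash functions with prescribed occupancy counts in the buckets of `W`. -/
lemma card_prescribed_counts (n : ℕ) (W : Finset J) (a : J → ℕ) :
    ((Finset.univ.filter fun h : Fin n → J => ∀ i ∈ W, fiberCount h i = a i).card : ℝ) *
      ∏ i ∈ W, ((a i).factorial : ℝ) =
    n.descFactorial (∑ i ∈ W, a i) * ((Fintype.card J : ℝ) - W.card) ^ (n - ∑ i ∈ W, a i) := by
  have h := sum_prescribed_counts n W (fun _ => 1) a
  simp only [one_pow, Finset.prod_const_one, Finset.sum_const, nsmul_eq_mul, mul_one] at h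
  rw [Finset.card_compl, Nat.cast_sub (Finset.card_le_univ W)] at h
  rw [← h, Finset.sum_boole]

end counts

/-! ### The exact model -/

/-- The uniform distribution on hash functions. -/
noncomputable def hashLaw (m n : ℕ) [NeZero m] : Measure (Fin n → Fin m) :=
  (PMF.uniformOfFintype (Fin n → Fin m)).toMeasure

instance (m n : ℕ) [NeZero m] : IsProbabilityMeasure (hashLaw m n) := by
  unfold hashLaw; infer_instance

/-- The law of the numbers of keys with hash addresses `0`, `-1`, `-2`, … -/
noncomputable def countsLaw (m n : ℕ) [NeZero m] : Measure (ℕ → ℕ) :=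
  (hashLaw m n).map fun h => homeCounts h 0

instance (m n : ℕ) [NeZero m] : IsProbabilityMeasure (countsLaw m n) :=
  Measure.isProbabilityMeasure_map (Measurable.of_discrete).aemeasurable

lemma integral_uniformOfFintype {α : Type*} [Fintype α] [Nonempty α] [MeasurableSpace α]
    [MeasurableSingletonClass α] (f : α → ℝ) :
    ∫ a, f a ∂(PMF.uniformOfFintype α).toMeasure = (∑ a, f a) / Fintype.card α := by
  rw [PMF.integral_eq_sum, Finset.sum_div]
  refine Finset.sum_congr rfl fun a _ => ?_
  rw [PMF.uniformOfFintype_apply, ENNReal.toReal_inv, ENNReal.toReal_natCast, smul_eq_mul]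
  ring

/-- As `y` ranges over a finite set, its rank takes each value once. -/
lemma sum_rank {n : ℕ} (B : Finset (Fin n)) (f : ℕ → ℝ) :
    ∑ y ∈ B, f (B.filter fun z => z < y).card = ∑ v ∈ Finset.range B.card, f v := by
  induction B using Finset.induction_on_max with
  | empty => simp
  | insert a B hlt ih =>
    have ha : a ∉ B := fun h => lt_irrefl _ (hlt a h)
    rw [Finset.sum_insert ha, Finset.card_insert_of_notMem ha, Finset.sum_range_succ, ← ih,
      add_comm]
    congr 1
    · refine Finset.sum_congr rfl fun y hy => ?_
      rw [Finset.filter_insert, if_neg (hlt y hy).asymm]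
    · rw [Finset.filter_insert, if_neg (lt_irrefl a), Finset.filter_true_of_mem hlt]

/-- Rotating the table. -/
lemma homeCounts_sub {m n : ℕ} [NeZero m] (h : Fin n → Fin m) (i : Fin m) :
    homeCounts (fun y => h y - i) 0 = homeCounts h i := by
  ext k
  unfold homeCounts homeCount
  split_ifs
  · congr 1
    ext y
    simp only [Finset.mem_filter, Finset.mem_univ, true_and]
    rw [sub_eq_iff_eq_add, zero_sub, neg_add_eq_sub]
  · rfl

lemma homeCounts_zero {m n : ℕ} [NeZero m] (h : Fin n → Fin m) (i : Fin m) :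
    homeCounts h i 0 = homeCount h i := by
  simp [homeCounts, Nat.pos_of_ne_zero (NeZero.ne m)]

lemma measurable_walk (b L : ℕ) : Measurable fun x : ℕ → ℕ => walk b x L := by
  unfold walk
  exact Finset.measurable_sum _ fun k _ =>
    (Measurable.of_discrete (f := fun j : ℕ => (j : ℤ) - b)).comp (measurable_pi_apply k)

lemma measurable_walkMax (b : ℕ) : Measurable (walkMax b) := by
  unfold walkMax
  exact (Measurable.of_discrete (f := Int.toNat)).comp (Measurable.iSup (measurable_walk b))

/-- The overflow into the home bucket, as a function of the numbers of keys with hash addresses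
`0`, `-1`, `-2`, … relative to the home bucket. -/
noncomputable def inflow (b : ℕ) (x : ℕ → ℕ) : ℕ := walkMax b fun k => x (k + 1)

lemma measurable_shift : Measurable fun (x : ℕ → ℕ) (k : ℕ) => x (k + 1) :=
  measurable_pi_lambda _ fun k => measurable_pi_apply (k + 1)

lemma measurable_inflow (b : ℕ) : Measurable (inflow b) :=
  (measurable_walkMax b).comp measurable_shift

/-- In the exact model, the law of the overflow and of the number of ties is obtained from the
table seen from a fixed bucket by size-biasing: every key of the bucket may be the marked one. -/
lemma integral_exactModel {m n b : ℕ} [NeZero m] [NeZero n] (σ : Equiv.Perm (Fin n))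
    (hn : n < b * m) (g : ℕ → ℕ → ℝ) :
    ∫ ω, g (overflowAt ω.1 (exactTable b σ ω.1) (ω.1 ω.2 - 1)) (Vex ω) ∂exactModel m n =
      (m / n : ℝ) * ∫ x, ∑ v ∈ Finset.range (x 0), g (inflow b x) v ∂countsLaw m n := by
  let F : (ℕ → ℕ) → ℝ := fun x => ∑ v ∈ Finset.range (x 0), g (inflow b x) v
  have hF : Measurable F :=
    (Measurable.of_discrete (f := fun p : ℕ × ℕ => ∑ v ∈ Finset.range p.1, g p.2 v)).comp
      ((measurable_pi_apply 0).prodMk (measurable_inflow b))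
  have hm0 : (m : ℝ) ≠ 0 := by exact_mod_cast NeZero.ne m
  have hn0 : (n : ℝ) ≠ 0 := by exact_mod_cast NeZero.ne n
  have hrhs : ∫ x, F x ∂countsLaw m n =
      (∑ h : Fin n → Fin m, F (homeCounts h 0)) / (m ^ n : ℝ) := by
    unfold countsLaw hashLaw
    rw [integral_map (Measurable.of_discrete).aemeasurable hF.aestronglyMeasurable,
      integral_uniformOfFintype]
    simp
  have hlhs : ∀ h : Fin n → Fin m, ∑ y : Fin n,
      g (overflowAt h (exactTable b σ h) (h y - 1)) (Vex (h, y)) = ∑ i, F (homeCounts h i) := by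
    intro h
    rw [← Finset.sum_fiberwise (s := Finset.univ) (g := h)]
    refine Finset.sum_congr rfl fun i _ => ?_
    simp only [F]
    rw [homeCounts_zero, homeCount, ← sum_rank]
    refine Finset.sum_congr rfl fun y hy => ?_
    have hy' : h y = i := (Finset.mem_filter.mp hy).2
    rw [hy', overflowAt_eq_walkMax σ h hn, Vex, Finset.filter_filter]
    simp only [hy']
    rfl
  have hrot : ∀ i : Fin m, ∑ h : Fin n → Fin m, F (homeCounts h i) =
      ∑ h : Fin n → Fin m, F (homeCounts h 0) := by
    intro i
    simp_rw [← homeCounts_sub _ i]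
    exact Equiv.sum_comp (Equiv.subRight (fun _ : Fin n => i)) fun h => F (homeCounts h 0)
  -- By rotation, every home bucket contributes the same.
  change _ = (m / n : ℝ) * ∫ x, F x ∂countsLaw m n
  rw [hrhs, exactModel, integral_uniformOfFintype, Fintype.sum_prod_type]
  simp_rw [hlhs]
  rw [Finset.sum_comm]
  simp_rw [hrot]
  simp only [Finset.sum_const, Finset.card_univ, Fintype.card_fin, nsmul_eq_mul,
    Fintype.card_prod, Fintype.card_pi, Finset.prod_const, Nat.cast_mul, Nat.cast_pow]
  field_simp

/-- An exponential moment bound that agrees with independent Poisson variables of mean `n / m`. -/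
lemma lintegral_countsLaw_le {m n : ℕ} [NeZero m] (L : ℕ) (w : ℕ → ℝ) (hw : ∀ k, 1 ≤ w k) :
    ∫⁻ x, ENNReal.ofReal (∏ k ∈ Finset.range L, w k ^ x k) ∂countsLaw m n ≤
      ENNReal.ofReal (Real.exp ((n / m : ℝ) * ∑ k ∈ Finset.range L, (w k - 1))) := by
  have hw0 : ∀ k, 0 ≤ w k := fun k => zero_le_one.trans (hw k)
  have hm0 : (m : ℝ) ≠ 0 := by exact_mod_cast NeZero.ne m
  have hmpos : (0 : ℝ) < m := by exact_mod_cast Nat.pos_of_ne_zero (NeZero.ne m)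
  have hmeas : Measurable fun x : ℕ → ℕ => ENNReal.ofReal (∏ k ∈ Finset.range L, w k ^ x k) :=
    ENNReal.measurable_ofReal.comp (Finset.measurable_prod _ fun k _ =>
      (Measurable.of_discrete (f := fun j : ℕ => w k ^ j)).comp (measurable_pi_apply k))
  unfold countsLaw
  rw [lintegral_map hmeas Measurable.of_discrete, ← ofReal_integral_eq_lintegral_ofReal
    (Integrable.of_finite)
    (ae_of_all _ fun h => Finset.prod_nonneg fun k _ => pow_nonneg (hw0 k) _)]
  refine ENNReal.ofReal_le_ofReal ?_
  rw [hashLaw, integral_uniformOfFintype]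
  -- The weight of a key is the weight of its bucket, so the sum over hash functions is a power.
  let u : ℕ → ℝ := fun k => if k < L then w k else 1
  have hfil : (Finset.range L).filter (· < m) = (Finset.range m).filter (· < L) := by
    ext k; simp [and_comm]
  have hprod : ∀ h : Fin n → Fin m, ∏ k ∈ Finset.range L, w k ^ homeCounts h 0 k =
      ∏ y, u (0 - h y : Fin m).val := by
    intro h
    rw [prod_comp_eq_prod_pow h fun j => u (0 - j : Fin m).val,
      ← Equiv.prod_comp (Equiv.subLeft (0 : Fin m))]
    simp only [Equiv.subLeft_apply, sub_sub_cancel]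
    have e1 : ∀ j : Fin m, u j.val ^ fiberCount h (0 - j) = u j.val ^ homeCounts h 0 j.val := by
      intro j
      simp [homeCounts, homeCount, fiberCount]
    rw [Finset.prod_congr rfl fun j _ => e1 j,
      Fin.prod_univ_eq_prod_range (fun k => u k ^ homeCounts h 0 k) m]
    rw [← Finset.prod_filter_mul_prod_filter_not (Finset.range L) (· < m),
      ← Finset.prod_filter_mul_prod_filter_not (Finset.range m) (· < L), hfil]
    congr 1
    · refine Finset.prod_congr rfl fun k hk => ?_
      simp [u, (Finset.mem_filter.mp hk).2]
    · rw [Finset.prod_eq_one, Finset.prod_eq_one]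
      · intro k hk
        simp [u, (Finset.mem_filter.mp hk).2]
      · intro k hk
        simp [homeCounts, (Finset.mem_filter.mp hk).2]
  have hsum : ∑ j : Fin m, u (0 - j : Fin m).val ≤ m + ∑ k ∈ Finset.range L, (w k - 1) := by
    rw [← Equiv.sum_comp (Equiv.subLeft (0 : Fin m))]
    simp only [Equiv.subLeft_apply, sub_sub_cancel]
    rw [Fin.sum_univ_eq_sum_range u m]
    have e2 : ∀ k, u k = 1 + if k < L then w k - 1 else 0 := by
      intro k; simp only [u]; split_ifs <;> ring
    simp_rw [e2]
    rw [Finset.sum_add_distrib, ← Finset.sum_filter, ← hfil]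
    simp only [Finset.sum_const, Finset.card_range, nsmul_eq_mul, mul_one]
    gcongr
    · exact fun k _ _ => sub_nonneg.mpr (hw k)
    · exact Finset.filter_subset _ _
  have hsum0 : 0 ≤ ∑ j : Fin m, u (0 - j : Fin m).val :=
    Finset.sum_nonneg fun j _ => by simp only [u]; split_ifs <;> simp [hw0]
  simp_rw [hprod]
  rw [← Fintype.sum_pow (fun j : Fin m => u (0 - j : Fin m).val)]
  simp only [Fintype.card_pi, Fintype.card_fin, Finset.prod_const, Finset.card_univ, Nat.cast_pow]
  rw [← div_pow]
  set s := ∑ k ∈ Finset.range L, (w k - 1) with hs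
  calc ((∑ j : Fin m, u (0 - j : Fin m).val) / m) ^ n ≤ (s / m + 1) ^ n := by
        refine pow_le_pow_left₀ (by positivity) ?_ n
        rw [div_add_one hm0]
        gcongr
        linarith
    _ ≤ (Real.exp (s / m)) ^ n := by
        refine pow_le_pow_left₀ ?_ (Real.add_one_le_exp _) n
        have : 0 ≤ s := Finset.sum_nonneg fun k _ => sub_nonneg.mpr (hw k)
        positivity
    _ = Real.exp ((n / m : ℝ) * s) := by
        rw [← Real.exp_nat_mul]; congr 1; field_simp

/-- The multinomial probabilities of prescribed counts in distinct buckets. -/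
lemma countsLaw_window {m n : ℕ} [NeZero m] (W : Finset ℕ) (hW : W ⊆ Finset.range m)
    (a : ℕ → ℕ) :
    (countsLaw m n).real {x | ∀ k ∈ W, x k = a k} =
      (n.descFactorial (∑ k ∈ W, a k) : ℝ) / m ^ (∑ k ∈ W, a k) *
        (1 - W.card / m) ^ (n - ∑ k ∈ W, a k) / ∏ k ∈ W, ((a k).factorial : ℝ) := by
  have hm0 : (m : ℝ) ≠ 0 := by exact_mod_cast NeZero.ne m
  let e : ℕ → Fin m := fun k => 0 - Fin.ofNat m k
  let e' : Fin m → ℕ := fun j => (0 - j : Fin m).val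
  have he : ∀ k ∈ W, e' (e k) = k := fun k hk => by
    have := Finset.mem_range.mp (hW hk)
    simp [e, e', Nat.mod_eq_of_lt this]
  have hinj : Set.InjOn e W := fun k hk l hl hkl => by
    rw [← he k hk, ← he l hl, hkl]
  have hset : MeasurableSet {x : ℕ → ℕ | ∀ k ∈ W, x k = a k} := by
    have : {x : ℕ → ℕ | ∀ k ∈ W, x k = a k} = ⋂ k ∈ W, (fun x : ℕ → ℕ => x k) ⁻¹' {a k} := by
      ext x; simp
    rw [this]
    exact Finset.measurableSet_biInter _ fun k _ =>
      measurable_pi_apply k (measurableSet_singleton _)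
  have hcard := card_prescribed_counts n (W.image e) (fun j => a (e' j))
  have h1 : ∑ j ∈ W.image e, a (e' j) = ∑ k ∈ W, a k := by
    rw [Finset.sum_image hinj]
    exact Finset.sum_congr rfl fun k hk => by rw [he k hk]
  have h2 : ∏ j ∈ W.image e, ((a (e' j)).factorial : ℝ) = ∏ k ∈ W, ((a k).factorial : ℝ) := by
    rw [Finset.prod_image hinj]
    exact Finset.prod_congr rfl fun k hk => by rw [he k hk]
  rw [h1, h2, Finset.card_image_of_injOn hinj, Fintype.card_fin] at hcard
  have hP : (∏ k ∈ W, ((a k).factorial : ℝ)) ≠ 0 :=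
    Finset.prod_ne_zero_iff.mpr fun k _ => by exact_mod_cast (a k).factorial_ne_zero
  have hprob : (countsLaw m n).real {x | ∀ k ∈ W, x k = a k} =
      ((Finset.univ.filter fun h : Fin n → Fin m =>
        ∀ i ∈ W.image e, fiberCount h i = a (e' i)).card : ℝ) / m ^ n := by
    rw [← integral_indicator_one hset, countsLaw, integral_map (Measurable.of_discrete).aemeasurable
      (measurable_one.indicator hset).aestronglyMeasurable, hashLaw, integral_uniformOfFintype]
    congr 1
    · rw [← Finset.sum_boole]
      refine Finset.sum_congr rfl fun h _ => ?_
      rw [Set.indicator_apply]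
      congr 1
      rw [Set.mem_ofPred_eq, eq_iff_iff, Finset.forall_mem_image]
      refine forall₂_congr fun k hk => ?_
      rw [he k hk, homeCounts, if_pos (Finset.mem_range.mp (hW hk))]
      rfl
    · simp
  rw [hprob, eq_div_iff hP, div_mul_eq_mul_div]
  refine (congrArg (· / (m : ℝ) ^ n) (Eq.trans ?_ hcard)).trans ?_
  · congr!
  by_cases hA : ∑ k ∈ W, a k ≤ n
  · have e3 : (m : ℝ) ^ n = m ^ (∑ k ∈ W, a k) * m ^ (n - ∑ k ∈ W, a k) := by
      rw [← pow_add]; congr 1; omega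
    rw [e3, one_sub_div hm0, div_pow]
    field_simp
  · rw [Nat.descFactorial_of_lt (not_le.mp hA)]; simp

/-- The occupancy counts of a bounded number of buckets become independent Poisson variables. -/
lemma tendsto_countsLaw_window {lam : ℝ} {m n : ℕ → ℕ} [∀ k, NeZero (m k)]
    (hm : Tendsto m atTop atTop) (hn : Tendsto n atTop atTop)
    (hmn : Tendsto (fun k => (n k : ℝ) / m k) atTop (𝓝 lam)) (W : Finset ℕ) (a : ℕ → ℕ) :
    Tendsto (fun k => (countsLaw (m k) (n k)).real {x | ∀ i ∈ W, x i = a i}) atTop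
      (𝓝 (∏ i ∈ W, (Real.exp (-lam) * lam ^ a i / (a i).factorial))) := by
  set A := ∑ i ∈ W, a i with hA
  have hmR : Tendsto (fun k => (m k : ℝ)) atTop atTop := tendsto_natCast_atTop_atTop.comp hm
  have hsub : ∀ c : ℕ, Tendsto (fun k => ((n k - c : ℕ) : ℝ) / m k) atTop (𝓝 lam) := by
    intro c
    have h1 : Tendsto (fun k => (n k : ℝ) / m k - c / m k) atTop (𝓝 (lam - 0)) :=
      hmn.sub (hmR.const_div_atTop _)
    rw [sub_zero] at h1
    refine h1.congr' ?_
    filter_upwards [hn.eventually_ge_atTop c] with k hk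
    rw [Nat.cast_sub hk, sub_div]
  have hdesc : ∀ c : ℕ, Tendsto (fun k => ((n k).descFactorial c : ℝ) / (m k : ℝ) ^ c) atTop
      (𝓝 (lam ^ c)) := by
    intro c
    induction c with
    | zero => simp
    | succ c ih =>
      rw [pow_succ']
      refine ((hsub c).mul ih).congr fun k => ?_
      rw [Nat.descFactorial_succ, Nat.cast_mul, pow_succ']
      rw [div_mul_div_comm]
  have hexp : Tendsto (fun k => (1 - (W.card : ℝ) / m k) ^ (n k - A)) atTop
      (𝓝 (Real.exp (lam * (-W.card)))) := by
    have hlog : Tendsto (fun k => (m k : ℝ) * Real.log (1 + -(W.card : ℝ) / m k)) atTop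
        (𝓝 (-W.card)) := by
      refine (Real.tendsto_mul_log_one_add_of_tendsto (g := fun x => -(W.card : ℝ) / x) ?_).comp hmR
      refine tendsto_const_nhds.congr' ?_
      filter_upwards [eventually_ne_atTop 0] with x hx
      field_simp
    refine (Real.continuous_exp.continuousAt.tendsto.comp ((hsub A).mul hlog)).congr' ?_
    filter_upwards [hmR.eventually_gt_atTop (W.card : ℝ)] with k hk
    have hm0 : (0 : ℝ) < m k := lt_of_le_of_lt (Nat.cast_nonneg _) hk
    have hpos : 0 < 1 + -(W.card : ℝ) / m k := by
      rw [neg_div, ← sub_eq_add_neg, sub_pos, div_lt_one hm0]; exact hk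
    rw [Function.comp_apply, ← mul_assoc, div_mul_cancel₀ _ hm0.ne', Real.exp_nat_mul,
      Real.exp_log hpos, neg_div, ← sub_eq_add_neg]
  have hlim : ∏ i ∈ W, (Real.exp (-lam) * lam ^ a i / (a i).factorial) =
      lam ^ A * Real.exp (lam * (-W.card)) / ∏ i ∈ W, ((a i).factorial : ℝ) := by
    rw [Finset.prod_div_distrib, Finset.prod_mul_distrib, Finset.prod_const,
      Finset.prod_pow_eq_pow_sum, ← Real.exp_nat_mul, mul_comm (lam ^ A)]
    congr 3
    ring
  rw [hlim]
  refine (((hdesc A).mul hexp).div_const _).congr' ?_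
  obtain ⟨B, hB⟩ : ∃ B, W ⊆ Finset.range B := W.exists_nat_subset_range
  filter_upwards [hm.eventually_ge_atTop B] with k hk
  rw [countsLaw_window W (hB.trans (Finset.range_subset_range.mpr hk)) a]

/-! ### Convergence of random variables with values in the nonnegative integers -/

section natValued

variable {Ω : Type*} [MeasurableSpace Ω] {P : Measure Ω} {Y : Ω → ℕ}

/-- Markov's inequality. -/
lemma measureReal_preimage_le [IsFiniteMeasure P] {s M : ℝ} (hs : 0 < s) (hM : 0 ≤ M)
    (hY : Measurable Y) (h : ∫⁻ ω, ENNReal.ofReal (s ^ Y ω) ∂P ≤ ENNReal.ofReal M) (c : ℕ) :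
    P.real (Y ⁻¹' {c}) * s ^ c ≤ M := by
  have hset : MeasurableSet (Y ⁻¹' {c}) := hY (measurableSet_singleton c)
  have h1 : ENNReal.ofReal (s ^ c) * P (Y ⁻¹' {c}) ≤ ENNReal.ofReal M := by
    rw [← setLIntegral_const]
    refine le_trans (le_of_eq ?_) ((setLIntegral_le_lintegral (Y ⁻¹' {c}) _).trans h)
    refine setLIntegral_congr_fun hset fun ω hω => ?_
    have : Y ω = c := hω
    simp only [this]
  rw [← ofReal_measureReal, ← ENNReal.ofReal_mul (by positivity),
    ENNReal.ofReal_le_ofReal_iff hM] at h1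
  linarith

lemma integrable_comp_of_le {E : Type*} [NormedAddCommGroup E] {s M K : ℝ} (hs : 0 < s)
    (hY : Measurable Y) (h : ∫⁻ ω, ENNReal.ofReal (s ^ Y ω) ∂P ≤ ENNReal.ofReal M) {f : ℕ → E}
    (hf : ∀ c, ‖f c‖ ≤ K * s ^ c) : Integrable (fun ω => f (Y ω)) P := by
  have h1 : Integrable (fun ω => s ^ Y ω) P := by
    refine ⟨((Measurable.of_discrete (f := fun c : ℕ => s ^ c)).comp hY).aestronglyMeasurable, ?_⟩
    rw [hasFiniteIntegral_iff_ofReal (ae_of_all _ fun ω => by positivity)]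
    exact h.trans_lt ENNReal.ofReal_lt_top
  refine (h1.const_mul K).mono' ?_ (ae_of_all _ fun ω => hf _)
  exact (StronglyMeasurable.of_discrete (f := f)).comp_measurable hY |>.aestronglyMeasurable

lemma hasSum_integral_comp {E : Type*} [NormedAddCommGroup E] [NormedSpace ℝ E] [CompleteSpace E]
    (hY : Measurable Y) {f : ℕ → E} (hf : Integrable (fun ω => f (Y ω)) P) :
    HasSum (fun c => P.real (Y ⁻¹' {c}) • f c) (∫ ω, f (Y ω) ∂P) := by
  have hsm : AEStronglyMeasurable f (P.map Y) :=
    (StronglyMeasurable.of_discrete (f := f)).aestronglyMeasurable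
  have hf' : Integrable f (P.map Y) := (integrable_map_measure hsm hY.aemeasurable).mpr hf
  have h := hasSum_integral_iUnion (μ := P.map Y) (f := f) (s := fun c : ℕ => {c})
    (fun c => measurableSet_singleton c) (fun i j hij => by simpa using hij)
    hf'.integrableOn
  rw [Set.iUnion_of_singleton, Measure.restrict_univ, integral_map hY.aemeasurable hsm] at h
  convert h using 2 with c
  rw [integral_singleton, map_measureReal_apply hY (measurableSet_singleton c)]

/-- The setting for convergence: pointwise convergence of the probabilities, together with a common
exponential moment of base `s`. -/
structure TiltedConv {Ω : ℕ → Type*} [∀ k, MeasurableSpace (Ω k)] (P : ∀ k, Measure (Ω k))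
    (Y : ∀ k, Ω k → ℕ) {Ω' : Type*} [MeasurableSpace Ω'] (P' : Measure Ω') (Y' : Ω' → ℕ)
    (s M : ℝ) : Prop where
  meas : ∀ k, Measurable (Y k)
  meas' : Measurable Y'
  bound : ∀ᶠ k in atTop, ∫⁻ ω, ENNReal.ofReal (s ^ Y k ω) ∂P k ≤ ENNReal.ofReal M
  bound' : ∫⁻ ω, ENNReal.ofReal (s ^ Y' ω) ∂P' ≤ ENNReal.ofReal M
  conv : ∀ c, Tendsto (fun k => (P k).real (Y k ⁻¹' {c})) atTop (𝓝 (P'.real (Y' ⁻¹' {c})))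

variable {Ω : ℕ → Type*} [∀ k, MeasurableSpace (Ω k)] {P : ∀ k, Measure (Ω k)}
  {Y : ∀ k, Ω k → ℕ} {Ω' : Type*} [MeasurableSpace Ω'] {P' : Measure Ω'} {Y' : Ω' → ℕ} {s t M : ℝ}

/-- The error for a test function is controlled by the weighted total variation, uniformly in the
test function. -/
lemma TiltedConv.norm_integral_sub_le {E : Type*} [NormedAddCommGroup E] [NormedSpace ℝ E]
    [CompleteSpace E] (h : TiltedConv P Y P' Y' s M) (ht : 0 < t) (hts : t < s) :
    ∀ᶠ k in atTop, ∀ (f : ℕ → E) (K : ℝ), 0 ≤ K → (∀ c, ‖f c‖ ≤ K * t ^ c) →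
      ‖∫ ω, f (Y k ω) ∂P k - ∫ ω, f (Y' ω) ∂P'‖ ≤
        K * ∑' c, |(P k).real (Y k ⁻¹' {c}) - P'.real (Y' ⁻¹' {c})| * t ^ c := by
  have hs : 0 < s := ht.trans hts
  filter_upwards [h.bound] with k hk f K hK hf
  have hf' : ∀ c, ‖f c‖ ≤ K * s ^ c := fun c => (hf c).trans (by gcongr)
  have i1 := hasSum_integral_comp (h.meas k) (integrable_comp_of_le hs (h.meas k) hk hf')
  have i2 := hasSum_integral_comp h.meas' (integrable_comp_of_le hs h.meas' h.bound' hf')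
  have j1 := (hasSum_integral_comp (h.meas k) (f := fun c => t ^ c)
    (integrable_comp_of_le (K := 1) hs (h.meas k) hk fun c => by
      rw [Real.norm_of_nonneg (by positivity), one_mul]; gcongr)).summable
  have j2 := (hasSum_integral_comp h.meas' (f := fun c => t ^ c)
    (integrable_comp_of_le (K := 1) hs h.meas' h.bound' fun c => by
      rw [Real.norm_of_nonneg (by positivity), one_mul]; gcongr)).summable
  have hsum : Summable fun c => |(P k).real (Y k ⁻¹' {c}) - P'.real (Y' ⁻¹' {c})| * t ^ c := by
    refine ((j1.sub j2).abs).congr fun c => ?_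
    rw [smul_eq_mul, smul_eq_mul, ← sub_mul, abs_mul, abs_of_pos (pow_pos ht c)]
  have i3 := i1.sub i2
  rw [← i3.tsum_eq, ← tsum_mul_left]
  refine tsum_of_norm_bounded (hsum.mul_left K).hasSum fun c => ?_
  rw [← sub_smul, norm_smul, Real.norm_eq_abs]
  calc _ ≤ |(P k).real (Y k ⁻¹' {c}) - P'.real (Y' ⁻¹' {c})| * (K * t ^ c) := by
        gcongr; exact hf c
    _ = _ := by ring

variable [∀ k, IsProbabilityMeasure (P k)] [IsProbabilityMeasure P']

/-- Weighted total variation converges to zero, by dominated convergence of series. -/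
lemma TiltedConv.tendsto_tsum (h : TiltedConv P Y P' Y' s M) (ht : 0 < t) (hts : t < s)
    (hM : 0 ≤ M) :
    Tendsto (fun k => ∑' c, |(P k).real (Y k ⁻¹' {c}) - P'.real (Y' ⁻¹' {c})| * t ^ c) atTop
      (𝓝 0) := by
  have hs : 0 < s := ht.trans hts
  have hsum : Summable fun c : ℕ => 2 * M * (t / s) ^ c :=
    (summable_geometric_of_lt_one (by positivity) ((div_lt_one hs).mpr hts)).mul_left _
  have hlim : ∀ c, Tendsto
      (fun k => |(P k).real (Y k ⁻¹' {c}) - P'.real (Y' ⁻¹' {c})| * t ^ c) atTop (𝓝 0) := by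
    intro c
    have := ((h.conv c).sub_const (P'.real (Y' ⁻¹' {c}))).abs.mul_const (t ^ c)
    simpa using this
  have hdom := tendsto_tsum_of_dominated_convergence hsum hlim ?_
  · simpa using hdom
  filter_upwards [h.bound] with k hk c
  have h1 := measureReal_preimage_le hs hM (h.meas k) hk c
  have h2 := measureReal_preimage_le hs hM h.meas' h.bound' c
  have hsc : 0 < s ^ c := by positivity
  rw [Real.norm_of_nonneg (by positivity), div_pow, mul_div_assoc', le_div_iff₀ hsc]
  have h3 : |(P k).real (Y k ⁻¹' {c}) - P'.real (Y' ⁻¹' {c})| ≤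
      (P k).real (Y k ⁻¹' {c}) + P'.real (Y' ⁻¹' {c}) := by
    refine (abs_sub _ _).trans (le_of_eq ?_)
    rw [abs_of_nonneg measureReal_nonneg, abs_of_nonneg measureReal_nonneg]
  calc _ = |(P k).real (Y k ⁻¹' {c}) - P'.real (Y' ⁻¹' {c})| * s ^ c * t ^ c := by ring
    _ ≤ ((P k).real (Y k ⁻¹' {c}) + P'.real (Y' ⁻¹' {c})) * s ^ c * t ^ c := by gcongr
    _ ≤ 2 * M * t ^ c := by
        refine mul_le_mul_of_nonneg_right ?_ (by positivity)
        linarith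

lemma TiltedConv.tendsto_integral {E : Type*} [NormedAddCommGroup E] [NormedSpace ℝ E]
    [CompleteSpace E] (h : TiltedConv P Y P' Y' s M) (ht : 0 < t) (hts : t < s) (hM : 0 ≤ M)
    {f : ℕ → E} {K : ℝ} (hK : 0 ≤ K) (hf : ∀ c, ‖f c‖ ≤ K * t ^ c) :
    Tendsto (fun k => ∫ ω, f (Y k ω) ∂P k) atTop (𝓝 (∫ ω, f (Y' ω) ∂P')) := by
  rw [tendsto_iff_norm_sub_tendsto_zero]
  have h1 := (h.tendsto_tsum ht hts hM).const_mul K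
  rw [mul_zero] at h1
  refine tendsto_of_tendsto_of_tendsto_of_le_of_le' tendsto_const_nhds h1
    (Eventually.of_forall fun k => norm_nonneg _) ?_
  filter_upwards [h.norm_integral_sub_le (E := E) ht hts] with k hk
  exact hk f K hK hf

lemma TiltedConv.tendstoInDistribution (h : TiltedConv P Y P' Y' s M) (hs : 1 < s)
    (hM : 0 ≤ M) : TendstoInDistribution Y atTop Y' P P' where
  forall_aemeasurable k := (h.meas k).aemeasurable
  aemeasurable_limit := h.meas'.aemeasurable
  tendsto := by
    refine ProbabilityMeasure.tendsto_iff_forall_integral_tendsto.mpr fun f => ?_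
    have h1 := h.tendsto_integral one_pos hs hM (f := fun c => f c) (K := ‖f‖) (norm_nonneg _)
      (fun c => by simpa using f.norm_coe_le_norm c)
    refine (h1.congr fun k => ?_).trans (le_of_eq ?_)
    · exact (integral_map (h.meas k).aemeasurable
        (f.continuous.aestronglyMeasurable)).symm
    · congr 1
      exact (integral_map h.meas'.aemeasurable (f.continuous.aestronglyMeasurable)).symm

lemma exists_pow_le_mul_pow (r : ℕ) {t : ℝ} (ht : 1 < t) :
    ∃ K : ℝ, 0 ≤ K ∧ ∀ c : ℕ, (c : ℝ) ^ r ≤ K * t ^ c := by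
  have h := tendsto_pow_const_div_const_pow_of_one_lt r ht
  obtain ⟨K, hK⟩ := h.bddAbove_range
  have hK' : ∀ c : ℕ, (c : ℝ) ^ r / t ^ c ≤ K := fun c => hK ⟨c, rfl⟩
  refine ⟨K, le_trans (by positivity) (hK' 0), fun c => ?_⟩
  exact (div_le_iff₀ (by positivity)).mp (hK' c)

lemma TiltedConv.tendsto_moment (h : TiltedConv P Y P' Y' s M) (ht : 1 < t) (hts : t < s)
    (hM : 0 ≤ M) (r : ℕ) :
    Integrable (fun ω => (Y' ω : ℝ) ^ r) P' ∧
      Tendsto (fun k => moment (P k) (Y k) r) atTop (𝓝 (moment P' Y' r)) := by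
  obtain ⟨K, hK, hle⟩ := exists_pow_le_mul_pow r ht
  have hle' : ∀ c : ℕ, ‖(c : ℝ) ^ r‖ ≤ K * t ^ c := fun c => by
    rw [Real.norm_of_nonneg (by positivity)]; exact hle c
  have ht0 : 0 < t := one_pos.trans ht
  exact ⟨integrable_comp_of_le (ht0.trans hts) h.meas' h.bound' (f := fun c => (c : ℝ) ^ r)
    fun c => (hle' c).trans (by gcongr), h.tendsto_integral ht0 hts hM hK hle'⟩

lemma TiltedConv.tendstoUniformlyOn_pgf (h : TiltedConv P Y P' Y' s M) (ht : 0 < t)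
    (hts : t < s) (hM : 0 ≤ M) :
    TendstoUniformlyOn (fun k => pgf (P k) (Y k)) (pgf P' Y') atTop (Metric.closedBall 0 t) := by
  rw [Metric.tendstoUniformlyOn_iff]
  intro ε hε
  filter_upwards [h.norm_integral_sub_le (E := ℂ) ht hts,
    (h.tendsto_tsum ht hts hM).eventually (gt_mem_nhds hε)] with k hk hlt q hq
  rw [dist_comm, dist_eq_norm]
  have hq' : ‖q‖ ≤ t := by simpa using hq
  refine lt_of_le_of_lt (hk (fun c => q ^ c) 1 zero_le_one fun c => ?_) (by rwa [one_mul])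
  rw [norm_pow, one_mul]
  exact pow_le_pow_left₀ (norm_nonneg _) hq' c

end natValued

/-! ### The inflow from the preceding buckets -/

/-- The exponential moments of the sequence are at most those of independent Poisson variables
of mean `lam`. -/
def PoissonDominated (μ : Measure (ℕ → ℕ)) (lam : ℝ) : Prop :=
  ∀ (L : ℕ) (w : ℕ → ℝ), (∀ k, 1 ≤ w k) →
    ∫⁻ x, ENNReal.ofReal (∏ k ∈ Finset.range L, w k ^ x k) ∂μ ≤
      ENNReal.ofReal (Real.exp (lam * ∑ k ∈ Finset.range L, (w k - 1)))

lemma PoissonDominated.mono {μ : Measure (ℕ → ℕ)} {lam lam' : ℝ} (h : PoissonDominated μ lam)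
    (hl : lam ≤ lam') : PoissonDominated μ lam' := fun L w hw => by
  refine (h L w hw).trans (ENNReal.ofReal_le_ofReal (Real.exp_le_exp.mpr ?_))
  exact mul_le_mul_of_nonneg_right hl (Finset.sum_nonneg fun k _ => sub_nonneg.mpr (hw k))

/-- The exponential rate at which the walk `walk b` drifts to `-∞`. -/
noncomputable def driftRate (b : ℕ) (lam r : ℝ) : ℝ := Real.exp (lam * (r - 1)) / r ^ b

lemma zpow_walk {r : ℝ} (hr : 0 < r) (b : ℕ) (x : ℕ → ℕ) (l : ℕ) :
    r ^ walk b x l = (∏ k ∈ Finset.range l, r ^ x k) / (r ^ b) ^ l := by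
  induction l with
  | zero => simp
  | succ l ih =>
    rw [walk_succ, zpow_add₀ hr.ne', ih, zpow_sub₀ hr.ne', zpow_natCast, zpow_natCast,
      Finset.prod_range_succ, pow_succ, div_mul_div_comm]

section dominated

variable {μ : Measure (ℕ → ℕ)} {b : ℕ} {lam r : ℝ}

/-- The weight `A` on the home bucket comes in when averages are taken over its keys. -/
lemma PoissonDominated.lintegral_walk_le (h : PoissonDominated μ lam) (hr : 1 ≤ r) {A : ℝ}
    (hA : 1 ≤ A) (l : ℕ) :
    ∫⁻ x, ENNReal.ofReal (A ^ x 0 * r ^ walk b (fun k => x (k + 1)) l) ∂μ ≤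
      ENNReal.ofReal (Real.exp (lam * (A - 1)) * driftRate b lam r ^ l) := by
  have hr0 : 0 < r := one_pos.trans_le hr
  let w : ℕ → ℝ := fun k => if k = 0 then A else r
  have h1 := h (l + 1) w (fun k => by simp only [w]; split_ifs <;> assumption)
  have h2 : ∀ x : ℕ → ℕ, A ^ x 0 * r ^ walk b (fun k => x (k + 1)) l =
      (∏ k ∈ Finset.range (l + 1), w k ^ x k) * ((r ^ b) ^ l)⁻¹ := by
    intro x
    rw [zpow_walk hr0, Finset.prod_range_succ']
    simp only [w, Nat.add_eq_zero_iff, one_ne_zero, and_false, if_false, if_true]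
    ring
  have h3 : (0 : ℝ) ≤ ((r ^ b) ^ l)⁻¹ := by positivity
  simp_rw [h2, ENNReal.ofReal_mul' h3]
  rw [lintegral_mul_const' _ _ ENNReal.ofReal_ne_top]
  refine (mul_le_mul_left h1 _).trans (le_of_eq ?_)
  rw [← ENNReal.ofReal_mul' h3, Finset.sum_range_succ']
  congr 1
  simp only [w, Nat.add_eq_zero_iff, one_ne_zero, and_false, if_false, if_true, Finset.sum_const,
    Finset.card_range, nsmul_eq_mul]
  rw [driftRate, div_pow, ← Real.exp_nat_mul, mul_add, Real.exp_add]
  rw [show lam * ((l : ℝ) * (r - 1)) = (l : ℝ) * (lam * (r - 1)) by ring]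
  ring

lemma driftRate_nonneg (b : ℕ) (lam : ℝ) (hr : 0 ≤ r) : 0 ≤ driftRate b lam r :=
  div_nonneg (Real.exp_nonneg _) (pow_nonneg hr _)

/-- The maximum is one of the terms; if the walk is unbounded, the junk value `0` of the maximum is
that of the initial term. -/
lemma ofReal_pow_walkMax_le (b : ℕ) (r : ℝ) (x : ℕ → ℕ) :
    ENNReal.ofReal (r ^ walkMax b x) ≤ ∑' l, ENNReal.ofReal (r ^ walk b x l) := by
  by_cases hx : BddAbove (Set.range (walk b x))
  · obtain ⟨l, hl⟩ := (isGreatest_walkMax hx).1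
    refine le_trans (le_of_eq ?_) (ENNReal.le_tsum l)
    rw [hl, zpow_natCast]
  · have : walkMax b x = 0 := by
      have h0 : sSup (Set.range (walk b x)) = 0 := Int.csSup_of_not_bddAbove hx
      unfold walkMax iSup
      rw [h0]; rfl
    refine le_trans (le_of_eq ?_) (ENNReal.le_tsum 0)
    rw [this]; simp

/-- The inflow has exponential moments, by the union bound over the length of the walk. -/
lemma PoissonDominated.lintegral_inflow_le (h : PoissonDominated μ lam) (hr : 1 ≤ r)
    (hρ : driftRate b lam r < 1) {A : ℝ} (hA : 1 ≤ A) :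
    ∫⁻ x, ENNReal.ofReal (A ^ x 0 * r ^ inflow b x) ∂μ ≤
      ENNReal.ofReal (Real.exp (lam * (A - 1)) * (1 - driftRate b lam r)⁻¹) := by
  have hρ0 := driftRate_nonneg b lam (zero_le_one.trans hr)
  have hmeas : ∀ l, Measurable fun x : ℕ → ℕ =>
      ENNReal.ofReal (A ^ x 0 * r ^ walk b (fun k => x (k + 1)) l) := fun l => by
    refine ENNReal.measurable_ofReal.comp (Measurable.mul ?_ ?_)
    · exact (Measurable.of_discrete (f := fun j : ℕ => A ^ j)).comp (measurable_pi_apply 0)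
    · exact (Measurable.of_discrete (f := fun j : ℤ => r ^ j)).comp
        ((measurable_walk b l).comp measurable_shift)
  calc ∫⁻ x, ENNReal.ofReal (A ^ x 0 * r ^ inflow b x) ∂μ
      ≤ ∫⁻ x, ∑' l, ENNReal.ofReal (A ^ x 0 * r ^ walk b (fun k => x (k + 1)) l) ∂μ := by
        refine lintegral_mono fun x => ?_
        have hA0 : (0 : ℝ) ≤ A ^ x 0 := by positivity
        simp_rw [ENNReal.ofReal_mul hA0]
        rw [ENNReal.tsum_mul_left]
        exact mul_le_mul_right (ofReal_pow_walkMax_le b r _) _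
    _ = ∑' l, ∫⁻ x, ENNReal.ofReal (A ^ x 0 * r ^ walk b (fun k => x (k + 1)) l) ∂μ :=
        lintegral_tsum fun l => (hmeas l).aemeasurable
    _ ≤ ∑' l, ENNReal.ofReal (Real.exp (lam * (A - 1)) * driftRate b lam r ^ l) :=
        ENNReal.tsum_le_tsum fun l => h.lintegral_walk_le hr hA l
    _ = _ := by
        rw [← ENNReal.ofReal_tsum_of_nonneg (fun l => by positivity)
          ((summable_geometric_of_lt_one hρ0 hρ).mul_left _), tsum_mul_left,
          tsum_geometric_of_lt_one hρ0 hρ]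

/-- The event that the walk is positive at some time `l ≥ L`. -/
def lateExcursion (b L : ℕ) : Set (ℕ → ℕ) :=
  {x | ∃ l, L ≤ l ∧ 0 < walk b (fun k => x (k + 1)) l}

lemma PoissonDominated.lateExcursion_le (h : PoissonDominated μ lam) (hr : 1 ≤ r)
    (hρ : driftRate b lam r < 1) (L : ℕ) :
    μ.real (lateExcursion b L) ≤ driftRate b lam r ^ L * (1 - driftRate b lam r)⁻¹ := by
  have hρ0 := driftRate_nonneg b lam (zero_le_one.trans hr)
  have h1ρ : 0 < 1 - driftRate b lam r := by linarith
  have hone : ∀ l, μ {x | 0 < walk b (fun k => x (k + 1)) l} ≤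
      ENNReal.ofReal (driftRate b lam r ^ l) := by
    intro l
    have h1 := h.lintegral_walk_le (b := b) hr le_rfl l
    simp only [one_pow, one_mul, sub_self, mul_zero, Real.exp_zero] at h1
    refine le_trans ?_ h1
    have hset : MeasurableSet {x : ℕ → ℕ | 0 < walk b (fun k => x (k + 1)) l} :=
      ((measurable_walk b l).comp measurable_shift) measurableSet_Ioi
    rw [← lintegral_indicator_one hset]
    refine lintegral_mono fun x => ?_
    rw [Set.indicator_apply]
    split_ifs with hx
    · rw [Pi.one_apply, ENNReal.one_le_ofReal]
      exact one_le_zpow₀ hr (le_of_lt hx)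
    · exact zero_le
  have hsub : lateExcursion b L ⊆ ⋃ l : ℕ, {x | 0 < walk b (fun k => x (k + 1)) (L + l)} := by
    rintro x ⟨l, hl, hx⟩
    refine Set.mem_iUnion.mpr ⟨l - L, ?_⟩
    rw [Set.mem_ofPred_eq, Nat.add_sub_cancel' hl]
    exact hx
  have hle : μ (lateExcursion b L) ≤
      ENNReal.ofReal (driftRate b lam r ^ L * (1 - driftRate b lam r)⁻¹) := by
    refine (measure_mono hsub).trans ((measure_iUnion_le _).trans ?_)
    refine (ENNReal.tsum_le_tsum fun l => hone (L + l)).trans (le_of_eq ?_)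
    simp_rw [pow_add]
    rw [← ENNReal.ofReal_tsum_of_nonneg (fun l => by positivity)
      ((summable_geometric_of_lt_one hρ0 hρ).mul_left _), tsum_mul_left,
      tsum_geometric_of_lt_one hρ0 hρ]
  exact ENNReal.toReal_le_of_le_ofReal (by positivity) hle

/-- The inflow, computed from a walk of length less than `L`. -/
def truncInflow (b L : ℕ) (x : ℕ → ℕ) : ℕ :=
  (Finset.range L).sup fun l => (walk b (fun k => x (k + 1)) l).toNat

lemma inflow_eq_truncInflow {L : ℕ} {x : ℕ → ℕ} (hx : x ∉ lateExcursion b L) :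
    inflow b x = truncInflow b L x := by
  have hlate : ∀ l, L ≤ l → walk b (fun k => x (k + 1)) l ≤ 0 := fun l hl => by
    by_contra hlt
    exact hx ⟨l, hl, not_le.mp hlt⟩
  refine walkMax_eq_of_isGreatest ⟨?_, ?_⟩
  · rcases Nat.eq_zero_or_pos (truncInflow b L x) with h0 | hpos
    · rw [h0]; exact ⟨0, by simp⟩
    · have hne : (Finset.range L).Nonempty := by
        rw [Finset.nonempty_iff_ne_empty]
        intro he
        rw [truncInflow, he] at hpos
        exact lt_irrefl _ hpos
      obtain ⟨l, -, hl⟩ := Finset.exists_mem_eq_sup (Finset.range L) hne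
        fun l => (walk b (fun k => x (k + 1)) l).toNat
      refine ⟨l, ?_⟩
      change truncInflow b L x = _ at hl
      omega
  · rintro _ ⟨l, rfl⟩
    rcases Nat.lt_or_ge l L with hl | hl
    · have := Finset.le_sup (f := fun l => (walk b (fun k => x (k + 1)) l).toNat)
        (Finset.mem_range.mpr hl)
      change _ ≤ truncInflow b L x at this
      omega
    · have := hlate l hl
      omega

/-- Truncating the walk changes probabilities by at most the probability of a late excursion. -/
lemma abs_measureReal_sub_le [IsFiniteMeasure μ] (L c : ℕ) (B : Set (ℕ → ℕ)) :
    |μ.real ({x | inflow b x = c} ∩ B) - μ.real ({x | truncInflow b L x = c} ∩ B)| ≤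
      μ.real (lateExcursion b L) := by
  have h1 : μ.real ({x | inflow b x = c} ∩ B) ≤
      μ.real ({x | truncInflow b L x = c} ∩ B) + μ.real (lateExcursion b L) := by
    refine (measureReal_mono ?_).trans (measureReal_union_le _ _)
    rintro x ⟨hx, hxB⟩
    by_cases hl : x ∈ lateExcursion b L
    · exact Or.inr hl
    · exact Or.inl ⟨(inflow_eq_truncInflow hl).symm.trans hx, hxB⟩
  have h2 : μ.real ({x | truncInflow b L x = c} ∩ B) ≤
      μ.real ({x | inflow b x = c} ∩ B) + μ.real (lateExcursion b L) := by
    refine (measureReal_mono ?_).trans (measureReal_union_le _ _)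
    rintro x ⟨hx, hxB⟩
    by_cases hl : x ∈ lateExcursion b L
    · exact Or.inr hl
    · exact Or.inl ⟨(inflow_eq_truncInflow hl).trans hx, hxB⟩
  rw [abs_le]
  constructor <;> linarith

end dominated

/-! ### Local limits -/

section localLimit

variable {μs : ℕ → Measure (ℕ → ℕ)} [∀ k, IsProbabilityMeasure (μs k)] {μ : Measure (ℕ → ℕ)}
  [IsProbabilityMeasure μ] {b : ℕ}

/-- Convergence of the finite-dimensional probabilities. -/
def WindowConv (μs : ℕ → Measure (ℕ → ℕ)) (μ : Measure (ℕ → ℕ)) : Prop :=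
  ∀ (W : Finset ℕ) (a : ℕ → ℕ), Tendsto (fun k => (μs k).real {x | ∀ i ∈ W, x i = a i}) atTop
    (𝓝 (μ.real {x | ∀ i ∈ W, x i = a i}))

/-- An event that depends on finitely many coordinates, and bounds them, is a finite union of
elementary events. -/
lemma WindowConv.tendsto_measureReal (h : WindowConv μs μ) {E : Set (ℕ → ℕ)} (W : Finset ℕ) (N : ℕ)
    (hdep : ∀ x y : ℕ → ℕ, (∀ i ∈ W, x i = y i) → x ∈ E → y ∈ E)
    (hbd : ∀ x ∈ E, ∀ i ∈ W, x i ≤ N) :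
    Tendsto (fun k => (μs k).real E) atTop (𝓝 (μ.real E)) := by
  classical
  let ext : (W → ℕ) → ℕ → ℕ := fun a i => if hi : i ∈ W then a ⟨i, hi⟩ else 0
  let S : Finset (W → ℕ) :=
    (Fintype.piFinset fun _ : W => Finset.range (N + 1)).filter fun a => ext a ∈ E
  let C : (W → ℕ) → Set (ℕ → ℕ) := fun a => {x | ∀ i ∈ W, x i = ext a i}
  have hext : ∀ (a : W → ℕ) (i : ℕ) (hi : i ∈ W), ext a i = a ⟨i, hi⟩ := fun a i hi => dif_pos hi
  have hE : E = ⋃ a ∈ S, C a := by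
    ext x
    simp only [Set.mem_iUnion, exists_prop]
    constructor
    · intro hx
      have hxe : ∀ i ∈ W, x i = ext (fun i => x i) i := fun i hi => (hext (fun i => x i) i hi).symm
      refine ⟨fun i => x i, Finset.mem_filter.mpr ⟨?_, hdep _ _ hxe hx⟩, hxe⟩
      rw [Fintype.mem_piFinset]
      exact fun i => Finset.mem_range.mpr (Nat.lt_succ_of_le (hbd x hx i i.2))
    · rintro ⟨a, ha, hxa⟩
      exact hdep _ _ (fun i hi => (hxa i hi).symm) (Finset.mem_filter.mp ha).2
  have hC : ∀ a, MeasurableSet (C a) := fun a => by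
    have : C a = ⋂ i ∈ W, (fun x : ℕ → ℕ => x i) ⁻¹' {ext a i} := by ext x; simp [C]
    rw [this]
    exact Finset.measurableSet_biInter _ fun i _ =>
      measurable_pi_apply i (measurableSet_singleton _)
  have hdisj : Set.PairwiseDisjoint (S : Set (W → ℕ)) C := by
    intro a _ a' _ hne
    refine Set.disjoint_left.mpr fun x hx hx' => hne ?_
    funext i
    have h1 := hx i i.2
    have h2 := hx' i i.2
    rw [hext a i i.2] at h1
    rw [hext a' i i.2] at h2
    exact h1.symm.trans h2
  have hsum : ∀ (ν : Measure (ℕ → ℕ)) [IsProbabilityMeasure ν],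
      ν.real E = ∑ a ∈ S, ν.real (C a) := by
    intro ν _
    rw [hE]
    exact measureReal_biUnion_finset hdisj fun a _ => hC a
  simp_rw [fun k => hsum (μs k)]
  rw [hsum μ]
  exact tendsto_finsetSum _ fun a _ => h W (ext a)

lemma walk_congr {x y : ℕ → ℕ} {l : ℕ} (h : ∀ k < l, x k = y k) : walk b x l = walk b y l := by
  unfold walk
  exact Finset.sum_congr rfl fun k hk => by rw [h k (Finset.mem_range.mp hk)]

lemma neg_mul_le_walk (b : ℕ) (x : ℕ → ℕ) (l : ℕ) : -((b * l : ℕ) : ℤ) ≤ walk b x l := by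
  induction l with
  | zero => simp
  | succ l ih => rw [walk_succ, Nat.mul_succ]; push_cast at ih ⊢; omega

lemma truncInflow_congr {L : ℕ} {x y : ℕ → ℕ} (h : ∀ i ∈ Finset.Ico 1 L, x i = y i) :
    truncInflow b L x = truncInflow b L y := by
  unfold truncInflow
  refine Finset.sup_congr rfl fun l hl => ?_
  rw [walk_congr fun k hk => h (k + 1) ?_]
  have := Finset.mem_range.mp hl
  exact Finset.mem_Ico.mpr ⟨by omega, by omega⟩

/-- The truncated inflow bounds the counts in the window, as the walk decreases by at most `b` in
each step. -/
lemma le_of_truncInflow_eq {L c : ℕ} {x : ℕ → ℕ} (h : truncInflow b L x = c) {i : ℕ}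
    (hi : i ∈ Finset.Ico 1 L) : x i ≤ c + b * L := by
  obtain ⟨h1, h2⟩ := Finset.mem_Ico.mp hi
  obtain ⟨k, rfl⟩ : ∃ k, i = k + 1 := ⟨i - 1, by omega⟩
  have h3 := Finset.le_sup (f := fun l => (walk b (fun k => x (k + 1)) l).toNat)
    (Finset.mem_range.mpr h2)
  change _ ≤ truncInflow b L x at h3
  rw [h] at h3
  have h4 := neg_mul_le_walk b (fun k => x (k + 1)) k
  simp only [walk_succ] at h3
  have h5 : b * k + b ≤ b * L := by rw [← Nat.mul_succ]; exact Nat.mul_le_mul_left b h2.le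
  omega

lemma tendsto_of_approx {p : ℕ → ℝ} {p' : ℝ} {q : ℕ → ℕ → ℝ} {q' e : ℕ → ℝ}
    (h1 : ∀ᶠ k in atTop, ∀ L, |p k - q L k| ≤ e L) (h2 : ∀ L, |p' - q' L| ≤ e L)
    (h3 : ∀ L, Tendsto (q L) atTop (𝓝 (q' L))) (h4 : Tendsto e atTop (𝓝 0)) :
    Tendsto p atTop (𝓝 p') := by
  rw [Metric.tendsto_atTop']
  intro ε hε
  obtain ⟨L, hL⟩ := (h4.eventually (gt_mem_nhds (show (0 : ℝ) < ε / 3 by positivity))).exists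
  have h5 := (Metric.tendsto_nhds.mp (h3 L)) (ε / 3) (by positivity)
  obtain ⟨K, hK⟩ := eventually_atTop.mp (h1.and h5)
  refine ⟨K, fun k hk => ?_⟩
  obtain ⟨h6, h7⟩ := hK k hk.le
  have h8 := h6 L
  have h9 := h2 L
  rw [Real.dist_eq] at h7 ⊢
  rw [abs_lt] at h7 ⊢
  rw [abs_le] at h8 h9
  constructor <;> linarith [h7.1, h7.2, h8.1, h8.2, h9.1, h9.2]

variable {lam r : ℝ}

/-- Convergence of the joint law of the inflow and of the occupancy of the home bucket. -/
lemma tendsto_inflow_and_lt (h : WindowConv μs μ)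
    (hdom : ∀ᶠ k in atTop, PoissonDominated (μs k) lam)
    (hdom' : PoissonDominated μ lam) (hr : 1 ≤ r) (hρ : driftRate b lam r < 1) (c v : ℕ) :
    Tendsto (fun k => (μs k).real {x | inflow b x = c ∧ v < x 0}) atTop
      (𝓝 (μ.real {x | inflow b x = c ∧ v < x 0})) := by
  have hρ0 := driftRate_nonneg b lam (zero_le_one.trans hr)
  have he : Tendsto (fun L => driftRate b lam r ^ L * (1 - driftRate b lam r)⁻¹) atTop (𝓝 0) := by
    simpa using (tendsto_pow_atTop_nhds_zero_of_lt_one hρ0 hρ).mul_const (1 - driftRate b lam r)⁻¹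
  have happ : ∀ B : Set (ℕ → ℕ), (∀ L, Tendsto
      (fun k => (μs k).real ({x | truncInflow b L x = c} ∩ B)) atTop
        (𝓝 (μ.real ({x | truncInflow b L x = c} ∩ B)))) →
      Tendsto (fun k => (μs k).real ({x | inflow b x = c} ∩ B)) atTop
        (𝓝 (μ.real ({x | inflow b x = c} ∩ B))) := by
    intro B hB
    refine tendsto_of_approx ?_ (fun L => (abs_measureReal_sub_le L c B).trans
      (hdom'.lateExcursion_le hr hρ L)) hB he
    filter_upwards [hdom] with k hk L
    exact (abs_measureReal_sub_le L c B).trans (hk.lateExcursion_le hr hρ L)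
  have h1 := happ Set.univ fun L => h.tendsto_measureReal (Finset.Ico 1 L) (c + b * L)
    (fun x y hxy hx => ⟨(truncInflow_congr hxy).symm.trans hx.1, trivial⟩)
    (fun x hx i hi => le_of_truncInflow_eq hx.1 hi)
  have h2 := happ {x | x 0 ≤ v} fun L => h.tendsto_measureReal (insert 0 (Finset.Ico 1 L))
    (v + (c + b * L))
    (fun x y hxy hx => by
      rw [Finset.forall_mem_insert] at hxy
      exact ⟨(truncInflow_congr hxy.2).symm.trans hx.1, hxy.1.symm.le.trans hx.2⟩)
    (fun x hx i hi => by
      rcases Finset.mem_insert.mp hi with rfl | hi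
      · exact (show x 0 ≤ v from hx.2).trans (Nat.le_add_right _ _)
      · exact (le_of_truncInflow_eq hx.1 hi).trans (Nat.le_add_left _ _))
  -- The number of keys in the home bucket is not bounded on the event, but on its complement.
  have hsplit : ∀ (ν : Measure (ℕ → ℕ)) [IsProbabilityMeasure ν],
      ν.real {x | inflow b x = c ∧ v < x 0} =
        ν.real ({x | inflow b x = c} ∩ Set.univ) -
          ν.real ({x | inflow b x = c} ∩ {x | x 0 ≤ v}) := by
    intro ν _
    have hm : MeasurableSet {x : ℕ → ℕ | x 0 ≤ v} :=
      (measurable_pi_apply (X := fun _ : ℕ => ℕ) 0) measurableSet_Iic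
    have := measureReal_inter_add_sdiff (μ := ν) (s := {x | inflow b x = c}) hm
    rw [Set.inter_univ, ← this, add_sub_cancel_left]
    congr 1
    ext x
    simp
  simp_rw [fun k => hsplit (μs k)]
  rw [hsplit μ]
  exact h1.sub h2

lemma tendsto_lt (h : WindowConv μs μ) (v : ℕ) :
    Tendsto (fun k => (μs k).real {x | v < x 0}) atTop (𝓝 (μ.real {x | v < x 0})) := by
  have h1 := h.tendsto_measureReal (E := {x | x 0 ≤ v}) {0} v
    (fun x y hxy hx => (hxy 0 (by simp)).symm.le.trans hx)
    (fun x hx i hi => by rw [Finset.mem_singleton.mp hi]; exact hx)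
  have hsplit : ∀ (ν : Measure (ℕ → ℕ)) [IsProbabilityMeasure ν],
      ν.real {x | v < x 0} = 1 - ν.real {x | x 0 ≤ v} := by
    intro ν _
    rw [← probReal_compl_eq_one_sub]
    · congr 1
      ext x
      simp
    · exact (measurable_pi_apply (X := fun _ : ℕ => ℕ) 0) measurableSet_Iic
  simp_rw [fun k => hsplit (μs k)]
  rw [hsplit μ]
  exact tendsto_const_nhds.sub h1

end localLimit

/-! ### Sequences of independent Poisson variables -/

section poisson

open scoped NNReal

variable {lam : ℝ≥0}

/-- The law of a sequence of independent Poisson variables with mean `lam`. -/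
noncomputable def poissonSeq (lam : ℝ≥0) : Measure (ℕ → ℕ) :=
  Measure.infinitePi fun _ : ℕ => poissonMeasure lam

instance (lam : ℝ≥0) : IsProbabilityMeasure (poissonSeq lam) := by
  unfold poissonSeq; infer_instance

/-- The sequence with first term `p.1` and remaining terms `p.2`. -/
def consSeq (p : ℕ × (ℕ → ℕ)) : ℕ → ℕ
  | 0 => p.1
  | k + 1 => p.2 k

lemma measurable_consSeq : Measurable consSeq := by
  refine measurable_pi_lambda _ fun k => ?_
  cases k with
  | zero => exact measurable_fst
  | succ k => exact (measurable_pi_apply k).comp measurable_snd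

lemma poissonSeq_eq_map_consSeq (lam : ℝ≥0) :
    ((poissonMeasure lam).prod (poissonSeq lam)).map consSeq = poissonSeq lam := by
  refine Measure.eq_infinitePi _ fun s t ht => ?_
  obtain ⟨N, hN⟩ := s.exists_nat_subset_range
  -- Boxes may be taken over an initial segment of the coordinates.
  let t' : ℕ → Set ℕ := fun i => if i ∈ s then t i else Set.univ
  have hbox : Set.pi (s : Set ℕ) t = Set.pi (Finset.range (N + 1) : Finset ℕ) t' := by
    ext x
    simp only [Set.mem_pi, Finset.mem_coe, t']
    constructor
    · intro h i _
      split_ifs with hi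
      · exact h i hi
      · trivial
    · intro h i hi
      have := h i (Finset.mem_range.mpr ((Finset.mem_range.mp (hN hi)).trans (Nat.lt_succ_self N)))
      rwa [if_pos hi] at this
  have hprod : ∏ i ∈ s, poissonMeasure lam (t i) =
      ∏ i ∈ Finset.range (N + 1), poissonMeasure lam (t' i) := by
    refine Finset.prod_subset_one_on_sdiff
      (hN.trans (Finset.range_subset_range.mpr (Nat.le_succ N))) (fun i hi => ?_) fun i hi => ?_
    · simp [t', (Finset.mem_sdiff.mp hi).2]
    · simp [t', hi]
  have hpre : consSeq ⁻¹' Set.pi (Finset.range (N + 1) : Finset ℕ) t' =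
      t' 0 ×ˢ Set.pi (Finset.range N : Finset ℕ) fun i => t' (i + 1) := by
    ext ⟨a, y⟩
    simp only [Set.mem_preimage, Set.mem_pi, Finset.mem_coe, Finset.mem_range, Set.mem_prod]
    constructor
    · intro h
      exact ⟨h 0 (Nat.succ_pos N), fun i hi => h (i + 1) (Nat.succ_lt_succ hi)⟩
    · rintro ⟨h0, h⟩ i hi
      cases i with
      | zero => exact h0
      | succ i => exact h i (Nat.lt_of_succ_lt_succ hi)
  rw [hbox, hprod, Measure.map_apply measurable_consSeq
    (MeasurableSet.pi (Finset.countable_toSet _) fun i _ => MeasurableSet.of_discrete), hpre,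
    Measure.prod_prod, Finset.prod_range_succ', mul_comm, poissonSeq,
    Measure.infinitePi_pi _ fun i _ => MeasurableSet.of_discrete]

lemma lintegral_poissonSeq {F : (ℕ → ℕ) → ENNReal} (hF : Measurable F) :
    ∫⁻ x, F x ∂poissonSeq lam =
      ∫⁻ y, ∫⁻ a, F (consSeq (a, y)) ∂poissonMeasure lam ∂poissonSeq lam := by
  conv_lhs => rw [← poissonSeq_eq_map_consSeq, lintegral_map hF measurable_consSeq]
  exact lintegral_prod_symm' _ (hF.comp measurable_consSeq)

lemma hasSum_poisson_pow (lam : ℝ≥0) (w : ℝ) :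
    HasSum (fun n : ℕ => Real.exp (-lam) * lam ^ n / n.factorial * w ^ n)
      (Real.exp (lam * (w - 1))) := by
  have h := (NormedSpace.expSeries_div_hasSum_exp ((lam : ℝ) * w)).mul_left (Real.exp (-lam))
  rw [← Real.exp_eq_exp_ℝ, ← Real.exp_add] at h
  rw [show (lam : ℝ) * (w - 1) = -lam + lam * w by ring]
  refine Eq.subst (motive := fun f => HasSum f _) (funext fun n => ?_) h
  rw [mul_pow]; ring

lemma hasSum_poisson_cpow (lam : ℝ≥0) (q : ℂ) :
    HasSum (fun n : ℕ => ((Real.exp (-lam) * lam ^ n / n.factorial : ℝ) : ℂ) * q ^ n)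
      (Complex.exp (lam * (q - 1))) := by
  have h := (NormedSpace.expSeries_div_hasSum_exp ((lam : ℂ) * q)).mul_left (Complex.exp (-lam))
  rw [← Complex.exp_eq_exp_ℂ, ← Complex.exp_add] at h
  rw [show (lam : ℂ) * (q - 1) = -lam + lam * q by ring]
  refine Eq.subst (motive := fun f => HasSum f _) (funext fun n => ?_) h
  push_cast; rw [mul_pow]; ring

lemma lintegral_poisson (F : ℕ → ENNReal) :
    ∫⁻ a, F a ∂poissonMeasure lam =
      ∑' n : ℕ, F n * ENNReal.ofReal (Real.exp (-lam) * lam ^ n / n.factorial) := by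
  rw [lintegral_countable']
  simp_rw [poissonMeasure_singleton]

lemma lintegral_poisson_pow {w : ℝ} (hw : 0 ≤ w) :
    ∫⁻ a, ENNReal.ofReal (w ^ a) ∂poissonMeasure lam =
      ENNReal.ofReal (Real.exp (lam * (w - 1))) := by
  rw [lintegral_poisson, ← (hasSum_poisson_pow lam w).tsum_eq,
    ENNReal.ofReal_tsum_of_nonneg (fun n => by positivity) (hasSum_poisson_pow lam w).summable]
  congr 1
  ext n
  rw [← ENNReal.ofReal_mul (by positivity), mul_comm]

lemma integral_poisson_cpow (q : ℂ) :
    ∫ a, q ^ a ∂poissonMeasure lam = Complex.exp (lam * (q - 1)) := by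
  rw [integral_poissonMeasure, ← (hasSum_poisson_cpow lam q).tsum_eq]
  congr 1

lemma integrable_poisson_cpow (q : ℂ) : Integrable (fun a : ℕ => q ^ a) (poissonMeasure lam) := by
  rw [integrable_poissonMeasure_iff]
  simpa using (hasSum_poisson_pow lam ‖q‖).summable

/-- The size-biasing identity of the Poisson law. -/
lemma poisson_size_bias (G : ℕ → ENNReal) (hG : G 0 = 0) :
    lam * ∫⁻ a, G (a + 1) * ((a + 1 : ℕ) : ENNReal)⁻¹ ∂poissonMeasure lam =
      ∫⁻ a, G a ∂poissonMeasure lam := by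
  rw [lintegral_poisson, lintegral_poisson, tsum_eq_zero_add' (f := fun n => G n * _)
    ENNReal.summable, hG, zero_mul, zero_add, ← ENNReal.tsum_mul_left]
  congr 1
  ext n
  have h1 : ((n + 1 : ℕ) : ENNReal)⁻¹ = ENNReal.ofReal ((n + 1 : ℕ) : ℝ)⁻¹ := by
    rw [ENNReal.ofReal_inv_of_pos (by positivity), ENNReal.ofReal_natCast]
  have h2 : (lam : ENNReal) = ENNReal.ofReal lam := ENNReal.ofReal_coe_nnreal.symm
  rw [h1, h2, mul_assoc (G (n + 1)), mul_left_comm, ← ENNReal.ofReal_mul (by positivity),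
    ← ENNReal.ofReal_mul (by positivity)]
  congr 2
  rw [Nat.factorial_succ, pow_succ]
  push_cast
  field_simp

/-- Equality holds for independent Poisson variables. -/
lemma poissonDominated_poissonSeq (lam : ℝ≥0) : PoissonDominated (poissonSeq lam) lam := by
  intro L
  induction L with
  | zero => intro w _; simp
  | succ L ih =>
    intro w hw
    have hw0 : ∀ k, 0 ≤ w k := fun k => zero_le_one.trans (hw k)
    have hmeas : Measurable fun x : ℕ → ℕ =>
        ENNReal.ofReal (∏ k ∈ Finset.range (L + 1), w k ^ x k) :=
      ENNReal.measurable_ofReal.comp (Finset.measurable_prod _ fun k _ =>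
        (Measurable.of_discrete (f := fun j : ℕ => w k ^ j)).comp (measurable_pi_apply k))
    have hmeas' : Measurable fun x : ℕ → ℕ =>
        ENNReal.ofReal (∏ k ∈ Finset.range L, w (k + 1) ^ x k) :=
      ENNReal.measurable_ofReal.comp (Finset.measurable_prod _ fun k _ =>
        (Measurable.of_discrete (f := fun j : ℕ => w (k + 1) ^ j)).comp (measurable_pi_apply k))
    have hstep : ∀ y : ℕ → ℕ, ∫⁻ a, ENNReal.ofReal
        (∏ k ∈ Finset.range (L + 1), w k ^ consSeq (a, y) k) ∂poissonMeasure lam =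
        ENNReal.ofReal (∏ k ∈ Finset.range L, w (k + 1) ^ y k) *
          ENNReal.ofReal (Real.exp (lam * (w 0 - 1))) := by
      intro y
      have hp : 0 ≤ ∏ k ∈ Finset.range L, w (k + 1) ^ y k :=
        Finset.prod_nonneg fun k _ => pow_nonneg (hw0 _) _
      simp_rw [Finset.prod_range_succ', consSeq, ENNReal.ofReal_mul hp]
      rw [lintegral_const_mul _ Measurable.of_discrete, lintegral_poisson_pow (hw0 0)]
    rw [lintegral_poissonSeq hmeas]
    simp_rw [hstep]
    rw [lintegral_mul_const _ hmeas']
    refine (mul_le_mul_left (ih (fun k => w (k + 1)) fun k => hw (k + 1)) _).trans (le_of_eq ?_)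
    rw [← ENNReal.ofReal_mul (Real.exp_nonneg _), ← Real.exp_add, Finset.sum_range_succ']
    congr 2
    ring

lemma poissonSeq_window (W : Finset ℕ) (a : ℕ → ℕ) :
    (poissonSeq lam).real {x | ∀ i ∈ W, x i = a i} =
      ∏ i ∈ W, (Real.exp (-lam) * lam ^ a i / (a i).factorial) := by
  have h : {x : ℕ → ℕ | ∀ i ∈ W, x i = a i} = Set.pi (W : Set ℕ) fun i => {a i} := by
    ext x; simp
  rw [h, measureReal_def, poissonSeq, Measure.infinitePi_pi _ fun i _ => MeasurableSet.of_discrete,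
    ENNReal.toReal_prod]
  simp_rw [← measureReal_def, poissonMeasure_real_singleton]

lemma windowConv_countsLaw {m n : ℕ → ℕ} [∀ k, NeZero (m k)]
    (hm : Tendsto m atTop atTop) (hn : Tendsto n atTop atTop)
    (hmn : Tendsto (fun k => (n k : ℝ) / m k) atTop (𝓝 lam)) :
    WindowConv (fun k => countsLaw (m k) (n k)) (poissonSeq lam) := by
  intro W a
  rw [poissonSeq_window]
  exact tendsto_countsLaw_window hm hn hmn W a

/-! ### The infinite Poisson model -/

lemma map_tableLaw (b : ℕ) (α : ℝ) :
    (tableLaw b α).map (fun X (k : ℕ) => X (-(k : ℤ))) = poissonSeq (b * α).toNNReal := by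
  unfold tableLaw poissonSeq
  exact Measure.map_infinitePi_infinitePi_of_inj (f := fun k : ℕ => -(k : ℤ))
    (fun i j h => by simpa using h)

/-- The average over the uniform distribution on `{0, …, X 0}`. -/
lemma lintegral_tieKernel (X : ℤ → ℕ) (g : ℕ → ENNReal) :
    ∫⁻ v, g v ∂tieKernel X =
      (∑ v ∈ Finset.range (X 0 + 1), g v) * ((X 0 + 1 : ℕ) : ENNReal)⁻¹ := by
  have hk : tieKernel X = (PMF.uniformOfFinset (Finset.range (X 0 + 1))
    Finset.nonempty_range_add_one).toMeasure := rfl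
  rw [hk, lintegral_countable']
  simp_rw [PMF.toMeasure_apply_singleton _ _ (measurableSet_singleton _),
    PMF.uniformOfFinset_apply, Finset.card_range]
  rw [tsum_eq_sum (s := Finset.range (X 0 + 1)) fun v hv => by rw [if_neg hv, mul_zero],
    Finset.sum_mul]
  exact Finset.sum_congr rfl fun v hv => by rw [if_pos hv]

lemma Qinf_eq_inflow (b : ℕ) (ω : (ℤ → ℕ) × ℕ) :
    Qinf b ω = inflow b fun k => ω.1 (-(k : ℤ)) := by
  unfold Qinf inflow
  rw [overflow_eq_walkMax]
  congr 1
  ext k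
  push_cast
  ring_nf

lemma measurable_env : Measurable fun (X : ℤ → ℕ) (k : ℕ) => X (-(k : ℤ)) :=
  measurable_pi_lambda _ fun _ => measurable_pi_apply _

lemma measurable_Qinf (b : ℕ) : Measurable (Qinf b) := by
  have : Qinf b = fun ω => inflow b fun k => ω.1 (-(k : ℤ)) := funext (Qinf_eq_inflow b)
  rw [this]
  exact (measurable_inflow b).comp (measurable_env.comp measurable_fst)

lemma measurable_Vinf : Measurable Vinf := measurable_snd

lemma measurable_Cinf (b : ℕ) : Measurable (Cinf b) := (measurable_Qinf b).add measurable_Vinf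

lemma inflow_consSeq (b a : ℕ) (y : ℕ → ℕ) : inflow b (consSeq (a, y)) = walkMax b y := rfl

/-- As in the exact model, the law of `(Q, V)` is a size-biased average over the keys of the home
bucket. -/
lemma lintegral_poissonModel {b : ℕ} {α : ℝ} (f : ℕ → ℕ → ENNReal) :
    ((b * α).toNNReal : ENNReal) * ∫⁻ ω, f (Qinf b ω) (Vinf ω) ∂poissonModel b α =
      ∫⁻ x, ∑ v ∈ Finset.range (x 0), f (inflow b x) v ∂poissonSeq (b * α).toNNReal := by
  have hf : Measurable fun p : ℕ × ℕ => f p.1 p.2 := Measurable.of_discrete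
  have hmeas : Measurable fun ω : (ℤ → ℕ) × ℕ => f (Qinf b ω) (Vinf ω) :=
    hf.comp ((measurable_Qinf b).prodMk measurable_Vinf)
  have hF : Measurable fun x : ℕ → ℕ =>
      (∑ v ∈ Finset.range (x 0 + 1), f (inflow b x) v) * ((x 0 + 1 : ℕ) : ENNReal)⁻¹ :=
    (Measurable.of_discrete (f := fun p : ℕ × ℕ => (∑ v ∈ Finset.range (p.1 + 1), f p.2 v) *
      ((p.1 + 1 : ℕ) : ENNReal)⁻¹)).comp ((measurable_pi_apply 0).prodMk (measurable_inflow b))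
  have hF' : Measurable fun x : ℕ → ℕ => ∑ v ∈ Finset.range (x 0), f (inflow b x) v :=
    (Measurable.of_discrete (f := fun p : ℕ × ℕ => ∑ v ∈ Finset.range p.1, f p.2 v)).comp
      ((measurable_pi_apply 0).prodMk (measurable_inflow b))
  have h1 : ∫⁻ ω, f (Qinf b ω) (Vinf ω) ∂poissonModel b α =
      ∫⁻ x, (∑ v ∈ Finset.range (x 0 + 1), f (inflow b x) v) * ((x 0 + 1 : ℕ) : ENNReal)⁻¹
        ∂poissonSeq (b * α).toNNReal := by
    rw [poissonModel, Measure.lintegral_compProd hmeas, ← map_tableLaw,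
      lintegral_map hF measurable_env]
    refine lintegral_congr fun X => ?_
    simp_rw [Qinf_eq_inflow, Vinf]
    exact lintegral_tieKernel X _
  rw [h1, lintegral_poissonSeq hF, lintegral_poissonSeq hF', ← lintegral_const_mul' _ _
    ENNReal.coe_ne_top]
  refine lintegral_congr fun y => ?_
  simp_rw [inflow_consSeq]
  exact poisson_size_bias (fun a => ∑ v ∈ Finset.range a, f (walkMax b y) v) (by simp)

end poisson

/-! ### Size-biased averages over the home bucket -/

section sizeBias

variable {Ω : Type*} [MeasurableSpace Ω]

/-- The joint law of `Q` and `V` is that of the inflow and of the rank of a key, averaged over the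
keys of the home bucket; `lam` is the mean number of keys in a bucket.  This is the common form of
the exact and of the Poisson model. -/
def SizeBiased (b : ℕ) (P : Measure Ω) (Q V : Ω → ℕ) (μ : Measure (ℕ → ℕ)) (lam : ℝ) : Prop :=
  ∀ g : ℕ → ℕ → ℝ, (∀ i j, 0 ≤ g i j) →
    ENNReal.ofReal lam * ∫⁻ ω, ENNReal.ofReal (g (Q ω) (V ω)) ∂P =
      ∫⁻ x, ∑ v ∈ Finset.range (x 0), ENNReal.ofReal (g (inflow b x) v) ∂μ

lemma sizeBiased_poissonModel {b : ℕ} {α : ℝ} :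
    SizeBiased b (poissonModel b α) (Qinf b) Vinf (poissonSeq (b * α).toNNReal) (b * α) :=
  fun g _ => lintegral_poissonModel fun i j => ENNReal.ofReal (g i j)

lemma sizeBiased_exactModel {m n b : ℕ} [NeZero m] [NeZero n] (σ : Equiv.Perm (Fin n))
    (hn : n < b * m) :
    SizeBiased b (exactModel m n)
      (fun ω => overflowAt ω.1 (exactTable b σ ω.1) (ω.1 ω.2 - 1)) Vex (countsLaw m n)
      (n / m : ℝ) := by
  intro g hg
  have hm0 : (m : ℝ) ≠ 0 := by exact_mod_cast NeZero.ne m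
  have hn0 : (n : ℝ) ≠ 0 := by exact_mod_cast NeZero.ne n
  have hF : Measurable fun x : ℕ → ℕ => ∑ v ∈ Finset.range (x 0), g (inflow b x) v :=
    (Measurable.of_discrete (f := fun p : ℕ × ℕ => ∑ v ∈ Finset.range p.1, g p.2 v)).comp
      ((measurable_pi_apply 0).prodMk (measurable_inflow b))
  have hint : Integrable (fun x : ℕ → ℕ => ∑ v ∈ Finset.range (x 0), g (inflow b x) v)
      (countsLaw m n) :=
    (integrable_map_measure hF.aestronglyMeasurable (Measurable.of_discrete).aemeasurable).mpr
      Integrable.of_finite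
  have h := integral_exactModel σ hn g
  rw [← ofReal_integral_eq_lintegral_ofReal Integrable.of_finite (ae_of_all _ fun ω => hg _ _),
    ← ENNReal.ofReal_mul (by positivity), h, ← mul_assoc, div_mul_div_comm, mul_comm (n : ℝ),
    div_self (mul_ne_zero hm0 hn0), one_mul, ofReal_integral_eq_lintegral_ofReal hint
      (ae_of_all _ fun x => Finset.sum_nonneg fun v _ => hg _ _)]
  refine lintegral_congr fun x => ?_
  exact ENNReal.ofReal_sum_of_nonneg fun v _ => hg _ _

variable {b : ℕ} {P : Measure Ω} {Q V : Ω → ℕ} {μ : Measure (ℕ → ℕ)} {lam : ℝ}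

lemma measurableSet_inflow_and_lt (b c v : ℕ) :
    MeasurableSet {x : ℕ → ℕ | inflow b x = c ∧ v < x 0} :=
  ((measurable_inflow b) (measurableSet_singleton c)).inter
    ((measurable_pi_apply (X := fun _ : ℕ => ℕ) 0) measurableSet_Ioi)

/-- For each `c`, only finitely many values of the rank contribute. -/
lemma SizeBiased.measureReal_add [IsFiniteMeasure μ] (h : SizeBiased b P Q V μ lam) (hlam : 0 < lam)
    (hQ : Measurable Q) (hV : Measurable V) (c : ℕ) :
    P.real ((fun ω => Q ω + V ω) ⁻¹' {c}) =
      lam⁻¹ * ∑ v ∈ Finset.range (c + 1), μ.real {x | inflow b x = c - v ∧ v < x 0} := by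
  classical
  have h1 := h (fun i j => if i + j = c then 1 else 0) (fun i j => by split_ifs <;> simp)
  have hl : ∫⁻ ω, ENNReal.ofReal (if Q ω + V ω = c then 1 else 0) ∂P =
      P ((fun ω => Q ω + V ω) ⁻¹' {c}) := by
    have hQV : Measurable fun ω => Q ω + V ω := hQ.add hV
    rw [← lintegral_indicator_one (hQV (measurableSet_singleton c))]
    refine lintegral_congr fun ω => ?_
    rw [Set.indicator_apply]
    by_cases hc : Q ω + V ω = c <;> simp [hc]
  have hr : ∀ x : ℕ → ℕ, ∑ v ∈ Finset.range (x 0),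
      ENNReal.ofReal (if inflow b x + v = c then 1 else 0) = ∑ v ∈ Finset.range (c + 1),
        {x : ℕ → ℕ | inflow b x = c - v ∧ v < x 0}.indicator 1 x := by
    intro x
    have e1 : ∀ v, ENNReal.ofReal (if inflow b x + v = c then 1 else 0) =
        if inflow b x + v = c then 1 else 0 := fun v => by split_ifs <;> simp
    simp_rw [e1, Set.indicator_apply, Pi.one_apply, Set.mem_ofPred_eq, Finset.sum_boole]
    congr 2
    ext v
    simp only [Finset.mem_filter, Finset.mem_range]
    omega
  simp_rw [hr] at h1
  rw [hl, lintegral_finsetSum _ fun v _ =>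
    measurable_one.indicator (measurableSet_inflow_and_lt b (c - v) v)] at h1
  simp_rw [lintegral_indicator_one (measurableSet_inflow_and_lt b _ _)] at h1
  have h2 := congrArg ENNReal.toReal h1
  rw [ENNReal.toReal_mul, ENNReal.toReal_ofReal hlam.le,
    ENNReal.toReal_sum fun v _ => measure_ne_top _ _] at h2
  exact (inv_mul_eq_iff_eq_mul₀ hlam.ne').mpr h2.symm |>.symm

lemma SizeBiased.measureReal_tie (h : SizeBiased b P Q V μ lam) (hlam : 0 < lam)
    (hV : Measurable V) (c : ℕ) :
    P.real (V ⁻¹' {c}) = lam⁻¹ * μ.real {x | c < x 0} := by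
  classical
  have h1 := h (fun _ j => if j = c then 1 else 0) (fun i j => by split_ifs <;> simp)
  have hset : MeasurableSet {x : ℕ → ℕ | c < x 0} :=
    (measurable_pi_apply (X := fun _ : ℕ => ℕ) 0) measurableSet_Ioi
  have hl : ∫⁻ ω, ENNReal.ofReal (if V ω = c then 1 else 0) ∂P = P (V ⁻¹' {c}) := by
    rw [← lintegral_indicator_one (hV (measurableSet_singleton c))]
    refine lintegral_congr fun ω => ?_
    rw [Set.indicator_apply]
    by_cases hc : V ω = c <;> simp [hc]
  have hr : ∀ x : ℕ → ℕ, ∑ v ∈ Finset.range (x 0), ENNReal.ofReal (if v = c then 1 else 0) =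
      {x : ℕ → ℕ | c < x 0}.indicator 1 x := by
    intro x
    have e1 : ∀ v, ENNReal.ofReal (if v = c then 1 else 0) = if v = c then 1 else 0 :=
      fun v => by split_ifs <;> simp
    simp_rw [e1, Finset.sum_ite_eq', Finset.mem_range, Set.indicator_apply]
    rfl
  simp_rw [hr] at h1
  rw [hl, lintegral_indicator_one hset] at h1
  have h2 := congrArg ENNReal.toReal h1
  rw [ENNReal.toReal_mul, ENNReal.toReal_ofReal hlam.le] at h2
  exact (inv_mul_eq_iff_eq_mul₀ hlam.ne').mpr h2.symm |>.symm

lemma sum_range_pow_le {s : ℝ} (hs : 1 ≤ s) (x c : ℕ) :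
    ∑ v ∈ Finset.range x, s ^ (c + v) ≤ (2 * s) ^ x * s ^ c := by
  calc ∑ v ∈ Finset.range x, s ^ (c + v) ≤ ∑ _v ∈ Finset.range x, s ^ (c + x) :=
        Finset.sum_le_sum fun v hv => pow_le_pow_right₀ hs
          (Nat.add_le_add_left (Finset.mem_range.mp hv).le c)
    _ = x * s ^ (c + x) := by simp
    _ ≤ 2 ^ x * s ^ (c + x) := by
        gcongr
        exact_mod_cast Nat.lt_two_pow_self.le
    _ = _ := by rw [pow_add, mul_pow]; ring

/-- The sum over the keys of the home bucket costs a factor `2` in the weight of that bucket. -/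
lemma SizeBiased.lintegral_pow_le (h : SizeBiased b P Q V μ lam) (hlam : 0 < lam) {lam' s : ℝ}
    (hdom : PoissonDominated μ lam') (hs : 1 ≤ s) (hρ : driftRate b lam' s < 1) :
    ∫⁻ ω, ENNReal.ofReal (s ^ (Q ω + V ω)) ∂P ≤ ENNReal.ofReal
      (lam⁻¹ * (Real.exp (lam' * (2 * s - 1)) * (1 - driftRate b lam' s)⁻¹)) := by
  have h1 := h (fun i j => s ^ (i + j)) (fun i j => by positivity)
  have h2 := hdom.lintegral_inflow_le (b := b) hs hρ (A := 2 * s) (by linarith)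
  have h3 : ∫⁻ x, ∑ v ∈ Finset.range (x 0), ENNReal.ofReal (s ^ (inflow b x + v)) ∂μ ≤
      ∫⁻ x, ENNReal.ofReal ((2 * s) ^ x 0 * s ^ inflow b x) ∂μ := by
    refine lintegral_mono fun x => ?_
    rw [← ENNReal.ofReal_sum_of_nonneg fun v _ => by positivity]
    exact ENNReal.ofReal_le_ofReal (sum_range_pow_le hs _ _)
  have h4 := (h1.le.trans h3).trans h2
  have h5 : ENNReal.ofReal lam ≠ 0 := by simpa using hlam
  rw [ENNReal.ofReal_mul (inv_nonneg.mpr hlam.le), ENNReal.ofReal_inv_of_pos hlam]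
  rw [mul_comm] at h4
  rw [mul_comm (ENNReal.ofReal lam)⁻¹, ← div_eq_mul_inv]
  exact (ENNReal.le_div_iff_mul_le (Or.inl h5) (Or.inl ENNReal.ofReal_ne_top)).mpr h4

end sizeBias

/-! ### Independence of the inflow and of the ties in the Poisson model -/

section poissonIndep

open scoped NNReal

variable {b : ℕ} {α : ℝ}

lemma toNNReal_mul_ne_zero (hb : 1 ≤ b) (hα0 : 0 < α) : (b * α).toNNReal ≠ 0 := by
  have hb' : (0 : ℝ) < b := by exact_mod_cast hb
  exact (Real.toNNReal_pos.mpr (mul_pos hb' hα0)).ne'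

/-- The joint law of `Q` and `V` has product form because the inflow does not depend on the home
bucket, over which the size-biasing takes place. -/
lemma poissonModel_inter (A B : Set ℕ) :
    ((b * α).toNNReal : ENNReal) * poissonModel b α (Qinf b ⁻¹' A ∩ Vinf ⁻¹' B) =
      poissonSeq (b * α).toNNReal (walkMax b ⁻¹' A) *
        ∫⁻ a, ∑ v ∈ Finset.range a, B.indicator 1 v ∂poissonMeasure (b * α).toNNReal := by
  have hA : MeasurableSet (Qinf b ⁻¹' A) := measurable_Qinf b MeasurableSet.of_discrete
  have hB : MeasurableSet (Vinf ⁻¹' B) := measurable_Vinf MeasurableSet.of_discrete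
  have hW : MeasurableSet (walkMax b ⁻¹' A) := measurable_walkMax b MeasurableSet.of_discrete
  have h := lintegral_poissonModel (b := b) (α := α)
    fun i j => A.indicator 1 i * B.indicator 1 j
  have hmeas : Measurable fun x : ℕ → ℕ => ∑ v ∈ Finset.range (x 0),
      (A.indicator 1 (inflow b x) * B.indicator 1 v : ENNReal) :=
    (Measurable.of_discrete (f := fun p : ℕ × ℕ => ∑ v ∈ Finset.range p.1,
      (A.indicator 1 p.2 * B.indicator 1 v : ENNReal))).comp
      ((measurable_pi_apply 0).prodMk (measurable_inflow b))
  rw [lintegral_poissonSeq hmeas] at h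
  rw [← lintegral_indicator_one (hA.inter hB), ← lintegral_indicator_one hW,
    ← lintegral_mul_const _ (measurable_one.indicator hW)]
  refine Eq.trans ?_ (h.trans ?_)
  · congr 1
    refine lintegral_congr fun ω => ?_
    change (Qinf b ⁻¹' A ∩ Vinf ⁻¹' B).indicator 1 ω =
      ((Qinf b ⁻¹' A).indicator 1 ω : ENNReal) * (Vinf ⁻¹' B).indicator 1 ω
    rw [Set.inter_indicator_one, Pi.mul_apply]
  · refine lintegral_congr fun y => ?_
    have hy : ∀ a : ℕ, ∑ v ∈ Finset.range a, (A.indicator 1 (walkMax b y) * B.indicator 1 v) =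
        (A.indicator 1 (walkMax b y) : ENNReal) * ∑ v ∈ Finset.range a, B.indicator 1 v :=
      fun a => (Finset.mul_sum _ _ _).symm
    refine (lintegral_congr hy).trans ?_
    rw [lintegral_const_mul _ Measurable.of_discrete]
    rfl

lemma lintegral_poisson_card :
    ∫⁻ a, ∑ v ∈ Finset.range a, (Set.univ : Set ℕ).indicator 1 v
      ∂poissonMeasure (b * α).toNNReal = ((b * α).toNNReal : ENNReal) := by
  have h := poissonModel_inter (b := b) (α := α) Set.univ Set.univ
  simpa using h.symm

lemma poissonModel_Qinf (hb : 1 ≤ b) (hα0 : 0 < α) (A : Set ℕ) :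
    poissonModel b α (Qinf b ⁻¹' A) = poissonSeq (b * α).toNNReal (walkMax b ⁻¹' A) := by
  have h0 : ((b * α).toNNReal : ENNReal) ≠ 0 := by
    exact_mod_cast toNNReal_mul_ne_zero hb hα0
  have h := poissonModel_inter (b := b) (α := α) A Set.univ
  rw [lintegral_poisson_card, Set.preimage_univ, Set.inter_univ, mul_comm] at h
  exact (ENNReal.mul_left_inj h0 ENNReal.coe_ne_top).mp h

lemma map_Qinf (hb : 1 ≤ b) (hα0 : 0 < α) :
    (poissonModel b α).map (Qinf b) = (poissonSeq (b * α).toNNReal).map (walkMax b) := by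
  ext A hA
  rw [Measure.map_apply (measurable_Qinf b) hA, Measure.map_apply (measurable_walkMax b) hA]
  exact poissonModel_Qinf hb hα0 A

lemma indepFun_Qinf_Vinf (hb : 1 ≤ b) (hα0 : 0 < α) :
    IndepFun (Qinf b) Vinf (poissonModel b α) := by
  have h0 : ((b * α).toNNReal : ENNReal) ≠ 0 := by
    exact_mod_cast toNNReal_mul_ne_zero hb hα0
  rw [indepFun_iff_measure_inter_preimage_eq_mul]
  intro A B _ _
  have h1 := poissonModel_inter (b := b) (α := α) A B
  have h2 := poissonModel_inter (b := b) (α := α) Set.univ B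
  rw [Set.preimage_univ, Set.preimage_univ, measure_univ, one_mul, Set.univ_inter] at h2
  rw [← h2, mul_left_comm] at h1
  rw [poissonModel_Qinf hb hα0]
  exact (ENNReal.mul_right_inj h0 ENNReal.coe_ne_top).mp h1

end poissonIndep

/-! ### The functional equation for the overflow -/

section functionalEquation

open scoped NNReal

variable {b : ℕ} {lam : ℝ≥0}

lemma map_shift_poissonSeq (lam : ℝ≥0) :
    (poissonSeq lam).map (fun (x : ℕ → ℕ) k => x (k + 1)) = poissonSeq lam := by
  conv_lhs => rw [← poissonSeq_eq_map_consSeq, Measure.map_map measurable_shift measurable_consSeq]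
  have h : (fun (x : ℕ → ℕ) k => x (k + 1)) ∘ consSeq = Prod.snd := rfl
  rw [h, Measure.map_snd_prod, measure_univ, one_smul]

lemma bddAbove_walk_of_notMem_lateExcursion {L : ℕ} {x : ℕ → ℕ} (hx : x ∉ lateExcursion b L) :
    BddAbove (Set.range (walk b fun k => x (k + 1))) := by
  refine BddAbove.mono ?_ (((Set.finite_Iio L).image (walk b fun k => x (k + 1))).bddAbove.union
    (bddAbove_Iic (a := (0 : ℤ))))
  rintro _ ⟨l, rfl⟩
  by_cases hl : l < L
  · exact Or.inl ⟨l, hl, rfl⟩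
  · refine Or.inr (not_lt.mp fun h0 => hx ⟨l, not_lt.mp hl, h0⟩)

/-- The walk has almost surely no late excursions, so that the infinite sup is a maximum. -/
lemma ae_bddAbove_walk {r : ℝ} (hr : 1 ≤ r) (hρ : driftRate b lam r < 1) :
    ∀ᵐ x ∂poissonSeq lam, BddAbove (Set.range (walk b x)) := by
  have hρ0 := driftRate_nonneg b lam (zero_le_one.trans hr)
  have hm : MeasurableSet {x : ℕ → ℕ | BddAbove (Set.range (walk b x))} :=
    measurableSet_bddAbove_range fun l => measurable_walk b l
  rw [← map_shift_poissonSeq, ae_map_iff measurable_shift.aemeasurable hm, ae_iff]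
  have hle : ∀ L, (poissonSeq lam).real
      {x | ¬BddAbove (Set.range (walk b fun k => x (k + 1)))} ≤
        driftRate b lam r ^ L * (1 - driftRate b lam r)⁻¹ := fun L =>
    (measureReal_mono fun x hx => by
      by_contra h
      exact hx (bddAbove_walk_of_notMem_lateExcursion h)).trans
      ((poissonDominated_poissonSeq lam).lateExcursion_le hr hρ L)
  have he : Tendsto (fun L => driftRate b lam r ^ L * (1 - driftRate b lam r)⁻¹) atTop (𝓝 0) := by
    simpa using (tendsto_pow_atTop_nhds_zero_of_lt_one hρ0 hρ).mul_const (1 - driftRate b lam r)⁻¹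
  have h0 := le_antisymm (ge_of_tendsto' he hle) measureReal_nonneg
  exact (measureReal_eq_zero_iff).mp h0

/-- The recursion `Q_i = (Q_{i-1} + X_i - b)_+`. -/
lemma walkMax_consSeq {y : ℕ → ℕ} (hy : BddAbove (Set.range (walk b y))) (a : ℕ) :
    walkMax b (consSeq (a, y)) = walkMax b y + a - b := by
  obtain ⟨⟨l, hl⟩, hmax⟩ := isGreatest_walkMax hy
  have hs : ∀ l, walk b (consSeq (a, y)) (l + 1) = walk b y l + (a - b) := fun l =>
    walk_succ' b _ l
  refine walkMax_eq_of_isGreatest ⟨?_, ?_⟩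
  · by_cases h : b ≤ walkMax b y + a
    · refine ⟨l + 1, ?_⟩
      rw [hs, hl]
      omega
    · refine ⟨0, ?_⟩
      rw [walk_zero]
      omega
  · rintro _ ⟨k, rfl⟩
    cases k with
    | zero => rw [walk_zero]; omega
    | succ k =>
      rw [hs]
      have := hmax ⟨k, rfl⟩
      omega

/-- The polynomial `∑_{j < b} P(H = j) (q ^ b - q ^ j)`, where `H` is the number of keys that try a
given bucket.  It is the correction caused by the truncation at `0` in the recursion for the
overflow. -/
noncomputable def deficitPoly (b : ℕ) (lam : ℝ≥0) : Polynomial ℂ :=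
  ∑ j ∈ Finset.range b, Polynomial.C
    ((((poissonMeasure lam).prod (poissonSeq lam)).real {p | walkMax b p.2 + p.1 = j} : ℝ) : ℂ) *
      (Polynomial.X ^ b - Polynomial.X ^ j)

lemma natDegree_deficitPoly_le (b : ℕ) (lam : ℝ≥0) : (deficitPoly b lam).natDegree ≤ b := by
  refine Polynomial.natDegree_sum_le_of_forall_le _ _ fun j hj => ?_
  refine (Polynomial.natDegree_C_mul_le _ _).trans ?_
  refine (Polynomial.natDegree_sub_le _ _).trans (max_le (by simp) ?_)
  simpa using (Finset.mem_range.mp hj).le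

/-- The natural subtraction `n - b` is the truncated one. -/
lemma pow_mul_pow_sub (q : ℂ) (b n : ℕ) :
    q ^ b * q ^ (n - b) =
      q ^ n + ∑ j ∈ Finset.range b, if n = j then q ^ b - q ^ j else 0 := by
  rw [Finset.sum_ite_eq]
  by_cases h : n < b
  · rw [if_pos (Finset.mem_range.mpr h), Nat.sub_eq_zero_of_le h.le]
    ring
  · rw [if_neg (by simpa using h), add_zero, ← pow_add, Nat.add_sub_cancel' (not_lt.mp h)]

/-- The functional equation for the generating function of the overflow: the recursion
`Q' = (Q + X - b)_+` preserves the law of the overflow, and only the event `Q + X < b` is affected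
by the truncation. -/
lemma integral_pow_walkMax {r : ℝ} (hr : 1 ≤ r) (hρ : driftRate b lam r < 1) {q : ℂ}
    (hq : Integrable (fun x => q ^ walkMax b x) (poissonSeq lam)) :
    (q ^ b - Complex.exp (lam * (q - 1))) * ∫ x, q ^ walkMax b x ∂poissonSeq lam =
      (deficitPoly b lam).eval q := by
  set ν := (poissonMeasure lam).prod (poissonSeq lam) with hν
  have hN : Measurable fun p : ℕ × (ℕ → ℕ) => walkMax b p.2 + p.1 :=
    ((measurable_walkMax b).comp measurable_snd).add measurable_fst
  have hprod : ∀ p : ℕ × (ℕ → ℕ), q ^ (walkMax b p.2 + p.1) = q ^ p.1 * q ^ walkMax b p.2 :=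
    fun p => by rw [pow_add, mul_comm]
  have hint : Integrable (fun p : ℕ × (ℕ → ℕ) => q ^ (walkMax b p.2 + p.1)) ν := by
    simp_rw [hprod]
    exact (integrable_poisson_cpow q).mul_prod hq
  have hval : ∫ p, q ^ (walkMax b p.2 + p.1) ∂ν =
      Complex.exp (lam * (q - 1)) * ∫ x, q ^ walkMax b x ∂poissonSeq lam := by
    simp_rw [hprod]
    rw [hν, integral_prod_mul (fun a : ℕ => q ^ a) fun x => q ^ walkMax b x,
      integral_poisson_cpow]
  have hset : ∀ j, MeasurableSet {p : ℕ × (ℕ → ℕ) | walkMax b p.2 + p.1 = j} :=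
    fun j => hN (measurableSet_singleton j)
  have hind : ∀ j (c : ℂ), (fun p : ℕ × (ℕ → ℕ) => if walkMax b p.2 + p.1 = j then c else 0) =
      {p : ℕ × (ℕ → ℕ) | walkMax b p.2 + p.1 = j}.indicator fun _ => c := fun j c => by
    ext p
    rw [Set.indicator_apply]
    rfl
  have hI : ∀ j (c : ℂ), Integrable
      (fun p : ℕ × (ℕ → ℕ) => if walkMax b p.2 + p.1 = j then c else 0) ν := fun j c => by
    rw [hind]
    exact (integrable_const c).indicator (hset j)
  have hstep : q ^ b * ∫ x, q ^ walkMax b x ∂poissonSeq lam =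
      ∫ p, (q ^ (walkMax b p.2 + p.1) + ∑ j ∈ Finset.range b,
        if walkMax b p.2 + p.1 = j then q ^ b - q ^ j else 0) ∂ν := by
    have hsm : StronglyMeasurable fun x => q ^ walkMax b x :=
      (StronglyMeasurable.of_discrete (f := fun c : ℕ => q ^ c)).comp_measurable
        (measurable_walkMax b)
    conv_lhs => rw [← poissonSeq_eq_map_consSeq]
    rw [integral_map measurable_consSeq.aemeasurable hsm.aestronglyMeasurable,
      ← integral_const_mul]
    refine integral_congr_ae ?_
    have hae : ∀ᵐ p ∂ν, BddAbove (Set.range (walk b p.2)) :=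
      Measure.quasiMeasurePreserving_snd.ae (ae_bddAbove_walk hr hρ)
    filter_upwards [hae] with p hp
    rw [← pow_mul_pow_sub, ← walkMax_consSeq hp]
  rw [sub_mul, hstep, integral_add hint (integrable_finsetSum _ fun j _ => hI j _), hval,
    add_sub_cancel_left, integral_finsetSum _ fun j _ => hI j _, deficitPoly,
    Polynomial.eval_finsetSum]
  refine Finset.sum_congr rfl fun j _ => ?_
  rw [hind, integral_indicator_const _ (hset j)]
  simp [hν]

lemma integrable_pow_of_norm_le_one {Ω : Type*} [MeasurableSpace Ω] {P : Measure Ω}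
    [IsFiniteMeasure P] {Y : Ω → ℕ} (hY : Measurable Y) {q : ℂ} (hq : ‖q‖ ≤ 1) :
    Integrable (fun ω => q ^ Y ω) P := by
  refine (integrable_const (1 : ℝ)).mono' ?_ (ae_of_all _ fun ω => ?_)
  · exact ((StronglyMeasurable.of_discrete (f := fun c : ℕ => q ^ c)).comp_measurable
      hY).aestronglyMeasurable
  · rw [norm_pow]
    exact pow_le_one₀ (norm_nonneg q) hq

/-- A generating function is left continuous at `1`. -/
lemma tendsto_integral_pow_one {Ω : Type*} [MeasurableSpace Ω] {P : Measure Ω}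
    [IsProbabilityMeasure P] {Y : Ω → ℕ} (hY : Measurable Y) :
    Tendsto (fun x : ℝ => ∫ ω, (x : ℂ) ^ Y ω ∂P) (𝓝[<] 1) (𝓝 1) := by
  have h1 : ∫ _ω, (1 : ℂ) ∂P = 1 := by simp
  rw [← h1]
  refine tendsto_integral_filter_of_dominated_convergence (fun _ => 1) ?_ ?_
    (integrable_const _) (ae_of_all _ fun ω => ?_)
  · exact Eventually.of_forall fun x =>
      ((StronglyMeasurable.of_discrete (f := fun c : ℕ => (x : ℂ) ^ c)).comp_measurable
        hY).aestronglyMeasurable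
  · filter_upwards [Ioo_mem_nhdsLT (show (0 : ℝ) < 1 by norm_num)] with x hx
    refine ae_of_all _ fun ω => ?_
    rw [norm_pow, Complex.norm_real, Real.norm_of_nonneg hx.1.le]
    exact pow_le_one₀ hx.1.le hx.2.le
  · have hc : Continuous fun x : ℝ => (x : ℂ) ^ Y ω := by fun_prop
    have := hc.tendsto 1
    simp only [Complex.ofReal_one, one_pow] at this
    exact this.mono_left nhdsWithin_le_nhds

end functionalEquation

/-! ### The generating functions in the Poisson model -/

section genFun

open scoped NNReal

variable {b : ℕ} {α : ℝ}

lemma coe_toNNReal_mul (hα0 : 0 < α) : ((b * α).toNNReal : ℝ) = b * α :=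
  Real.coe_toNNReal _ (by positivity)

/-- The other factor of the functional equation is finite in the closed unit disc. -/
lemma eval_deficitPoly_zeta {r : ℝ} (hb : 1 ≤ b) (hα0 : 0 < α) (hα1 : α < 1) (hr : 1 ≤ r)
    (hρ : driftRate b (b * α) r < 1) (l : ℕ) :
    (deficitPoly b (b * α).toNNReal).eval (zeta b α l) = 0 := by
  rw [← coe_toNNReal_mul hα0] at hρ
  rw [← integral_pow_walkMax hr hρ (integrable_pow_of_norm_le_one (measurable_walkMax b)
    (norm_zeta_le hb hα0 hα1 l)), zeta_pow hb hα0 hα1, coe_toNNReal_mul hα0]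
  push_cast
  rw [sub_self, zero_mul]

/-- The `b` distinct zeros in the closed unit disc determine the polynomial up to a constant. -/
lemma exists_deficitPoly_eval_eq {r : ℝ} (hb : 1 ≤ b) (hα0 : 0 < α) (hα1 : α < 1) (hr : 1 ≤ r)
    (hρ : driftRate b (b * α) r < 1) :
    ∃ c : ℂ, ∀ q, (deficitPoly b (b * α).toNNReal).eval q =
      c * ((q - 1) * ∏ l ∈ Finset.Ico 1 b, (q - zeta b α l)) := by
  set p := deficitPoly b (b * α).toNNReal
  have hdvd : ∏ l ∈ Finset.range b, (Polynomial.X - Polynomial.C (zeta b α l)) ∣ p := by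
    refine Finset.prod_dvd_of_coprime (fun i hi j hj hij => ?_) fun l _ =>
      Polynomial.dvd_iff_isRoot.mpr (eval_deficitPoly_zeta hb hα0 hα1 hr hρ l)
    exact Polynomial.isCoprime_X_sub_C_of_isUnit_sub
      (sub_ne_zero.mpr fun h => hij (zeta_injOn hb hα0 hα1 hi hj h)).isUnit
  obtain ⟨g, hg⟩ := hdvd
  have hg0 : g.natDegree = 0 := by
    by_cases h0 : g = 0
    · simp [h0]
    · have h1 := natDegree_deficitPoly_le b (b * α).toNNReal
      change p.natDegree ≤ b at h1
      rw [hg, (Polynomial.monic_prod_X_sub_C _ _).natDegree_mul' h0,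
        Polynomial.natDegree_finsetProd_X_sub_C_eq_card, Finset.card_range] at h1
      omega
  refine ⟨g.coeff 0, fun q => ?_⟩
  rw [hg, Polynomial.eval_mul, Polynomial.eq_C_of_natDegree_eq_zero hg0, Polynomial.eval_C,
    Polynomial.eval_prod, Polynomial.coeff_C_zero, mul_comm, Finset.range_eq_Ico,
    Finset.prod_eq_prod_Ico_succ_bot hb]
  simp [zeta_zero hα0 hα1]

lemma prod_one_sub_zeta_ne_zero (hb : 1 ≤ b) (hα0 : 0 < α) (hα1 : α < 1) :
    ∏ l ∈ Finset.Ico 1 b, (1 - zeta b α l) ≠ 0 := by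
  refine Finset.prod_ne_zero_iff.mpr fun l hl h => ?_
  obtain ⟨h1, h2⟩ := Finset.mem_Ico.mp hl
  have := zeta_injOn hb hα0 hα1 (Finset.mem_coe.mpr (Finset.mem_range.mpr hb))
    (Finset.mem_coe.mpr (Finset.mem_range.mpr h2))
    ((zeta_zero hα0 hα1).trans (sub_eq_zero.mp h))
  omega

/-- The generating function of the overflow.  The constant is found by comparing both sides of the
functional equation to first order at `q = 1`. -/
lemma integral_pow_walkMax_mul {r : ℝ} (hb : 1 ≤ b) (hα0 : 0 < α) (hα1 : α < 1) (hr : 1 ≤ r)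
    (hρ : driftRate b (b * α) r < 1) {q : ℂ}
    (hq : Integrable (fun x => q ^ walkMax b x) (poissonSeq (b * α).toNNReal)) :
    (q ^ b - Complex.exp (b * α * (q - 1))) *
        (∫ x, q ^ walkMax b x ∂poissonSeq (b * α).toNNReal) *
        ∏ l ∈ Finset.Ico 1 b, (1 - zeta b α l) =
      b * (1 - α) * ((q - 1) * ∏ l ∈ Finset.Ico 1 b, (q - zeta b α l)) := by
  obtain ⟨c, hc⟩ := exists_deficitPoly_eval_eq hb hα0 hα1 hr hρ
  have hfun : ∀ q : ℂ, Integrable (fun x => q ^ walkMax b x) (poissonSeq (b * α).toNNReal) →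
      (q ^ b - Complex.exp (b * α * (q - 1))) *
        ∫ x, q ^ walkMax b x ∂poissonSeq (b * α).toNNReal =
      c * ((q - 1) * ∏ l ∈ Finset.Ico 1 b, (q - zeta b α l)) := by
    intro q hq
    have h := integral_pow_walkMax hr (by rwa [coe_toNNReal_mul hα0]) hq
    rw [hc, coe_toNNReal_mul hα0] at h
    push_cast at h
    exact h
  have hconst : (b : ℂ) - b * α = c * ∏ l ∈ Finset.Ico 1 b, (1 - zeta b α l) := by
    have hd : HasDerivAt (fun q : ℂ => q ^ b - Complex.exp (b * α * (q - 1))) (b - b * α)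
        ((1 : ℝ) : ℂ) := by
      have h1 : HasDerivAt (fun q : ℂ => b * α * (q - 1)) (b * α) ((1 : ℝ) : ℂ) := by
        simpa using ((hasDerivAt_id (((1 : ℝ) : ℂ))).sub_const 1).const_mul ((b : ℂ) * α)
      refine ((hasDerivAt_pow b _).sub h1.cexp).congr_deriv ?_
      simp
    have hs := (hasDerivAt_iff_tendsto_slope.mp hd.comp_ofReal).mono_left
      (nhdsWithin_mono (1 : ℝ) (s := Set.Iio 1) (t := {1}ᶜ) fun x hx => ne_of_lt hx)
    have h1 := hs.mul (tendsto_integral_pow_one (P := poissonSeq (b * α).toNNReal)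
      (measurable_walkMax b))
    rw [mul_one] at h1
    have h2 : Tendsto (fun x : ℝ => c * ∏ l ∈ Finset.Ico 1 b, ((x : ℂ) - zeta b α l)) (𝓝[<] 1)
        (𝓝 (c * ∏ l ∈ Finset.Ico 1 b, (1 - zeta b α l))) := by
      have hcont : Continuous fun x : ℝ => c * ∏ l ∈ Finset.Ico 1 b, ((x : ℂ) - zeta b α l) := by
        fun_prop
      have := hcont.tendsto 1
      rw [Complex.ofReal_one] at this
      exact this.mono_left nhdsWithin_le_nhds
    refine tendsto_nhds_unique (h1.congr' ?_) h2
    filter_upwards [Ioo_mem_nhdsLT (show (0 : ℝ) < 1 by norm_num)] with x hx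
    have hx1 : (x : ℂ) - 1 ≠ 0 := by
      rw [sub_ne_zero]
      exact_mod_cast hx.2.ne
    have hf := hfun x (integrable_pow_of_norm_le_one (measurable_walkMax b) (by
      rw [Complex.norm_real, Real.norm_of_nonneg hx.1.le]; exact hx.2.le))
    rw [slope_def_module]
    simp only [Complex.ofReal_one, one_pow, sub_self, mul_zero, Complex.exp_zero, sub_zero,
      Complex.real_smul]
    push_cast
    rw [mul_assoc, hf]
    field_simp
  rw [hfun q hq, show (b : ℂ) * (1 - α) = b - b * α by ring, hconst]
  ring

lemma pgf_Qinf (hb : 1 ≤ b) (hα0 : 0 < α) (q : ℂ) :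
    pgf (poissonModel b α) (Qinf b) q =
      ∫ x, q ^ walkMax b x ∂poissonSeq (b * α).toNNReal := by
  have hsm : StronglyMeasurable fun c : ℕ => q ^ c := StronglyMeasurable.of_discrete
  rw [pgf, ← integral_map (f := fun c : ℕ => q ^ c) (measurable_Qinf b).aemeasurable
    hsm.aestronglyMeasurable, map_Qinf hb hα0,
    integral_map (measurable_walkMax b).aemeasurable hsm.aestronglyMeasurable]

lemma integrable_pow_walkMax (hb : 1 ≤ b) (hα0 : 0 < α) {q : ℂ}
    (hq : Integrable (fun ω => q ^ Qinf b ω) (poissonModel b α)) :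
    Integrable (fun x => q ^ walkMax b x) (poissonSeq (b * α).toNNReal) := by
  have hsm : StronglyMeasurable fun c : ℕ => q ^ c := StronglyMeasurable.of_discrete
  have h := (integrable_map_measure (g := fun c : ℕ => q ^ c) hsm.aestronglyMeasurable
    (measurable_Qinf b).aemeasurable).mpr hq
  rw [map_Qinf hb hα0] at h
  exact (integrable_map_measure hsm.aestronglyMeasurable
    (measurable_walkMax b).aemeasurable).mp h

lemma integrable_pow_Qinf {q : ℂ} (hq : Integrable (fun ω => q ^ Cinf b ω) (poissonModel b α)) :
    Integrable (fun ω => q ^ Qinf b ω) (poissonModel b α) := by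
  rcases le_total ‖q‖ 1 with h | h
  · exact integrable_pow_of_norm_le_one (measurable_Qinf b) h
  · refine hq.mono ((StronglyMeasurable.of_discrete (f := fun c : ℕ => q ^ c)).comp_measurable
      (measurable_Qinf b)).aestronglyMeasurable (ae_of_all _ fun ω => ?_)
    rw [norm_pow, norm_pow]
    exact pow_le_pow_right₀ h (Nat.le_add_right _ _)

/-- The generating function of `C` is that of `Q` times that of `V`. -/
lemma pgf_Cinf (hb : 1 ≤ b) (hα0 : 0 < α) (q : ℂ) :
    pgf (poissonModel b α) (Cinf b) q =
      pgf (poissonModel b α) (Qinf b) q * pgf (poissonModel b α) Vinf q := by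
  have hsm : StronglyMeasurable fun c : ℕ => q ^ c := StronglyMeasurable.of_discrete
  have h := (indepFun_Qinf_Vinf (b := b) hb hα0).integral_fun_comp_mul_comp
    (f := fun c : ℕ => q ^ c) (g := fun c : ℕ => q ^ c) (measurable_Qinf b).aemeasurable
    measurable_Vinf.aemeasurable hsm.aestronglyMeasurable hsm.aestronglyMeasurable
  unfold pgf
  rw [← h]
  simp_rw [Cinf, pow_add]

lemma integrable_pow_Vinf (hb : 1 ≤ b) (hα0 : 0 < α) (q : ℂ) :
    Integrable (fun ω => q ^ Vinf ω) (poissonModel b α) := by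
  set s := max 1 ‖q‖
  have hs : 1 ≤ s := le_max_left _ _
  have h1 := sizeBiased_poissonModel (b := b) (α := α) (fun _ j => s ^ j) fun i j => by positivity
  have h2 : ∫⁻ x, ∑ v ∈ Finset.range (x 0), ENNReal.ofReal (s ^ v)
      ∂poissonSeq (b * α).toNNReal < ⊤ := by
    refine lt_of_le_of_lt (lintegral_mono fun x => ?_)
      ((poissonDominated_poissonSeq (b * α).toNNReal 1 (fun _ => 2 * s) fun _ => by
        linarith).trans_lt ENNReal.ofReal_lt_top)
    rw [← ENNReal.ofReal_sum_of_nonneg fun v _ => by positivity]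
    refine ENNReal.ofReal_le_ofReal ?_
    simpa using sum_range_pow_le hs (x 0) 0
  rw [← h1] at h2
  have hlam : ENNReal.ofReal (b * α) ≠ 0 :=
    ENNReal.coe_ne_zero.mpr (toNNReal_mul_ne_zero hb hα0)
  have h3 : ∫⁻ ω, ENNReal.ofReal (s ^ Vinf ω) ∂poissonModel b α ≠ ⊤ := fun h => by
    rw [h, ENNReal.mul_top hlam] at h2
    exact absurd h2 (lt_irrefl _)
  refine integrable_comp_of_le (M := (∫⁻ ω, ENNReal.ofReal (s ^ Vinf ω) ∂poissonModel b α).toReal)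
    (s := s) (K := 1) (by positivity) measurable_Vinf ?_ fun c => ?_
  · rw [ENNReal.ofReal_toReal h3]
  · rw [norm_pow, one_mul]
    exact pow_le_pow_left₀ (norm_nonneg q) (le_max_right _ _) c

/-- Summation by parts: the tail probabilities `P(X > c)` have the generating function
`(1 - E q ^ X) / (1 - q)`. -/
lemma pgf_Vinf_mul (hb : 1 ≤ b) (hα0 : 0 < α) (q : ℂ) :
    b * α * (1 - q) * pgf (poissonModel b α) Vinf q = 1 - Complex.exp (b * α * (q - 1)) := by
  set lam := (b * α).toNNReal
  have hb' : (0 : ℝ) < b := by exact_mod_cast hb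
  have hlam0 : 0 < b * α := mul_pos hb' hα0
  have hlamC : ((lam : ℝ) : ℂ) = b * α := by rw [coe_toNNReal_mul hα0]; push_cast; rfl
  set u : ℕ → ℝ := fun c => (poissonSeq lam).real {x | c < x 0}
  set p : ℕ → ℝ := fun c => Real.exp (-lam) * lam ^ c / c.factorial
  have hpm : ∀ c, (poissonSeq lam).real {x | x 0 = c} = p c := fun c => by
    have := poissonSeq_window (lam := lam) {0} fun _ => c
    simpa using this
  have hms : ∀ c, MeasurableSet {x : ℕ → ℕ | x 0 = c} := fun c =>
    (measurable_pi_apply (X := fun _ : ℕ => ℕ) 0) (measurableSet_singleton c)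
  have hu0 : u 0 = 1 - p 0 := by
    rw [← hpm, ← probReal_compl_eq_one_sub (hms 0)]
    change (poissonSeq lam).real _ = _
    congr 1
    ext x
    simp [Nat.pos_iff_ne_zero]
  have hus : ∀ c, u c = u (c + 1) + p (c + 1) := fun c => by
    rw [← hpm]
    change (poissonSeq lam).real _ = (poissonSeq lam).real _ + _
    rw [← measureReal_union ?_ (hms _)]
    · congr 1
      ext x
      simp only [Set.mem_union, Set.mem_ofPred_eq]
      omega
    · rw [Set.disjoint_left]
      intro x hx hx'
      simp only [Set.mem_ofPred_eq] at hx hx'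
      omega
  have hS := hasSum_integral_comp measurable_Vinf (integrable_pow_Vinf (b := b) hb hα0 q)
  simp_rw [sizeBiased_poissonModel.measureReal_tie hlam0 measurable_Vinf] at hS
  have hS' : HasSum (fun c => (u c : ℂ) * q ^ c) (b * α * pgf (poissonModel b α) Vinf q) := by
    have h := hS.mul_left ((b : ℂ) * α)
    refine Eq.subst (motive := fun f => HasSum f _) (funext fun c => ?_) h
    have hα : (b : ℂ) * α ≠ 0 := by exact_mod_cast hlam0.ne'
    rw [Complex.real_smul]
    push_cast
    rw [← mul_assoc, ← mul_assoc, mul_inv_cancel₀ hα, one_mul]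
  have hE : HasSum (fun c => (p c : ℂ) * q ^ c) _ := hasSum_poisson_cpow lam q
  rw [hlamC] at hE
  have h1 := (hasSum_nat_add_iff' 1).mpr hS'
  have h2 := (hasSum_nat_add_iff' 1).mpr hE
  have h3 := (h1.add h2).unique (Eq.subst (motive := fun f => HasSum f _) (funext fun c => ?_)
    (hS'.mul_left q))
  · simp only [Finset.sum_range_one, pow_zero, mul_one, hu0] at h3
    push_cast at h3
    linear_combination h3
  · change q * ((u c : ℂ) * q ^ c) = u (c + 1) * q ^ (c + 1) + (p (c + 1) : ℂ) * q ^ (c + 1)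
    rw [hus c]
    push_cast
    ring

lemma pgf_Vinf (hb : 1 ≤ b) (hα0 : 0 < α) {q : ℂ} (hq : q ≠ 1) :
    pgf (poissonModel b α) Vinf q = (1 - Complex.exp (b * α * (q - 1))) / (b * α * (1 - q)) := by
  have hb' : (b : ℂ) ≠ 0 := by exact_mod_cast (Nat.pos_of_ne_zero (by omega)).ne'
  have hα : (α : ℂ) ≠ 0 := by exact_mod_cast hα0.ne'
  rw [eq_div_iff (mul_ne_zero (mul_ne_zero hb' hα) (sub_ne_zero.mpr hq.symm)), mul_comm]
  exact pgf_Vinf_mul hb hα0 q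

/-- The factor `1 - q` of the overflow cancels against that of `V`. -/
lemma pgf_Cinf_eq {r : ℝ} (hb : 1 ≤ b) (hα0 : 0 < α) (hα1 : α < 1) (hr : 1 ≤ r)
    (hρ : driftRate b (b * α) r < 1) {q : ℂ}
    (hq : Integrable (fun ω => q ^ Cinf b ω) (poissonModel b α))
    (hne : Complex.exp (b * α * (q - 1)) ≠ q ^ b) :
    pgf (poissonModel b α) (Cinf b) q = (1 - α) / α *
      ((1 - Complex.exp (b * α * (q - 1))) / (Complex.exp (b * α * (q - 1)) - q ^ b)) *
      ((∏ l ∈ Finset.Ico 1 b, (q - zeta b α l)) / ∏ l ∈ Finset.Ico 1 b, (1 - zeta b α l)) := by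
  have hb' : (b : ℂ) ≠ 0 := by exact_mod_cast (Nat.pos_of_ne_zero (by omega)).ne'
  have hα : (α : ℂ) ≠ 0 := by exact_mod_cast hα0.ne'
  have hq1 : q ≠ 1 := by
    rintro rfl
    simp at hne
  have hq1' : 1 - q ≠ 0 := sub_ne_zero.mpr hq1.symm
  have hP := prod_one_sub_zeta_ne_zero hb hα0 hα1
  have h := integral_pow_walkMax_mul hb hα0 hα1 hr hρ
    (integrable_pow_walkMax hb hα0 (integrable_pow_Qinf hq))
  rw [← pgf_Qinf hb hα0] at h
  rw [pgf_Cinf hb hα0, pgf_Vinf hb hα0 hq1]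
  set E := Complex.exp (b * α * (q - 1))
  set A := ∏ l ∈ Finset.Ico 1 b, (q - zeta b α l)
  set B := ∏ l ∈ Finset.Ico 1 b, (1 - zeta b α l)
  set F := pgf (poissonModel b α) (Qinf b) q
  have hne' : E - q ^ b ≠ 0 := sub_ne_zero.mpr hne
  have hF : F = b * (1 - α) * ((1 - q) * A) / ((E - q ^ b) * B) := by
    rw [eq_div_iff (mul_ne_zero hne' hP)]
    linear_combination -h
  rw [hF]
  field_simp

end genFun

/-! ### The displacement in the Poisson model -/

section rootsOfUnity

variable {b : ℕ} {α : ℝ}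

/-- Orthogonality of the characters of the cyclic group of order `b`. -/
lemma sum_rootU_pow_mul (hb : 1 ≤ b) {z : ℂ} (hz : z ≠ 0) {r s : ℕ} (hr : r < b) (hs : s < b) :
    ∑ j ∈ Finset.range b, (rootU b ^ j * z) ^ s * ((rootU b ^ j * z)⁻¹) ^ r =
      if r = s then (b : ℂ) else 0 := by
  have hω := rootU_isPrimitiveRoot hb
  have hω0 : rootU b ≠ 0 := hω.ne_zero (by omega)
  set x : ℂ := rootU b ^ s * (rootU b ^ r)⁻¹ with hx
  have h1 : ∀ j, (rootU b ^ j * z) ^ s * ((rootU b ^ j * z)⁻¹) ^ r =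
      z ^ s * (z ^ r)⁻¹ * x ^ j := fun j => by
    rw [hx, inv_pow, mul_pow, mul_pow, mul_pow, mul_inv, inv_pow, ← pow_mul, ← pow_mul, ← pow_mul,
      ← pow_mul, mul_comm j s, mul_comm j r]
    ring
  simp_rw [h1]
  rw [← Finset.mul_sum]
  split_ifs with h
  · have hx1 : x = 1 := by rw [hx, h, mul_inv_cancel₀ (pow_ne_zero _ hω0)]
    rw [h, mul_inv_cancel₀ (pow_ne_zero _ hz), hx1]
    simp
  · have hx1 : x ≠ 1 := fun h1 => h (hω.pow_inj hs hr
      ((mul_inv_eq_one₀ (pow_ne_zero _ hω0)).mp h1)).symm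
    have hxb : x ^ b = 1 := by
      rw [hx, mul_pow, inv_pow, ← pow_mul, ← pow_mul, mul_comm s, mul_comm r, pow_mul, pow_mul,
        hω.pow_eq_one]
      simp
    rw [geom_sum_eq hx1, hxb, sub_self, zero_div, mul_zero]

lemma rootU_pow_mul_pow (hb : 1 ≤ b) {q z : ℂ} (hz : z ^ b = q) (j : ℕ) :
    (rootU b ^ j * z) ^ b = q := by
  rw [mul_pow, ← pow_mul, mul_comm j, pow_mul, (rootU_isPrimitiveRoot hb).pow_eq_one, one_pow,
    one_mul, hz]

/-- The roots-of-unity filter extracting `q ^ ⌊c / b⌋`. -/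
lemma rootsOfUnity_filter (hb : 1 ≤ b) {q z : ℂ} (hz : z ^ b = q) (hq0 : q ≠ 0) (c : ℕ) :
    ∑ j ∈ Finset.range b, (rootU b ^ j * z) ^ c *
      ∑ r ∈ Finset.range b, ((rootU b ^ j * z)⁻¹) ^ r = b * q ^ (c / b) := by
  have hz0 : z ≠ 0 := by
    rintro rfl
    exact hq0 (by rw [← hz, zero_pow (by omega)])
  have hs : c % b < b := Nat.mod_lt _ hb
  have h1 : ∀ j, (rootU b ^ j * z) ^ c = q ^ (c / b) * (rootU b ^ j * z) ^ (c % b) := fun j => by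
    conv_lhs => rw [← Nat.div_add_mod c b, pow_add, pow_mul, rootU_pow_mul_pow hb hz]
  simp_rw [h1, mul_assoc (q ^ (c / b)), Finset.mul_sum]
  rw [Finset.sum_comm]
  simp_rw [← Finset.mul_sum]
  rw [Finset.sum_congr rfl fun r hr => sum_rootU_pow_mul hb hz0 (Finset.mem_range.mp hr) hs,
    Finset.sum_ite_eq', if_pos (Finset.mem_range.mpr hs), mul_comm]

/-- `‖w‖ ^ C` and `‖q‖ ^ ⌊C / b⌋` agree up to a bounded factor. -/
lemma integrable_pow_Cinf_of_Dinf {q w : ℂ} (hb : 1 ≤ b) (hw : w ^ b = q)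
    (hq : Integrable (fun ω => q ^ Dinf b ω) (poissonModel b α)) :
    Integrable (fun ω => w ^ Cinf b ω) (poissonModel b α) := by
  refine (hq.norm.const_mul (max 1 ‖w‖ ^ b)).mono'
    ((StronglyMeasurable.of_discrete (f := fun c : ℕ => w ^ c)).comp_measurable
      (measurable_Cinf b)).aestronglyMeasurable (ae_of_all _ fun ω => ?_)
  have h1 : w ^ Cinf b ω = q ^ Dinf b ω * w ^ (Cinf b ω % b) := by
    conv_lhs => rw [← Nat.div_add_mod (Cinf b ω) b, pow_add, pow_mul, hw]
    rfl
  rw [h1, norm_mul, norm_pow w, mul_comm]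
  refine mul_le_mul_of_nonneg_right ?_ (norm_nonneg _)
  exact (pow_le_pow_left₀ (norm_nonneg w) (le_max_right _ _) _).trans
    (pow_le_pow_right₀ (le_max_left _ _) (Nat.mod_lt _ hb).le)

lemma pgf_Dinf {q z : ℂ} (hb : 1 ≤ b) (hz : z ^ b = q) (hq0 : q ≠ 0) (hq1 : q ≠ 1)
    (hq : Integrable (fun ω => q ^ Dinf b ω) (poissonModel b α)) :
    pgf (poissonModel b α) (Dinf b) q = 1 / b * ∑ j ∈ Finset.range b,
      pgf (poissonModel b α) (Cinf b) (rootU b ^ j * z) *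
        ((1 - q⁻¹) / (1 - (rootU b ^ j)⁻¹ * z⁻¹)) := by
  have hb' : (b : ℂ) ≠ 0 := by exact_mod_cast (Nat.pos_of_ne_zero (by omega)).ne'
  have hgeom : ∀ j, (1 - q⁻¹) / (1 - (rootU b ^ j)⁻¹ * z⁻¹) =
      ∑ r ∈ Finset.range b, ((rootU b ^ j * z)⁻¹) ^ r := by
    intro j
    have hw := rootU_pow_mul_pow hb hz j
    have hne : (rootU b ^ j * z)⁻¹ ≠ 1 := fun h => hq1 (by
      rw [← hw, inv_eq_one.mp h, one_pow])
    rw [geom_sum_eq hne, inv_pow, hw, mul_inv, ← neg_div_neg_eq, neg_sub, neg_sub]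
  simp_rw [hgeom]
  unfold pgf
  simp_rw [← integral_mul_const]
  rw [← integral_finsetSum _ fun j _ =>
    (integrable_pow_Cinf_of_Dinf hb (rootU_pow_mul_pow hb hz j) hq).mul_const _]
  simp_rw [rootsOfUnity_filter hb hz hq0]
  rw [integral_const_mul, ← mul_assoc, one_div, inv_mul_cancel₀ hb', one_mul]
  rfl

end rootsOfUnity

/-! ### Convergence of the exact model to the Poisson model -/

section tilted

lemma measureReal_preimage_div {Ω : Type*} [MeasurableSpace Ω] {P : Measure Ω} [IsFiniteMeasure P]
    {Y : Ω → ℕ} (hY : Measurable Y) {b : ℕ} (hb : 1 ≤ b) (d : ℕ) :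
    P.real ((fun ω => Y ω / b) ⁻¹' {d}) =
      ∑ c ∈ Finset.Ico (d * b) ((d + 1) * b), P.real (Y ⁻¹' {c}) := by
  have h : (fun ω => Y ω / b) ⁻¹' {d} =
      ⋃ c ∈ Finset.Ico (d * b) ((d + 1) * b), Y ⁻¹' {c} := by
    ext ω
    simp only [Set.mem_preimage, Set.mem_singleton_iff, Set.mem_iUnion, Finset.mem_Ico,
      exists_prop, exists_eq_right']
    rw [← Nat.le_div_iff_mul_le hb, ← Nat.div_lt_iff_lt_mul hb]
    omega
  rw [h, measureReal_biUnion_finset (fun i _ j _ hij => ?_) fun c _ =>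
    hY (measurableSet_singleton c)]
  rw [Function.onFun, Set.disjoint_left]
  intro ω hi hj
  exact hij ((Set.mem_singleton_iff.mp hi).symm.trans (Set.mem_singleton_iff.mp hj))

variable {Ω : ℕ → Type*} [∀ k, MeasurableSpace (Ω k)] {P : ∀ k, Measure (Ω k)}
  {Y Z : ∀ k, Ω k → ℕ} {Ω' : Type*} [MeasurableSpace Ω'] {P' : Measure Ω'} {Y' Z' : Ω' → ℕ}
  {s M : ℝ}

lemma TiltedConv.of_le (h : TiltedConv P Y P' Y' s M) (hs : 1 ≤ s) (hZ : ∀ k, Measurable (Z k))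
    (hZ' : Measurable Z') (hle : ∀ᶠ k in atTop, ∀ ω, Z k ω ≤ Y k ω) (hle' : ∀ ω, Z' ω ≤ Y' ω)
    (hconv : ∀ c, Tendsto (fun k => (P k).real (Z k ⁻¹' {c})) atTop (𝓝 (P'.real (Z' ⁻¹' {c})))) :
    TiltedConv P Z P' Z' s M where
  meas := hZ
  meas' := hZ'
  bound := by
    filter_upwards [h.bound, hle] with k hk hlek
    exact (lintegral_mono fun ω => ENNReal.ofReal_le_ofReal
      (pow_le_pow_right₀ hs (hlek ω))).trans hk
  bound' := (lintegral_mono fun ω => ENNReal.ofReal_le_ofReal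
    (pow_le_pow_right₀ hs (hle' ω))).trans h.bound'
  conv := hconv

lemma TiltedConv.div [∀ k, IsFiniteMeasure (P k)] [IsFiniteMeasure P']
    (h : TiltedConv P Y P' Y' s M) (hs : 1 ≤ s) {b : ℕ} (hb : 1 ≤ b)
    (hZ : ∀ k, Measurable (Z k)) (hdiv : ∀ᶠ k in atTop, ∀ ω, Z k ω = Y k ω / b) :
    TiltedConv P Z P' (fun ω => Y' ω / b) s M := by
  refine h.of_le hs hZ ((Measurable.of_discrete (f := fun c : ℕ => c / b)).comp h.meas') ?_
    (fun ω => Nat.div_le_self _ _) fun d => ?_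
  · filter_upwards [hdiv] with k hk ω
    exact (hk ω).trans_le (Nat.div_le_self _ _)
  · rw [measureReal_preimage_div h.meas' hb]
    refine (tendsto_finsetSum _ fun c _ => h.conv c).congr' ?_
    filter_upwards [hdiv] with k hk
    rw [← measureReal_preimage_div (h.meas k) hb, ← funext hk]

end tilted

section drift

/-- Below full load the walk has negative drift. -/
lemma exists_driftRate_lt_one {b : ℕ} {lam : ℝ} (h0 : 0 < lam) (hlt : lam < b) :
    ∃ r, 1 < r ∧ driftRate b lam r < 1 := by
  have hb : (0 : ℝ) < b := h0.trans hlt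
  obtain ⟨r, hr1, hr2⟩ := exists_between ((one_lt_div h0).mpr hlt)
  have hr0 : 0 < r := one_pos.trans hr1
  refine ⟨r, hr1, ?_⟩
  rw [driftRate, div_lt_one (by positivity), ← Real.exp_log (pow_pos hr0 b), Real.exp_lt_exp,
    Real.log_pow]
  calc lam * (r - 1) < b / r * (r - 1) := by
        refine mul_lt_mul_of_pos_right ?_ (by linarith)
        rwa [lt_div_iff₀ hr0, mul_comm, ← lt_div_iff₀ h0]
    _ = b * (1 - r⁻¹) := by field_simp
    _ ≤ b * Real.log r :=
        mul_le_mul_of_nonneg_left (Real.one_sub_inv_le_log_of_pos hr0) hb.le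

lemma driftRate_mono (b : ℕ) {lam lam' r : ℝ} (hr : 1 ≤ r) (h : lam ≤ lam') :
    driftRate b lam r ≤ driftRate b lam' r := by
  refine div_le_div_of_nonneg_right (Real.exp_le_exp.mpr ?_) (by positivity)
  exact mul_le_mul_of_nonneg_right h (by linarith)

end drift

section exactLimit

variable {b : ℕ} {α lam r : ℝ} {m n : ℕ → ℕ}

lemma tendsto_load (hb : 1 ≤ b) (h : Tendsto (fun k => (n k : ℝ) / (b * m k)) atTop (𝓝 α)) :
    Tendsto (fun k => (n k : ℝ) / m k) atTop (𝓝 (b * α)) := by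
  refine (h.const_mul (b : ℝ)).congr fun k => ?_
  have hb' : (b : ℝ) ≠ 0 := by exact_mod_cast (Nat.pos_of_ne_zero (by omega)).ne'
  field_simp

lemma eventually_lt_mul [∀ k, NeZero (m k)] (hα1 : α < 1) (hb : 1 ≤ b)
    (h : Tendsto (fun k => (n k : ℝ) / (b * m k)) atTop (𝓝 α)) :
    ∀ᶠ k in atTop, n k < b * m k := by
  filter_upwards [h.eventually_lt_const hα1] with k hk
  have hm : (0 : ℝ) < m k := by exact_mod_cast Nat.pos_of_ne_zero (NeZero.ne (m k))
  have hb' : (0 : ℝ) < b := by exact_mod_cast hb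
  rw [div_lt_one (by positivity)] at hk
  exact_mod_cast hk

variable [∀ k, NeZero (m k)] [∀ k, NeZero (n k)]

/-- Both models are size-biased averages, over tables whose counts converge and have uniform
exponential moments. -/
lemma tiltedConv_Cex (hb : 1 ≤ b) (hα0 : 0 < α) (hα1 : α < 1) (hlam : b * α < lam) (hr : 1 ≤ r)
    (hρ : driftRate b lam r < 1) (σ : ∀ k, Equiv.Perm (Fin (n k))) (hm : Tendsto m atTop atTop)
    (hn : Tendsto n atTop atTop) (h : Tendsto (fun k => (n k : ℝ) / (b * m k)) atTop (𝓝 α)) :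
    TiltedConv (fun k => exactModel (m k) (n k)) (fun k => Cex (m := m k) b (σ k))
      (poissonModel b α) (Cinf b) r
      ((b * α / 2)⁻¹ * (Real.exp (lam * (2 * r - 1)) * (1 - driftRate b lam r)⁻¹)) := by
  have hb' : (0 : ℝ) < b := by exact_mod_cast hb
  have hα : 0 < b * α := mul_pos hb' hα0
  have hload := tendsto_load hb h
  have hpos : ∀ k, (0 : ℝ) < n k / m k := fun k => div_pos
    (by exact_mod_cast Nat.pos_of_ne_zero (NeZero.ne (n k)))
    (by exact_mod_cast Nat.pos_of_ne_zero (NeZero.ne (m k)))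
  have h1ρ : 0 < 1 - driftRate b lam r := by linarith
  have hdom' : PoissonDominated (poissonSeq (b * α).toNNReal) lam := by
    refine (poissonDominated_poissonSeq _).mono ?_
    rw [coe_toNNReal_mul hα0]
    exact hlam.le
  have hdom : ∀ᶠ k in atTop, PoissonDominated (countsLaw (m k) (n k)) lam := by
    filter_upwards [hload.eventually_le_const hlam] with k hk
    exact PoissonDominated.mono (fun L w hw => lintegral_countsLaw_le L w hw) hk
  have hbias := eventually_lt_mul (n := n) hα1 hb h
  have hwin : WindowConv (fun k => countsLaw (m k) (n k)) (poissonSeq (b * α).toNNReal) :=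
    windowConv_countsLaw hm hn (by rwa [coe_toNNReal_mul hα0])
  have hM : ∀ x, b * α / 2 ≤ x → ENNReal.ofReal
      (x⁻¹ * (Real.exp (lam * (2 * r - 1)) * (1 - driftRate b lam r)⁻¹)) ≤ ENNReal.ofReal
        ((b * α / 2)⁻¹ * (Real.exp (lam * (2 * r - 1)) * (1 - driftRate b lam r)⁻¹)) := by
    intro x hx
    refine ENNReal.ofReal_le_ofReal (mul_le_mul_of_nonneg_right ?_ (by positivity))
    exact inv_anti₀ (by positivity) hx
  refine ⟨fun k => Measurable.of_discrete, measurable_Cinf b, ?_, ?_, fun c => ?_⟩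
  · filter_upwards [hbias, hdom, hload.eventually_const_le (half_lt_self hα)] with k hk hdk hl
    exact ((sizeBiased_exactModel (σ k) hk).lintegral_pow_le (hpos k) hdk hr hρ).trans (hM _ hl)
  · exact (sizeBiased_poissonModel.lintegral_pow_le hα hdom' hr hρ).trans
      (hM _ (half_le_self hα.le))
  · have hlim := (hload.inv₀ hα.ne').mul (tendsto_finsetSum (Finset.range (c + 1)) fun v _ =>
      tendsto_inflow_and_lt hwin hdom hdom' hr hρ (c - v) v)
    rw [← sizeBiased_poissonModel.measureReal_add hα (measurable_Qinf b) measurable_Vinf] at hlim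
    refine hlim.congr' ?_
    filter_upwards [hbias] with k hk
    exact ((sizeBiased_exactModel (σ k) hk).measureReal_add (hpos k) Measurable.of_discrete
      Measurable.of_discrete c).symm

lemma tendsto_measureReal_Vex (hb : 1 ≤ b) (hα0 : 0 < α) (hα1 : α < 1)
    (hm : Tendsto m atTop atTop) (hn : Tendsto n atTop atTop)
    (h : Tendsto (fun k => (n k : ℝ) / (b * m k)) atTop (𝓝 α)) (c : ℕ) :
    Tendsto (fun k => (exactModel (m k) (n k)).real (Vex (m := m k) (n := n k) ⁻¹' {c})) atTop
      (𝓝 ((poissonModel b α).real (Vinf ⁻¹' {c}))) := by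
  have hb' : (0 : ℝ) < b := by exact_mod_cast hb
  have hα : 0 < b * α := mul_pos hb' hα0
  have hload := tendsto_load hb h
  have hwin : WindowConv (fun k => countsLaw (m k) (n k)) (poissonSeq (b * α).toNNReal) :=
    windowConv_countsLaw hm hn (by rwa [coe_toNNReal_mul hα0])
  have hlim := (hload.inv₀ hα.ne').mul (tendsto_lt hwin c)
  rw [← sizeBiased_poissonModel.measureReal_tie hα measurable_Vinf] at hlim
  refine hlim.congr' ?_
  filter_upwards [eventually_lt_mul (n := n) hα1 hb h] with k hk
  exact ((sizeBiased_exactModel (Equiv.refl _) hk).measureReal_tie (div_pos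
    (by exact_mod_cast Nat.pos_of_ne_zero (NeZero.ne (n k)))
    (by exact_mod_cast Nat.pos_of_ne_zero (NeZero.ne (m k)))) Measurable.of_discrete c).symm

lemma Dex_eq_div {m n : ℕ} [NeZero m] (hb : 1 ≤ b) (σ : Equiv.Perm (Fin n)) (hn : n ≤ b * m)
    (ω : ExactSpace m n) : Dex b σ ω = Cex b σ ω / b :=
  (legal_exactTable σ hn).disp_eq_div hb ω.2

end exactLimit

end RobinHood

theorem mainTheorem6 (b : ℕ) (hb : 1 ≤ b) (α : ℝ) (hα0 : 0 < α) (hα1 : α < 1) :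
    (∀ q : ℂ,
      Integrable (fun ω => q ^ RobinHood.Vinf ω) (RobinHood.poissonModel b α) ∧
      (q ≠ 1 →
        RobinHood.pgf (RobinHood.poissonModel b α) RobinHood.Vinf q =
          (1 - Complex.exp (b * α * (q - 1))) / (b * α * (1 - q)))) ∧
    (∀ q : ℂ,
      Integrable (fun ω => q ^ RobinHood.Cinf b ω) (RobinHood.poissonModel b α) →
      RobinHood.pgf (RobinHood.poissonModel b α) (RobinHood.Cinf b) q =
          RobinHood.pgf (RobinHood.poissonModel b α) (RobinHood.Qinf b) q *
            RobinHood.pgf (RobinHood.poissonModel b α) RobinHood.Vinf q ∧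
      (Complex.exp (b * α * (q - 1)) ≠ q ^ b →
        RobinHood.pgf (RobinHood.poissonModel b α) (RobinHood.Cinf b) q =
          (1 - α) / α *
            ((1 - Complex.exp (b * α * (q - 1))) / (Complex.exp (b * α * (q - 1)) - q ^ b)) *
            ((∏ l ∈ Finset.Ico 1 b, (q - RobinHood.zeta b α l)) /
              ∏ l ∈ Finset.Ico 1 b, (1 - RobinHood.zeta b α l)))) ∧
    (∀ q z : ℂ, z ^ b = q → q ≠ 0 → q ≠ 1 →
      Integrable (fun ω => q ^ RobinHood.Dinf b ω) (RobinHood.poissonModel b α) →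
      RobinHood.pgf (RobinHood.poissonModel b α) (RobinHood.Dinf b) q =
        1 / b * ∑ j ∈ Finset.range b,
          RobinHood.pgf (RobinHood.poissonModel b α) (RobinHood.Cinf b)
              (RobinHood.rootU b ^ j * z) *
            ((1 - q⁻¹) / (1 - (RobinHood.rootU b ^ j)⁻¹ * z⁻¹))) ∧
    ∃ δ : ℝ, 0 < δ ∧
      (∀ q : ℂ, ‖q‖ ≤ 1 + δ →
        Integrable (fun ω => q ^ RobinHood.Cinf b ω) (RobinHood.poissonModel b α) ∧
        Integrable (fun ω => q ^ RobinHood.Dinf b ω) (RobinHood.poissonModel b α)) ∧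
      ∀ (m n : ℕ → ℕ) [∀ k, NeZero (m k)] [∀ k, NeZero (n k)]
        (σ : ∀ k, Equiv.Perm (Fin (n k))),
        Tendsto m atTop atTop → Tendsto n atTop atTop →
        Tendsto (fun k => (n k : ℝ) / (b * m k)) atTop (𝓝 α) →
        (TendstoInDistribution (fun k => RobinHood.Vex (m := m k) (n := n k)) atTop
            RobinHood.Vinf (fun k => RobinHood.exactModel (m k) (n k))
            (RobinHood.poissonModel b α) ∧
          TendstoInDistribution (fun k => RobinHood.Cex (m := m k) b (σ k)) atTop
            (RobinHood.Cinf b) (fun k => RobinHood.exactModel (m k) (n k))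
            (RobinHood.poissonModel b α) ∧
          TendstoInDistribution (fun k => RobinHood.Dex (m := m k) b (σ k)) atTop
            (RobinHood.Dinf b) (fun k => RobinHood.exactModel (m k) (n k))
            (RobinHood.poissonModel b α)) ∧
        (∀ r : ℕ,
          (Integrable (fun ω => (RobinHood.Vinf ω : ℝ) ^ r) (RobinHood.poissonModel b α) ∧
            Tendsto (fun k => RobinHood.moment (RobinHood.exactModel (m k) (n k))
              RobinHood.Vex r) atTop
              (𝓝 (RobinHood.moment (RobinHood.poissonModel b α) RobinHood.Vinf r))) ∧
          (Integrable (fun ω => (RobinHood.Cinf b ω : ℝ) ^ r) (RobinHood.poissonModel b α) ∧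
            Tendsto (fun k => RobinHood.moment (RobinHood.exactModel (m k) (n k))
              (RobinHood.Cex b (σ k)) r) atTop
              (𝓝 (RobinHood.moment (RobinHood.poissonModel b α) (RobinHood.Cinf b) r))) ∧
          (Integrable (fun ω => (RobinHood.Dinf b ω : ℝ) ^ r) (RobinHood.poissonModel b α) ∧
            Tendsto (fun k => RobinHood.moment (RobinHood.exactModel (m k) (n k))
              (RobinHood.Dex b (σ k)) r) atTop
              (𝓝 (RobinHood.moment (RobinHood.poissonModel b α) (RobinHood.Dinf b) r)))) ∧
        TendstoUniformlyOn
          (fun k => RobinHood.pgf (RobinHood.exactModel (m k) (n k)) RobinHood.Vex)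
          (RobinHood.pgf (RobinHood.poissonModel b α) RobinHood.Vinf) atTop
          (Metric.closedBall 0 (1 + δ)) ∧
        TendstoUniformlyOn
          (fun k => RobinHood.pgf (RobinHood.exactModel (m k) (n k)) (RobinHood.Cex b (σ k)))
          (RobinHood.pgf (RobinHood.poissonModel b α) (RobinHood.Cinf b)) atTop
          (Metric.closedBall 0 (1 + δ)) ∧
        TendstoUniformlyOn
          (fun k => RobinHood.pgf (RobinHood.exactModel (m k) (n k)) (RobinHood.Dex b (σ k)))
          (RobinHood.pgf (RobinHood.poissonModel b α) (RobinHood.Dinf b)) atTop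
          (Metric.closedBall 0 (1 + δ)) := by
  have hb' : (0 : ℝ) < b := by exact_mod_cast hb
  -- The exponential moments are controlled uniformly for all loads below `lam / b < 1`.
  obtain ⟨lam, hlam, hlam1⟩ : ∃ lam : ℝ, b * α < lam ∧ lam < b :=
    exists_between (mul_lt_of_lt_one_right hb' hα1)
  have hα : 0 < b * α := mul_pos hb' hα0
  obtain ⟨r, hr1, hρ⟩ := RobinHood.exists_driftRate_lt_one (hα.trans hlam) hlam1
  have hρ' : RobinHood.driftRate b (b * α) r < 1 :=
    (RobinHood.driftRate_mono b hr1.le hlam.le).trans_lt hρ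
  have h1ρ' : 0 < 1 - RobinHood.driftRate b lam r := by linarith
  have hC := RobinHood.sizeBiased_poissonModel.lintegral_pow_le hα
    (by
      have := RobinHood.poissonDominated_poissonSeq (b * α).toNNReal
      rwa [RobinHood.coe_toNNReal_mul hα0] at this) hr1.le hρ'
  refine ⟨fun q => ⟨RobinHood.integrable_pow_Vinf hb hα0 q, RobinHood.pgf_Vinf hb hα0⟩,
    fun q hq => ⟨RobinHood.pgf_Cinf hb hα0 q,
      RobinHood.pgf_Cinf_eq hb hα0 hα1 hr1.le hρ' hq⟩,
    fun q z hz hq0 hq1 hq => RobinHood.pgf_Dinf hb hz hq0 hq1 hq,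
    (r - 1) / 2, by linarith, fun q hq => ?_, ?_⟩
  · have hqr : ‖q‖ ≤ r := by linarith
    have hpow : ∀ c : ℕ, ‖q ^ c‖ ≤ 1 * r ^ c := fun c => by
      rw [norm_pow, one_mul]
      exact pow_le_pow_left₀ (norm_nonneg q) hqr c
    have hr0 : 0 < r := one_pos.trans hr1
    refine ⟨RobinHood.integrable_comp_of_le hr0 (RobinHood.measurable_Cinf b) hC hpow,
      RobinHood.integrable_comp_of_le (f := fun c => q ^ (c / b)) (K := 1) hr0
        (RobinHood.measurable_Cinf b) hC fun c => (hpow (c / b)).trans ?_⟩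
    rw [one_mul, one_mul]
    exact pow_le_pow_right₀ hr1.le (Nat.div_le_self c b)
  · intro m n _ _ σ hm hn h
    have hTC := RobinHood.tiltedConv_Cex hb hα0 hα1 hlam hr1.le hρ σ hm hn h
    have hTV := hTC.of_le (Z := fun k => RobinHood.Vex (m := m k) (n := n k))
      (Z' := RobinHood.Vinf) hr1.le (fun k => Measurable.of_discrete) RobinHood.measurable_Vinf
      (Eventually.of_forall fun k ω => Nat.le_add_left _ _) (fun ω => Nat.le_add_left _ _)
      (RobinHood.tendsto_measureReal_Vex hb hα0 hα1 hm hn h)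
    have hTD := hTC.div (Z := fun k => RobinHood.Dex (m := m k) b (σ k)) hr1.le hb
      (fun k => Measurable.of_discrete)
      ((RobinHood.eventually_lt_mul (n := n) hα1 hb h).mono fun k hk ω =>
        RobinHood.Dex_eq_div hb (σ k) hk.le ω)
    -- The radius `1 + δ` lies strictly between `1` and the base `r` of the exponential moments.
    have ht1 : 1 < 1 + (r - 1) / 2 := by linarith
    have htr : 1 + (r - 1) / 2 < r := by linarith
    have ht0 : 0 < 1 + (r - 1) / 2 := by linarith
    have hM : 0 ≤ (b * α / 2)⁻¹ *
        (Real.exp (lam * (2 * r - 1)) * (1 - RobinHood.driftRate b lam r)⁻¹) := by positivity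
    exact ⟨⟨hTV.tendstoInDistribution hr1 hM, hTC.tendstoInDistribution hr1 hM,
        hTD.tendstoInDistribution hr1 hM⟩,
      fun p => ⟨hTV.tendsto_moment ht1 htr hM p, hTC.tendsto_moment ht1 htr hM p,
        hTD.tendsto_moment ht1 htr hM p⟩,
      hTV.tendstoUniformlyOn_pgf ht0 htr hM, hTC.tendstoUniformlyOn_pgf ht0 htr hM,
      hTD.tendstoUniformlyOn_pgf ht0 htr hM⟩
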